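/- Let $\ell>0$ and $\alpha>0$. Let $\Lambda_\ell=(\mathbb R/\ell\mathbb Z)^3$ be the cube of side length $\ell$ with periodic boundary conditions, let $\mathcal F=\bigoplus_{n\ge 0}\bigotimes^n_{\rm sym}L^2(\mathbb R^3)$ be the bosonic Fock space over $L^2(\mathbb R^3)$, and let $\mathscr H_\ell=L^2(\Lambda_\ell)\otimes\mathcal F$, whose elements are the sequences $\Psi=(\Psi^{(n)})_{n\ge0}$ of functions $\Psi^{(n)}(x,y_1,\dots,y_n)$ in $L^2(\Lambda_\ell\times\mathbb R^{3n})$, symmetric in $y_1,\dots,y_n$, with $\sum_n\|\Psi^{(n)}\|^2<\infty$. Consider on $\mathscr H_\ell$ $$h_\ell=(-\mathrm i\nabla_x-P_f)^2+N+\sqrt\alpha\,\phi(v),$$ where $P_f=\mathrm d\Gamma(-\mathrm i\nabla)$, that is, $(P_f\Psi)^{(n)}=\sum_{i=1}^n-\mathrm i\nabla_{y_i}\Psi^{(n)}$, where $(N\Psi)^{(n)}=n\Psi^{(n)}$, and where $\phi(v)=a(v)+a^*(v)$ with $v(y)=|y|^{-2}$ and $$(a(v)\Psi)^{(n)}(x,y_1,\dots,y_n)=\sqrt{n+1}\int_{\mathbb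 R^3}v(y)\,\Psi^{(n+1)}(x,y,y_1,\dots,y_n)\,dy .$$ Since $v\notin L^2(\mathbb R^3)$, $h_\ell$ is understood as the self-adjoint operator associated with the quadratic form $$\Psi\mapsto\|(-\mathrm i\nabla_x-P_f)\Psi\|^2+\|N^{1/2}\Psi\|^2+2\sqrt\alpha\,\operatorname{Re}\langle\Psi,a(v)\Psi\rangle$$ on the form domain of $(-\mathrm i\nabla_x-P_f)^2+N$, i.e. on the set of all $\Psi\in\mathscr H_\ell$ for which $(-\mathrm i\nabla_x-P_f)\Psi$ (in the weak sense) and $N^{1/2}\Psi$ are square integrable. Here $\langle\Psi,a(v)\Psi\rangle$ means $\sum_n\langle\Psi^{(n)},(a(v)\Psi)^{(n)}\rangle$. If $\inf\sigma(h_\ell)$ is an eigenvalue of $h_\ell$, then this eigenvalue has multiplicity one, i.e. its eigenspace is one-dimensional over $\mathbb C$. -/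

import Mathlib

open MeasureTheory
open scoped ContDiff ComplexConjugate

noncomputable section

namespace Polaron

/-! ### Unbounded operators, given by their graphs -/

section Operators

variable {H : Type*} [NormedAddCommGroup H] [InnerProductSpace ℂ H]

/-- The graph of the operator associated with a sesquilinear form `q` (antilinear in the first
argument) with form domain `D`: a pair `(Ψ, Φ)` belongs to it iff `Ψ ∈ D` and
`q(Θ, Ψ) = ⟨Θ, Φ⟩` for all `Θ ∈ D`. -/
def formOperator (D : Set H) (q : H → H → ℂ) : Set (H × H) :=
  {p | p.1 ∈ D ∧ ∀ Θ ∈ D, q Θ p.1 = inner ℂ Θ p.2}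

/-- `z` lies in the resolvent set of the operator with graph `A` iff `A - z` has an everywhere
defined bounded two-sided inverse `R`, that is, `(A - z) Ψ = Φ ↔ Ψ = R Φ`. -/
def opResolventSet (A : Set (H × H)) : Set ℂ :=
  {z | ∃ R : H →L[ℂ] H, ∀ Φ Ψ : H, (Ψ, Φ + z • Ψ) ∈ A ↔ Ψ = R Φ}

/-- The spectrum: the complement of the resolvent set. -/
def opSpectrum (A : Set (H × H)) : Set ℂ := (opResolventSet A)ᶜ

/-- The set of all `Ψ` in the domain of `A` with `A Ψ = z Ψ`. -/
def opEigenspace (A : Set (H × H)) (z : ℂ) : Set H := {Ψ | (Ψ, z • Ψ) ∈ A}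

/-- `z` is an eigenvalue of `A`. -/
def IsOpEigenvalue (A : Set (H × H)) (z : ℂ) : Prop := ∃ Ψ ∈ opEigenspace A z, Ψ ≠ 0

/-- The eigenspace of `A` for `z` is a one-dimensional complex subspace. -/
def HasOpMultiplicityOne (A : Set (H × H)) (z : ℂ) : Prop :=
  ∃ Ψ₀ : H, Ψ₀ ≠ 0 ∧ opEigenspace A z = (Submodule.span ℂ {Ψ₀} : Set H)

end Operators

/-! ### The Hilbert space `L²(Λ_ℓ) ⊗ 𝓕` -/

/-- Three-dimensional Euclidean space. -/
abbrev E3 : Type := EuclideanSpace ℝ (Fin 3)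

/-- The cube of side length `ℓ` with periodic boundary conditions, `(ℝ / ℓℤ)³`; its volume
is `ℓ³`. -/
abbrev Torus (ℓ : ℝ) : Type := Fin 3 → AddCircle ℓ

/-- Configurations `(x, y₁, …, yₙ)` of the electron on the torus and of `n` phonons. -/
abbrev Config (ℓ : ℝ) (n : ℕ) : Type := Torus ℓ × (Fin n → E3)

/-- Permutation of the phonon coordinates. -/
def permute (ℓ : ℝ) {n : ℕ} (σ : Equiv.Perm (Fin n)) (z : Config ℓ n) : Config ℓ n :=
  (z.1, fun i => z.2 (σ i))

variable (ℓ : ℝ) [Fact (0 < ℓ)]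

/-- `L²(Λ_ℓ × ℝ³ⁿ)` with Lebesgue measure. -/
abbrev L2 (n : ℕ) : Type := Lp ℂ 2 (volume : Measure (Config ℓ n))

theorem measurePreserving_permute {n : ℕ} (σ : Equiv.Perm (Fin n)) :
    MeasurePreserving (permute ℓ σ) (volume : Measure (Config ℓ n)) volume := by
  have h : MeasurePreserving (fun (y : Fin n → E3) (i : Fin n) => y (σ i)) volume volume := by
    have h' := volume_measurePreserving_piCongrLeft (fun _ : Fin n => E3) σ.symm
    have e : (fun (y : Fin n → E3) (i : Fin n) => y (σ i)) =
        MeasurableEquiv.piCongrLeft (fun _ : Fin n => E3) σ.symm := by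
      funext y i
      have h2 := Equiv.piCongrLeft_apply_apply (fun _ : Fin n => E3) σ.symm y (σ i)
      rw [Equiv.symm_apply_apply] at h2
      exact h2.symm
    rw [e]
    exact h'
  exact (MeasurePreserving.id (volume : Measure (Torus ℓ))).prod h

/-- The `n`-phonon sector `L²(Λ_ℓ) ⊗ (⊗ⁿ_sym L²(ℝ³))`: the square-integrable functions
`Ψ⁽ⁿ⁾(x, y₁, …, yₙ)` that are symmetric in `y₁, …, yₙ`. -/
def sector (n : ℕ) : Submodule ℂ (L2 ℓ n) where
  carrier := {f | ∀ σ : Equiv.Perm (Fin n),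
    Lp.compMeasurePreserving (permute ℓ σ) (measurePreserving_permute ℓ σ) f = f}
  zero_mem' := fun σ => map_zero _
  add_mem' := fun {f g} hf hg σ => by rw [map_add, hf σ, hg σ]
  smul_mem' := fun c f hf σ => by
    have h := (Lp.compMeasurePreservingₗ (E := ℂ) (p := 2) ℂ (permute ℓ σ)
      (measurePreserving_permute ℓ σ)).map_smul c f
    exact h.trans (congrArg (c • ·) (hf σ))

/-- The Hilbert space `L²(Λ_ℓ) ⊗ 𝓕 = ⨁ₙ L²(Λ_ℓ) ⊗ (⊗ⁿ_sym L²(ℝ³))` (Hilbert sum). -/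
abbrev Space : Type := lp (fun n : ℕ => sector ℓ n) 2

variable {ℓ}

/-- The `n`-phonon component of a state. -/
def comp (Ψ : Space ℓ) (n : ℕ) : L2 ℓ n := (Ψ n : L2 ℓ n)

/-! ### The components of `-i∇_x - P_f` -/

/-- The motion `(x, y₁, …, yₙ) ↦ (x + t, y₁ - t, …, yₙ - t)`. -/
def shift {n : ℕ} (t : E3) (z : Config ℓ n) : Config ℓ n :=
  (fun j => z.1 j + ((t j : ℝ) : AddCircle ℓ), fun i => z.2 i - t)

/-- The classical derivative `(∂_{x_j} - ∑ᵢ ∂_{y_{i,j}}) η`. -/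
def relDeriv {n : ℕ} (j : Fin 3) (η : Config ℓ n → ℂ) (z : Config ℓ n) : ℂ :=
  deriv (fun s : ℝ => η (shift (s • EuclideanSpace.single j (1 : ℝ)) z)) 0

/-- Test functions on `Λ_ℓ × ℝ³ⁿ`: smooth, `ℓ`-periodic in `x`, compactly supported. -/
def IsTestFunction {n : ℕ} (η : Config ℓ n → ℂ) : Prop :=
  ContDiff ℝ ∞ (fun p : E3 × (Fin n → E3) =>
    η (fun j => ((p.1 j : ℝ) : AddCircle ℓ), p.2)) ∧
  HasCompactSupport η

/-- `g = (∂_{x_j} - ∑ᵢ ∂_{y_{i,j}}) f` in the weak sense. -/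
def IsWeakRelDeriv {n : ℕ} (j : Fin 3) (f g : L2 ℓ n) : Prop :=
  ∀ η : Config ℓ n → ℂ, IsTestFunction η →
    ∫ z, relDeriv j η z * f z = - ∫ z, η z * g z

open Classical in
/-- The weak derivative `(∂_{x_j} - ∑ᵢ ∂_{y_{i,j}}) f` (set to `0` if it does not exist
in `L²`). Since `P_f = ∑ᵢ -i∇_{y_i}` on `n` phonons, `-i` times it is the `j`-th component of
`(-i∇_x - P_f) f`. -/
def weakRelDeriv {n : ℕ} (j : Fin 3) (f : L2 ℓ n) : L2 ℓ n :=
  if h : ∃ g, IsWeakRelDeriv j f g then h.choose else 0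

/-- The `j`-th component of `(-i∇_x - P_f) f`. -/
def relMomentum {n : ℕ} (j : Fin 3) (f : L2 ℓ n) : L2 ℓ n :=
  (-Complex.I) • weakRelDeriv j f

/-! ### The annihilation operator -/

/-- The form factor `v(y) = |y|⁻²`. -/
def formFactor (y : E3) : ℝ := 1 / ‖y‖ ^ 2

/-- `(a(v) f)(x, y₁, …, yₙ) = √(n+1) ∫ v(y) f(x, y, y₁, …, yₙ) dy`. -/
def annihilate {n : ℕ} (f : L2 ℓ (n + 1)) (z : Config ℓ n) : ℂ :=
  (Real.sqrt (n + 1) : ℂ) *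
    ∫ y : E3, (formFactor y : ℂ) * f (z.1, (Fin.cons y z.2 : Fin (n + 1) → E3))

/-! ### The Hamiltonian `h_ℓ = (-i∇_x - P_f)² + N + √α φ(v)` -/

variable (ℓ)

/-- The form domain of `(-i∇_x - P_f)² + N`: all `Ψ` such that `(-i∇_x - P_f) Ψ` and
`N^{1/2} Ψ` are square integrable. -/
def formDomain : Set (Space ℓ) :=
  {Ψ | (∀ (n : ℕ) (j : Fin 3), ∃ g, IsWeakRelDeriv j (comp Ψ n) g) ∧
    Summable (fun n : ℕ => ∑ j : Fin 3, ‖relMomentum j (comp Ψ n)‖ ^ 2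
      + (n : ℝ) * ‖comp Ψ n‖ ^ 2)}

/-- `⟨(-i∇_x - P_f) Θ, (-i∇_x - P_f) Ψ⟩ + ⟨N^{1/2} Θ, N^{1/2} Ψ⟩`. -/
def freeForm (Θ Ψ : Space ℓ) : ℂ :=
  ∑' n : ℕ, (∑ j : Fin 3, inner ℂ (relMomentum j (comp Θ n)) (relMomentum j (comp Ψ n))
    + (n : ℂ) * inner ℂ (comp Θ n) (comp Ψ n))

/-- `⟨Θ, φ(v) Ψ⟩ = ⟨Θ, a(v) Ψ⟩ + ⟨a(v) Θ, Ψ⟩`. -/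
def interactionForm (Θ Ψ : Space ℓ) : ℂ :=
  ∑' n : ℕ, ((∫ z, conj (comp Θ n z) * annihilate (comp Ψ (n + 1)) z)
    + ∫ z, conj (annihilate (comp Θ (n + 1)) z) * comp Ψ n z)

/-- The sesquilinear form of `h_ℓ`. -/
def hamiltonianForm (α : ℝ) (Θ Ψ : Space ℓ) : ℂ :=
  freeForm ℓ Θ Ψ + (Real.sqrt α : ℂ) * interactionForm ℓ Θ Ψ

/-- The graph of `h_ℓ = (-i∇_x - P_f)² + N + √α φ(v)`, the operator associated with its
quadratic form on the form domain of the non-interacting operator. -/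
def hamiltonian (α : ℝ) : Set (Space ℓ × Space ℓ) :=
  formOperator (formDomain ℓ) (hamiltonianForm ℓ α)

end Polaron

end

noncomputable section

namespace Polaron

open Filter Topology
open scoped ENNReal NNReal
set_option linter.unusedSectionVars false

/-! ### Translations along the relative motion -/

section Translations

variable {ℓ : ℝ} [Fact (0 < ℓ)] {n : ℕ}

/-! The argument is of Perron–Frobenius type, carried out entirely with quadratic forms. Conjugation
by `(-1)^N` (`flipSpace`) reverses the sign of the coupling and changes nothing else
(`energyForm_flipSpace`). After it the interaction is `-√α φ(v)`, and since `v ≥ 0` this lowers the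
energy of nonnegative states. The kinetic part is generated by the translations `(x, y) ↦ (x + t, y
- t)`, which preserve nonnegativity, so nonnegative functions with disjoint supports have
nonpositive kinetic overlap. Hence the positive and the negative part of a real ground state are
again ground states (`IsGround.posSpace_negSpace`). The form commutes with complex conjugation, so
real states suffice.

It remains to exclude two nonzero nonnegative ground states with zero overlap. The overlap is
already visible in the vacuum sector. If the vacuum component of a nonnegative ground state
vanishes, the eigenvalue equation in the `n`-th sector forces the `(n+1)`-st component to vanish,
one sector after another (`IsGround.eq_zero_of_comp_zero`). If it does not vanish identically, it
vanishes almost nowhere (`IsGround.ae_ne_zero`): the truncations `min(1, k u)` of the vacuum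
component `u` have bounded kinetic energy and converge to the indicator of its support, and an
indicator with finite kinetic energy is translation invariant, hence constant by ergodicity of the
torus. Two such states therefore overlap strictly. A real ground state minus its projection onto a
nonnegative one must then be zero.

Two analytic facts support this. Because `v` is not square integrable, the form is controlled by
Hardy's inequality: the relative motion displaces the first phonon, so `-i∇_x - P_f` controls the
weight `|y₁|⁻²` (`lintegral_div_norm_sq_le`, `exists_interaction_bound`). And the infimum of the
spectrum is a lower bound of the form (`IsHermitianFormOn.mul_norm_sq_le_of_isGLB`), which makes
ground states minimizers. Weak derivatives are handled throughout as generators of translations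
(`isWeakRelDeriv_iff_hasDerivAt`). -/

instance : IsLocallyFiniteMeasure (volume : Measure (Config ℓ n)) :=
  inferInstanceAs (IsLocallyFiniteMeasure
    ((volume : Measure (Torus ℓ)).prod (volume : Measure (Fin n → E3))))

instance : (volume : Measure (E3 × (Fin n → E3))).IsAddHaarMeasure :=
  Measure.prod.instIsAddHaarMeasure (volume : Measure E3) (volume : Measure (Fin n → E3))

instance : (volume : Measure (Config ℓ n)).Regular :=
  Measure.Regular.of_sigmaCompactSpace_of_isLocallyFiniteMeasure _

theorem continuous_coe_torus : Continuous (fun (t : E3) (j : Fin 3) => ((t j : ℝ) : AddCircle ℓ)) :=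
  continuous_pi fun j => (AddCircle.continuous_mk' ℓ).comp (by fun_prop)

theorem continuous_shift_uncurry :
    Continuous (fun p : E3 × Config ℓ n => shift p.1 p.2) := by
  refine Continuous.prodMk ?_ ?_
  · have h := (continuous_coe_torus (ℓ := ℓ)).comp (continuous_fst (X := E3) (Y := Config ℓ n))
    exact (continuous_fst.comp continuous_snd).add h
  · exact continuous_pi fun i => ((continuous_apply i).comp
      (continuous_snd.comp continuous_snd)).sub continuous_fst

theorem continuous_shift (t : E3) : Continuous (shift t : Config ℓ n → Config ℓ n) :=
  continuous_shift_uncurry.comp (Continuous.prodMk_right t)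

theorem shift_shift (s t : E3) (z : Config ℓ n) : shift s (shift t z) = shift (s + t) z := by
  refine Prod.ext (funext fun j => ?_) (funext fun i => ?_)
  · simp only [shift, PiLp.add_apply]
    rw [AddCircle.coe_add, add_comm ((s j : ℝ) : AddCircle ℓ), add_assoc]
  · simp only [shift]
    abel

theorem shift_zero (z : Config ℓ n) : shift 0 z = z := by
  refine Prod.ext (funext fun j => ?_) (funext fun i => ?_) <;> simp [shift]

theorem measurePreserving_shift (t : E3) :
    MeasurePreserving (shift t : Config ℓ n → Config ℓ n) volume volume := by
  have h1 : MeasurePreserving (fun x : Torus ℓ => fun j => x j + ((t j : ℝ) : AddCircle ℓ))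
      volume volume :=
    measurePreserving_add_right volume (fun j => ((t j : ℝ) : AddCircle ℓ))
  have h2 : MeasurePreserving (fun (y : Fin n → E3) i => y i - t) volume volume :=
    volume_preserving_pi fun _ => measurePreserving_sub_right volume t
  exact h1.prod h2

/-- The translation `f ↦ f ∘ shift t` as an isometry. -/
def translate (t : E3) : L2 ℓ n →ₗᵢ[ℂ] L2 ℓ n :=
  Lp.compMeasurePreservingₗᵢ ℂ (shift t) (measurePreserving_shift t)

theorem coeFn_translate (t : E3) (f : L2 ℓ n) : translate t f =ᵐ[volume] f ∘ shift t :=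
  Lp.coeFn_compMeasurePreserving f (measurePreserving_shift t)

theorem translate_translate (s t : E3) (f : L2 ℓ n) :
    translate s (translate t f) = translate (s + t) f := by
  apply Lp.ext
  have h1 := coeFn_translate s (translate t f)
  have h2 := (measurePreserving_shift (ℓ := ℓ) (n := n) s).quasiMeasurePreserving.ae_eq
    (coeFn_translate t f)
  filter_upwards [h1, h2, coeFn_translate (s + t) f] with z h1 h2 h3
  rw [h1, h3, Function.comp_apply, Function.comp_apply]
  refine Eq.trans h2 ?_
  rw [Function.comp_apply, Function.comp_apply, shift_shift, add_comm]

theorem translate_zero (f : L2 ℓ n) : translate 0 f = f := by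
  apply Lp.ext
  filter_upwards [coeFn_translate 0 f] with z h1
  rw [h1, Function.comp_apply, shift_zero]

/-- Strong continuity of the translation group; with the group law and isometry this makes each
`flow j` a strongly continuous unitary one-parameter group. -/
theorem continuous_translate (f : L2 ℓ n) : Continuous (fun t : E3 => translate t f) := by
  let g : E3 → C(Config ℓ n, Config ℓ n) := fun t => ⟨shift t, continuous_shift t⟩
  have hg : Continuous g :=
    ContinuousMap.continuous_of_continuous_uncurry _ continuous_shift_uncurry
  exact Continuous.compMeasurePreservingLp (f := fun _ : E3 => f) continuous_const hg
    (fun t => measurePreserving_shift t) (by simp)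

theorem inner_translate_left (t : E3) (f g : L2 ℓ n) :
    inner ℂ (translate t f) g = inner ℂ f (translate (-t) g) := by
  rw [← (translate (ℓ := ℓ) (n := n) (-t)).inner_map_map, translate_translate, neg_add_cancel,
    translate_zero]

/-- The one-parameter group generated by `∂_{x_j} - ∑ᵢ ∂_{y_{i,j}}`. -/
def flow (j : Fin 3) (s : ℝ) : L2 ℓ n →ₗᵢ[ℂ] L2 ℓ n :=
  translate (s • EuclideanSpace.single j (1 : ℝ))

theorem flow_flow (j : Fin 3) (s t : ℝ) (f : L2 ℓ n) : flow j s (flow j t f) = flow j (s + t) f := by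
  rw [flow, flow, flow, translate_translate, add_smul]

theorem flow_zero (j : Fin 3) (f : L2 ℓ n) : flow j 0 f = f := by
  rw [flow, zero_smul, translate_zero]

theorem continuous_flow (j : Fin 3) (f : L2 ℓ n) : Continuous (fun s : ℝ => flow j s f) :=
  (continuous_translate f).comp (by fun_prop)

theorem inner_flow_left (j : Fin 3) (s : ℝ) (f g : L2 ℓ n) :
    inner ℂ (flow j s f) g = inner ℂ f (flow j (-s) g) := by
  rw [flow, inner_translate_left, flow, neg_smul]

end Translations

/-! ### Test functions -/

section TestFunctions

variable {ℓ : ℝ} [Fact (0 < ℓ)] {n : ℕ}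

/-- The covering map `ℝ³ × ℝ³ⁿ → Λ_ℓ × ℝ³ⁿ`. -/
def cover (ℓ : ℝ) (n : ℕ) (p : E3 × (Fin n → E3)) : Config ℓ n :=
  (fun j => ((p.1 j : ℝ) : AddCircle ℓ), p.2)

/-- Smoothness of test functions is tested on the covering space. The quotient property lets
continuity descend from there, and surjectivity lets every configuration be lifted. -/
theorem isOpenQuotientMap_cover : IsOpenQuotientMap (cover ℓ n) := by
  have h1 : IsOpenQuotientMap (Pi.map (fun (_ : Fin 3) (s : ℝ) => (s : AddCircle ℓ))) :=
    IsOpenQuotientMap.piMap fun _ => QuotientAddGroup.isOpenQuotientMap_mk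
  have h2 := h1.comp (EuclideanSpace.equiv (Fin 3) ℝ).toHomeomorph.isOpenQuotientMap
  exact h2.prodMap (IsOpenQuotientMap.id (X := Fin n → E3))

/-- The direction of the relative motion in the covering space. -/
def coverDir (n : ℕ) (t : E3) : E3 × (Fin n → E3) := (t, fun _ => -t)

theorem shift_cover (t : E3) (p : E3 × (Fin n → E3)) :
    shift t (cover ℓ n p) = cover ℓ n (p + coverDir n t) := by
  refine Prod.ext (funext fun j => ?_) (funext fun i => ?_)
  · simp [shift, cover, coverDir]
  · simp [shift, cover, coverDir, sub_eq_add_neg]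

/-- The torus factor is compact, so compactness of the support only constrains the phonon
coordinates. -/
theorem hasCompactSupport_of_norm_snd_le {η : Config ℓ n → ℂ} (R : ℝ)
    (h : ∀ z, R < ‖z.2‖ → η z = 0) : HasCompactSupport η := by
  refine HasCompactSupport.intro
    (isCompact_univ.prod (isCompact_closedBall (0 : Fin n → E3) R)) fun z hz => h z ?_
  by_contra hR
  exact hz ⟨Set.mem_univ _, by simpa using not_lt.mp hR⟩

theorem exists_norm_snd_le_of_hasCompactSupport {η : Config ℓ n → ℂ} (h : HasCompactSupport η) :
    ∃ R, 0 ≤ R ∧ ∀ z, R < ‖z.2‖ → η z = 0 := by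
  obtain ⟨R, hR⟩ := (h.isCompact.image continuous_snd).isBounded.exists_norm_le
  refine ⟨max R 0, le_max_right _ _, fun z hz => ?_⟩
  by_contra hne
  have := hR z.2 ⟨z, subset_tsupport _ hne, rfl⟩
  exact absurd (this.trans (le_max_left _ _)) (not_le.mpr hz)

theorem IsTestFunction.continuous {η : Config ℓ n → ℂ} (h : IsTestFunction η) : Continuous η :=
  isOpenQuotientMap_cover.continuous_comp_iff.mp h.1.continuous

theorem IsTestFunction.memLp {η : Config ℓ n → ℂ} (h : IsTestFunction η) :
    MemLp η 2 (volume : Measure (Config ℓ n)) :=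
  h.continuous.memLp_of_hasCompactSupport h.2

theorem IsTestFunction.conj {η : Config ℓ n → ℂ} (h : IsTestFunction η) :
    IsTestFunction (fun z => conj (η z)) :=
  ⟨Complex.conjCLE.contDiff.comp h.1, h.2.comp_left (map_zero _)⟩

theorem IsTestFunction.comp_shift {η : Config ℓ n → ℂ} (h : IsTestFunction η) (t : E3) :
    IsTestFunction (fun z => η (shift t z)) := by
  refine ⟨?_, ?_⟩
  · have : (fun p : E3 × (Fin n → E3) => η (shift t (cover ℓ n p))) =
        (fun p => η (cover ℓ n p)) ∘ (fun p => p + coverDir n t) := by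
      funext p
      rw [shift_cover, Function.comp_apply]
    exact this ▸ h.1.comp (contDiff_id.add contDiff_const)
  · obtain ⟨R, hR0, hR⟩ := exists_norm_snd_le_of_hasCompactSupport h.2
    refine hasCompactSupport_of_norm_snd_le (R + ‖t‖) fun z hz => hR _ ?_
    have h1 : ‖z.2‖ ≤ ‖(shift t z).2‖ + ‖t‖ := by
      have h2 : ‖fun _ : Fin n => t‖ ≤ ‖t‖ := by
        simpa using pi_norm_const_le t
      have h3 : z.2 = (shift t z).2 + fun _ => t := by
        funext i; simp [shift]
      calc ‖z.2‖ = ‖(shift t z).2 + fun _ => t‖ := by rw [← h3]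
        _ ≤ _ := (norm_add_le _ _).trans (by gcongr)
    linarith

theorem IsTestFunction.hasDerivAt_shift {η : Config ℓ n → ℂ} (h : IsTestFunction η) (j : Fin 3)
    (z : Config ℓ n) (r : ℝ) :
    HasDerivAt (fun s : ℝ => η (shift (s • EuclideanSpace.single j (1 : ℝ)) z))
      (relDeriv j η (shift (r • EuclideanSpace.single j (1 : ℝ)) z)) r := by
  have key : ∀ w : Config ℓ n,
      HasDerivAt (fun s : ℝ => η (shift (s • EuclideanSpace.single j (1 : ℝ)) w))
        (relDeriv j η w) 0 := by
    intro w
    obtain ⟨p, rfl⟩ := isOpenQuotientMap_cover.surjective w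
    refine DifferentiableAt.hasDerivAt ?_
    have h1 : (fun s : ℝ => η (shift (s • EuclideanSpace.single j (1 : ℝ)) (cover ℓ n p))) =
        (fun p => η (cover ℓ n p)) ∘
          fun s : ℝ => p + s • coverDir n (EuclideanSpace.single j (1 : ℝ)) := by
      funext s
      rw [shift_cover, Function.comp_apply]
      congr 3
      refine Prod.ext rfl (funext fun i => ?_)
      simp [coverDir]
    rw [h1]
    exact ((h.1.differentiable (by simp)) _).comp _ (by fun_prop)
  -- By the group law, the derivative at time `r` is the derivative at time zero from the shifted
  -- base point.
  have h2 := key (shift (r • EuclideanSpace.single j (1 : ℝ)) z)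
  have h3 : HasDerivAt (fun s : ℝ => s - r) 1 r := (hasDerivAt_id r).sub_const r
  have h4 := HasDerivAt.scomp (𝕜 := ℝ) r (h := fun s : ℝ => s - r) (by simpa using h2) h3
  rw [one_smul] at h4
  refine h4.congr_of_eventuallyEq (Eventually.of_forall fun s => ?_)
  simp only [Function.comp_apply]
  rw [shift_shift, ← add_smul, sub_add_cancel]

/-- On the covering space the relative derivative is the Fréchet derivative in a fixed direction,
hence smooth, and differentiation does not enlarge the closed support. -/
theorem IsTestFunction.relDeriv {η : Config ℓ n → ℂ} (h : IsTestFunction η) (j : Fin 3) :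
    IsTestFunction (relDeriv j η) := by
  refine ⟨?_, ?_⟩
  · have h1 : (fun p : E3 × (Fin n → E3) => Polaron.relDeriv j η (cover ℓ n p)) = fun p =>
        fderiv ℝ (fun p => η (cover ℓ n p)) p (coverDir n (EuclideanSpace.single j (1 : ℝ))) := by
      funext p
      have h2 := h.hasDerivAt_shift j (cover ℓ n p) 0
      rw [zero_smul, shift_zero] at h2
      refine h2.unique ?_
      have h3 : (fun s : ℝ => η (shift (s • EuclideanSpace.single j (1 : ℝ)) (cover ℓ n p))) =
          (fun p => η (cover ℓ n p)) ∘
            fun s : ℝ => p + s • coverDir n (EuclideanSpace.single j (1 : ℝ)) := by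
        funext s
        rw [shift_cover, Function.comp_apply]
        congr 3
        refine Prod.ext rfl (funext fun i => ?_)
        simp [coverDir]
      rw [h3]
      have h4 : HasDerivAt
          (fun s : ℝ => p + s • coverDir n (EuclideanSpace.single j (1 : ℝ)))
          (coverDir n (EuclideanSpace.single j (1 : ℝ))) 0 := by
        simpa using ((hasDerivAt_id (0 : ℝ)).smul_const
          (coverDir n (EuclideanSpace.single j (1 : ℝ)))).const_add p
      refine HasFDerivAt.comp_hasDerivAt (0 : ℝ) ?_ h4
      rw [zero_smul, add_zero]
      exact ((h.1.differentiable (by simp)) p).hasFDerivAt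
    have h5 : ContDiff ℝ ∞ (fun p : E3 × (Fin n → E3) =>
        fderiv ℝ (fun p => η (cover ℓ n p)) p (coverDir n (EuclideanSpace.single j (1 : ℝ)))) :=
      (h.1.fderiv_right (m := ∞) (by simp)).clm_apply contDiff_const
    exact h1 ▸ h5
  · refine HasCompactSupport.intro h.2 fun z hz => ?_
    rw [Polaron.relDeriv]
    have h1 : ∀ᶠ s : ℝ in 𝓝 0, η (shift (s • EuclideanSpace.single j (1 : ℝ)) z) = 0 := by
      have h2 : ∀ᶠ w in 𝓝 z, η w = 0 :=
        (isClosed_tsupport η).isOpen_compl.eventually_mem hz |>.mono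
          fun w hw => image_eq_zero_of_notMem_tsupport hw
      have h3 : Continuous (fun s : ℝ => shift (s • EuclideanSpace.single j (1 : ℝ)) z) :=
        continuous_shift_uncurry.comp (Continuous.prodMk (by fun_prop) continuous_const)
      refine (h3.tendsto 0).eventually (p := fun w => η w = 0) ?_
      simpa [shift_zero] using h2
    exact (EventuallyEq.deriv_eq (f := fun _ => (0 : ℂ)) h1).trans (by simp)

theorem relDeriv_comp_shift {η : Config ℓ n → ℂ} (j : Fin 3) (t : E3) (z : Config ℓ n) :
    relDeriv j (fun w => η (shift t w)) z = relDeriv j η (shift t z) := by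
  simp only [relDeriv, shift_shift, add_comm]

end TestFunctions

/-! ### Density of test functions -/

section Density

variable {ℓ : ℝ} [Fact (0 < ℓ)] {n : ℕ}

instance : (volume : Measure (E3 × (Fin n → E3))).Regular :=
  Measure.Regular.of_sigmaCompactSpace_of_isLocallyFiniteMeasure _

instance : (volume : Measure (E3 × (Fin n → E3))).IsNegInvariant :=
  Measure.IsAddHaarMeasure.isNegInvariant_of_regular _

theorem uniformContinuous_cover : UniformContinuous (cover ℓ n) := by
  refine UniformContinuous.prodMk (uniformContinuous_pi.mpr fun j => ?_) uniformContinuous_snd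
  let φ : (E3 × (Fin n → E3)) →+ AddCircle ℓ :=
    { toFun := fun p => ((p.1 j : ℝ) : AddCircle ℓ)
      map_zero' := by simp
      map_add' := fun p q => by simp }
  have hφ : Continuous φ := (AddCircle.continuous_mk' ℓ).comp (by fun_prop)
  exact uniformContinuous_addMonoidHom_of_continuous hφ

/-- A continuous function with compact support is a uniform limit of test functions with
supports in a fixed neighbourhood. -/
theorem exists_isTestFunction_dist_le {g : Config ℓ n → ℂ} (hg : Continuous g) {R : ℝ}
    (hR : ∀ z, R < ‖z.2‖ → g z = 0) {δ : ℝ} (hδ : 0 < δ) :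
    ∃ η, IsTestFunction η ∧ (∀ z, dist (g z) (η z) ≤ δ) ∧ ∀ z, R + 1 < ‖z.2‖ → η z = 0 := by
  have hcs : HasCompactSupport g := hasCompactSupport_of_norm_snd_le R hR
  have hu : UniformContinuous (fun p => g (cover ℓ n p)) :=
    (hcs.uniformContinuous_of_continuous hg).comp uniformContinuous_cover
  obtain ⟨ρ, hρ, hu⟩ := Metric.uniformContinuous_iff.mp hu δ hδ
  let φ : ContDiffBump (0 : E3 × (Fin n → E3)) :=
    ⟨min ρ 1 / 2, min ρ 1, by positivity, half_lt_self (by positivity)⟩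
  -- The mollifier lives on the covering space while the subtraction takes place on the torus, so
  -- periodicity is automatic; pulled back to the cover, `η` is an ordinary convolution. The radius
  -- `min ρ 1` serves both the modulus of continuity and the enlargement of the support by at most
  -- one.
  let η : Config ℓ n → ℂ := fun z => ∫ t : E3 × (Fin n → E3),
    φ.normed volume t • g (fun j => z.1 j - ((t.1 j : ℝ) : AddCircle ℓ), z.2 - t.2)
  have hη : ∀ p, η (cover ℓ n p) = convolution (φ.normed volume) (fun p => g (cover ℓ n p))
      (ContinuousLinearMap.lsmul ℝ ℝ) volume p := by
    intro p
    simp only [convolution, η, ContinuousLinearMap.lsmul_apply]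
    refine integral_congr_ae (Eventually.of_forall fun t => ?_)
    simp [cover]
  have hgc : Continuous (fun p => g (cover ℓ n p)) :=
    hg.comp isOpenQuotientMap_cover.continuous
  have hsupp : ∀ z, R + 1 < ‖z.2‖ → η z = 0 := by
    intro z hz
    refine integral_eq_zero_of_ae (Eventually.of_forall fun t => ?_)
    by_cases ht : ‖t‖ < min ρ 1
    · have h1 : ‖t.2‖ < 1 := (norm_snd_le t).trans_lt (ht.trans_le (min_le_right _ _))
      have h2 := norm_sub_norm_le z.2 t.2
      have h3 : g (fun j => z.1 j - ((t.1 j : ℝ) : AddCircle ℓ), z.2 - t.2) = 0 :=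
        hR _ (by simp only; linarith)
      simp [h3]
    · have h1 : t ∉ Function.support (φ.normed volume) := by
        rw [φ.support_normed_eq]
        simpa [φ] using ht
      simp [Function.notMem_support.mp h1]
  refine ⟨η, ⟨?_, hasCompactSupport_of_norm_snd_le _ hsupp⟩, ?_, hsupp⟩
  · have h1 : ContDiff ℝ ∞ (convolution (φ.normed volume) (fun p => g (cover ℓ n p))
        (ContinuousLinearMap.lsmul ℝ ℝ) volume) :=
      φ.hasCompactSupport_normed.contDiff_convolution_left _ φ.contDiff_normed
        hgc.locallyIntegrable
    rwa [← funext hη] at h1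
  · intro z
    obtain ⟨p, rfl⟩ := isOpenQuotientMap_cover.surjective z
    rw [hη, dist_comm]
    refine ContDiffBump.dist_normed_convolution_le (g := fun p => g (cover ℓ n p))
      hgc.aestronglyMeasurable fun x hx => ?_
    exact (hu (hx.trans_le (min_le_left _ _))).le

theorem exists_isTestFunction_norm_sub_le (f : L2 ℓ n) {ε : ℝ} (hε : 0 < ε) :
    ∃ (η : Config ℓ n → ℂ) (hη : IsTestFunction η), ‖f - hη.memLp.toLp η‖ ≤ ε := by
  obtain ⟨g, hgs, hgf, hgc, hgL⟩ := (Lp.memLp f).exists_hasCompactSupport_eLpNorm_sub_le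
    (by simp) (ε := ENNReal.ofReal (ε / 2)) (by simpa using hε)
  obtain ⟨R, -, hR⟩ := exists_norm_snd_le_of_hasCompactSupport hgs
  set K : Set (Config ℓ n) := Set.univ ×ˢ Metric.closedBall (0 : Fin n → E3) (R + 1) with hK
  have hKc : IsCompact K := isCompact_univ.prod (isCompact_closedBall _ _)
  have hKm : volume K ^ (1 / (2 : ℝ≥0∞).toReal) ≠ ⊤ :=
    ENNReal.rpow_ne_top_of_nonneg (by simp) hKc.measure_ne_top
  set M : ℝ := (volume K ^ (1 / (2 : ℝ≥0∞).toReal)).toReal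
  have hM : 0 ≤ M := ENNReal.toReal_nonneg
  -- `M` is the `L²` norm of the indicator of `K`, which converts a uniform error into an `L²`
  -- error; `M + 1` avoids division by zero.
  obtain ⟨η, hη, hd, hηs⟩ := exists_isTestFunction_dist_le hgc hR
    (δ := ε / 2 / (M + 1)) (by positivity)
  refine ⟨η, hη, ?_⟩
  have hsub : ∀ h : Config ℓ n → ℂ, (∀ z, R + 1 < ‖z.2‖ → h z = 0) → Function.support h ⊆ K := by
    intro h hh z hz
    refine ⟨Set.mem_univ _, ?_⟩
    by_contra hzK
    exact hz (hh z (by simpa using hzK))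
  have h2 : eLpNorm (g - η) 2 volume ≤ ENNReal.ofReal (ε / 2) := by
    refine (eLpNorm_sub_le_of_dist_bdd volume (p := 2) (by simp) hKc.measurableSet
      (c := ε / 2 / (M + 1)) (by positivity) hd
      (hsub g fun z hz => hR z (by linarith)) (hsub η hηs)).trans ?_
    rw [← ENNReal.ofReal_toReal hKm, ← ENNReal.ofReal_mul (by positivity)]
    refine ENNReal.ofReal_le_ofReal ?_
    rw [div_mul_eq_mul_div, div_le_iff₀ (by positivity)]
    nlinarith
  have h3 : ‖f - hgL.toLp g‖ ≤ ε / 2 := by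
    have h4 : f - hgL.toLp g = ((Lp.memLp f).sub hgL).toLp (⇑f - g) := by
      rw [MemLp.toLp_sub (Lp.memLp f) hgL, Lp.toLp_coeFn]
    rw [h4, Lp.norm_toLp]
    exact ENNReal.toReal_le_of_le_ofReal (by positivity) hgf
  have h5 : ‖hgL.toLp g - hη.memLp.toLp η‖ ≤ ε / 2 := by
    rw [← MemLp.toLp_sub, Lp.norm_toLp]
    exact ENNReal.toReal_le_of_le_ofReal (by positivity) h2
  calc ‖f - hη.memLp.toLp η‖ = ‖(f - hgL.toLp g) + (hgL.toLp g - hη.memLp.toLp η)‖ := by abel_nf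
    _ ≤ ε / 2 + ε / 2 := (norm_add_le _ _).trans (add_le_add h3 h5)
    _ = ε := by ring

theorem integral_mul_eq_inner {η : Config ℓ n → ℂ} (hη : IsTestFunction η) (f : L2 ℓ n) :
    ∫ z, η z * f z = inner ℂ (hη.conj.memLp.toLp _) f := by
  rw [L2.inner_def]
  refine integral_congr_ae ?_
  filter_upwards [hη.conj.memLp.coeFn_toLp] with z hz
  rw [hz, RCLike.inner_apply]
  simp [mul_comm]

/-- Test functions determine the norm of an element of `L²`. -/
theorem norm_le_of_forall_isTestFunction (f : L2 ℓ n) {c : ℝ} (hc : 0 ≤ c)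
    (h : ∀ (η : Config ℓ n → ℂ) (hη : IsTestFunction η),
      ‖inner ℂ (hη.memLp.toLp η) f‖ ≤ c * ‖hη.memLp.toLp η‖) : ‖f‖ ≤ c := by
  have key : ∀ g : L2 ℓ n, ‖inner ℂ g f‖ ≤ c * ‖g‖ := by
    intro g
    have hcl : IsClosed {g : L2 ℓ n | ‖inner ℂ g f‖ ≤ c * ‖g‖} :=
      isClosed_le (by fun_prop) (by fun_prop)
    have hmem : g ∈ closure {g : L2 ℓ n | ‖inner ℂ g f‖ ≤ c * ‖g‖} := by
      rw [Metric.mem_closure_iff]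
      intro ε hε
      obtain ⟨η, hη, hd⟩ := exists_isTestFunction_norm_sub_le g (half_pos hε)
      exact ⟨_, h η hη, by rw [dist_eq_norm]; linarith⟩
    rwa [hcl.closure_eq] at hmem
  rcases (norm_nonneg f).eq_or_lt with h0 | h0
  · rwa [← h0]
  · have h1 := key f
    rw [inner_self_eq_norm_sq_to_K] at h1
    simp only [norm_pow, RCLike.norm_ofReal, abs_norm] at h1
    nlinarith

end Density

/-! ### Weak derivatives as generators of translations -/

section WeakDerivatives

variable {ℓ : ℝ} [Fact (0 < ℓ)] {n : ℕ}

theorem flow_toLp {η : Config ℓ n → ℂ} (hη : IsTestFunction η) (j : Fin 3) (s : ℝ) :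
    flow j s (hη.memLp.toLp η) =
      (hη.comp_shift (s • EuclideanSpace.single j (1 : ℝ))).memLp.toLp _ :=
  Lp.toLp_compMeasurePreserving hη.memLp (measurePreserving_shift _)

theorem integral_mul_flow {η : Config ℓ n → ℂ} (hη : IsTestFunction η) (j : Fin 3) (s : ℝ)
    (f : L2 ℓ n) :
    ∫ z, η z * flow j s f z =
      ∫ z, η (shift ((-s) • EuclideanSpace.single j (1 : ℝ)) z) * f z := by
  rw [integral_mul_eq_inner hη, integral_mul_eq_inner (hη.comp_shift _)]
  have h := inner_flow_left j (-s) (hη.conj.memLp.toLp _) f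
  rw [neg_neg] at h
  rw [← h, flow_toLp hη.conj]

/-- No regularity of `f` is needed: invariance of the measure moves the translation onto the smooth
factor, with reversed direction, whence the minus sign. The derivative is dominated by a constant on
a fixed compact set times `|f|`. -/
theorem hasDerivAt_integral_mul_flow {η : Config ℓ n → ℂ} (hη : IsTestFunction η) (j : Fin 3)
    (f : L2 ℓ n) :
    HasDerivAt (fun s : ℝ => ∫ z, η z * flow j s f z) (-∫ z, relDeriv j η z * f z) 0 := by
  obtain ⟨R, hR0, hR⟩ := exists_norm_snd_le_of_hasCompactSupport (hη.relDeriv j).2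
  obtain ⟨C, hC⟩ := (hη.relDeriv j).2.exists_bound_of_continuous (hη.relDeriv j).continuous
  set e : E3 := EuclideanSpace.single j (1 : ℝ) with he
  set K : Set (Config ℓ n) := Set.univ ×ˢ Metric.closedBall (0 : Fin n → E3) (R + 1) with hK
  have hKc : IsCompact K := isCompact_univ.prod (isCompact_closedBall _ _)
  have hCn : 0 ≤ C := (norm_nonneg _).trans (hC (cover ℓ n 0))
  have hbound : Integrable (fun z => K.indicator (fun _ => C) z * ‖f z‖)
      (volume : Measure (Config ℓ n)) := by
    refine MemLp.integrable_mul (p := 2) (q := 2) ?_ (Lp.memLp f).norm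
    exact memLp_indicator_const 2 hKc.measurableSet C (Or.inr hKc.measure_ne_top)
  have hmeas : ∀ s : ℝ, AEStronglyMeasurable (fun z => η (shift (s • e) z) * f z) volume :=
    fun s => ((hη.comp_shift _).continuous.aestronglyMeasurable).mul
      (Lp.aestronglyMeasurable f)
  have h := hasDerivAt_integral_of_dominated_loc_of_deriv_le (𝕜 := ℝ)
    (μ := (volume : Measure (Config ℓ n)))
    (F := fun s z => η (shift (s • e) z) * f z)
    (F' := fun s z => relDeriv j η (shift (s • e) z) * f z) (x₀ := 0)
    (bound := fun z => K.indicator (fun _ => C) z * ‖f z‖)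
    (Metric.ball_mem_nhds (0 : ℝ) one_pos) (Eventually.of_forall hmeas)
    (MemLp.integrable_mul (p := 2) (q := 2) (hη.comp_shift _).memLp (Lp.memLp f))
    ((((hη.relDeriv j).comp_shift _).continuous.aestronglyMeasurable).mul
      (Lp.aestronglyMeasurable f))
    (Eventually.of_forall fun z s hs => ?_) hbound
    (Eventually.of_forall fun z s _ => (hη.hasDerivAt_shift j z s).mul_const _)
  · have h1 := h.2
    simp only [zero_smul, shift_zero] at h1
    have h2 : HasDerivAt (fun s : ℝ => -s) (-1) 0 := hasDerivAt_neg 0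
    have h3 := HasDerivAt.scomp (𝕜 := ℝ) (0 : ℝ) (h := fun s : ℝ => -s) (by simpa using h1) h2
    rw [neg_one_smul] at h3
    refine h3.congr_of_eventuallyEq (Eventually.of_forall fun s => ?_)
    exact integral_mul_flow hη j s f
  · rw [norm_mul]
    refine mul_le_mul_of_nonneg_right ?_ (norm_nonneg _)
    by_cases hz : z ∈ K
    · rw [Set.indicator_of_mem hz]
      exact hC _
    · rw [Set.indicator_of_notMem hz]
      have hz' : R + 1 < ‖z.2‖ := by
        by_contra hc
        exact hz ⟨Set.mem_univ _, by simpa using not_lt.mp hc⟩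
      have h1 : ‖z.2‖ ≤ ‖(shift (s • e) z).2‖ + 1 := by
        have h2 : ‖fun _ : Fin n => s • e‖ ≤ 1 := by
          refine (pi_norm_const_le _).trans ?_
          rw [norm_smul, he, PiLp.norm_single, norm_one, mul_one]
          exact (mem_ball_zero_iff.mp hs).le
        have h3 : z.2 = (shift (s • e) z).2 + fun _ => s • e := by
          funext i; simp [shift]
        calc ‖z.2‖ = ‖(shift (s • e) z).2 + fun _ => s • e‖ := by rw [← h3]
          _ ≤ _ := (norm_add_le _ _).trans (by gcongr)
      rw [hR _ (by linarith), norm_zero]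

theorem IsWeakRelDeriv.flow {j : Fin 3} {f g : L2 ℓ n} (h : IsWeakRelDeriv j f g) (r : ℝ) :
    IsWeakRelDeriv j (flow j r f) (flow j r g) := by
  intro η hη
  rw [integral_mul_flow (hη.relDeriv j), integral_mul_flow hη, ← h _ (hη.comp_shift _)]
  simp only [relDeriv_comp_shift]

theorem IsWeakRelDeriv.hasDerivAt_integral {j : Fin 3} {f g : L2 ℓ n} (h : IsWeakRelDeriv j f g)
    {η : Config ℓ n → ℂ} (hη : IsTestFunction η) (r : ℝ) :
    HasDerivAt (fun s : ℝ => ∫ z, η z * Polaron.flow j s f z)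
      (∫ z, η z * Polaron.flow j r g z) r := by
  have h1 := hasDerivAt_integral_mul_flow hη j (Polaron.flow j r f)
  rw [h.flow r η hη, neg_neg] at h1
  have h3 : HasDerivAt (fun s : ℝ => s - r) 1 r := (hasDerivAt_id r).sub_const r
  have h4 := HasDerivAt.scomp (𝕜 := ℝ) r (h := fun s : ℝ => s - r) (by simpa using h1) h3
  rw [one_smul] at h4
  refine h4.congr_of_eventuallyEq (Eventually.of_forall fun s => ?_)
  simp only [Function.comp_apply, flow_flow, sub_add_cancel]

/-- A weak derivative is the derivative of the translates in the norm of `L²`. -/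
theorem isWeakRelDeriv_iff_hasDerivAt {j : Fin 3} {f g : L2 ℓ n} :
    IsWeakRelDeriv j f g ↔ HasDerivAt (fun s : ℝ => flow j s f) g 0 := by
  constructor
  · intro h
    rw [hasDerivAt_iff_isLittleO, Asymptotics.isLittleO_iff]
    intro ε hε
    have h1 : ∀ᶠ r : ℝ in 𝓝 0, ‖flow j r g - g‖ ≤ ε := by
      have h2 : Tendsto (fun r : ℝ => ‖flow j r g - g‖) (𝓝 0) (𝓝 0) := by
        have := (((continuous_flow j g).sub continuous_const).norm).tendsto (0 : ℝ)
          (f := fun r : ℝ => ‖flow j r g - g‖)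
        simpa [flow_zero] using this
      exact (h2.eventually (gt_mem_nhds hε)).mono fun _ h => le_of_lt h
    obtain ⟨δ, hδ, hball⟩ := Metric.eventually_nhds_iff_ball.mp h1
    filter_upwards [Metric.ball_mem_nhds (0 : ℝ) hδ] with s hs
    rw [flow_zero, sub_zero]
    -- Weak to strong: after pairing with a test function the remainder is a scalar function of
    -- time, whose derivative is at most `ε ‖η‖` near zero. The mean value inequality then gives a
    -- bound uniform in `η`, hence a bound in norm.
    refine norm_le_of_forall_isTestFunction _ (by positivity) fun η hη => ?_
    have hderiv : ∀ r ∈ Metric.ball (0 : ℝ) δ, HasDerivWithinAt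
        (fun r : ℝ => inner ℂ (hη.memLp.toLp η) (flow j r f - f - r • g))
        (inner ℂ (hη.memLp.toLp η) (flow j r g - g)) (Metric.ball (0 : ℝ) δ) r := by
      intro r _
      refine HasDerivAt.hasDerivWithinAt ?_
      have h3 := h.hasDerivAt_integral hη.conj r
      simp only [integral_mul_eq_inner hη.conj, Complex.conj_conj] at h3
      have h4 : HasDerivAt (fun r : ℝ => r • inner ℂ (hη.memLp.toLp η) g)
          (inner ℂ (hη.memLp.toLp η) g) r := by
        simpa using (hasDerivAt_id r).smul_const (inner ℂ (hη.memLp.toLp η) g)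
      have h5 := (h3.sub_const (inner ℂ (hη.memLp.toLp η) f)).sub h4
      rw [inner_sub_right]
      refine h5.congr_of_eventuallyEq (Eventually.of_forall fun r => ?_)
      simp only [inner_sub_right, Pi.sub_apply]
      rw [show r • g = (r : ℂ) • g from (Complex.coe_smul r g).symm, inner_smul_right]
      simp
    have h6 := (convex_ball (0 : ℝ) δ).norm_image_sub_le_of_norm_hasDerivWithin_le
      (C := ε * ‖hη.memLp.toLp η‖) hderiv (fun r hr => ?_) (Metric.mem_ball_self hδ) hs
    · simp only [flow_zero, sub_self, zero_smul, inner_zero_right, sub_zero] at h6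
      refine h6.trans (le_of_eq ?_)
      ring
    · refine (norm_inner_le_norm _ _).trans ?_
      rw [mul_comm]
      gcongr
      exact hball r hr
  · intro h η hη
    have h1 := hasDerivAt_integral_mul_flow hη j f
    have h2 : HasDerivAt (fun s : ℝ => ∫ z, η z * flow j s f z) (∫ z, η z * g z) 0 := by
      simp only [integral_mul_eq_inner hη]
      exact ((innerSL ℂ (hη.conj.memLp.toLp _)).restrictScalars ℝ).hasFDerivAt.comp_hasDerivAt
        (0 : ℝ) h
    rw [h2.unique h1, neg_neg]

/-- A bound on the difference quotients yields a weak derivative. -/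
theorem exists_isWeakRelDeriv_of_norm_flow_sub_le {j : Fin 3} {f : L2 ℓ n} {C : ℝ}
    (h : ∀ s : ℝ, ‖flow j s f - f‖ ≤ C * |s|) : ∃ g, IsWeakRelDeriv j f g := by
  let Q : ℝ → L2 ℓ n := fun s => s⁻¹ • (flow j s f - f)
  have hQ : ∀ s : ℝ, s ≠ 0 → ‖Q s‖ ≤ C := by
    intro s hs
    have : 0 < |s| := abs_pos.mpr hs
    rw [norm_smul, norm_inv, Real.norm_eq_abs, inv_mul_le_iff₀ this, mul_comm]
    exact h s
  -- The difference quotients stay in a ball, which is weak-* compact by Banach–Alaoglu. An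
  -- ultrafilter refining the punctured neighbourhoods of zero picks out a weak limit `g`.
  let D : ℝ → WeakDual ℂ (L2 ℓ n) := fun s =>
    StrongDual.toWeakDual (InnerProductSpace.toDual ℂ (L2 ℓ n) (Q s))
  let F : Ultrafilter ℝ := Ultrafilter.of (𝓝[≠] (0 : ℝ))
  have hF : (F : Filter ℝ) ≤ 𝓝[≠] (0 : ℝ) := Ultrafilter.of_le _
  have hcomp := WeakDual.isCompact_closedBall (𝕜 := ℂ) (0 : StrongDual ℂ (L2 ℓ n)) C
  have hmem : ∀ᶠ s in (F : Filter ℝ), D s ∈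
      (WeakDual.toStrongDual ⁻¹' Metric.closedBall (0 : StrongDual ℂ (L2 ℓ n)) C) := by
    refine hF (Filter.Eventually.filter_mono le_rfl ?_)
    filter_upwards [self_mem_nhdsWithin] with s hs
    simpa [D] using hQ s hs
  obtain ⟨φ, -, hφ⟩ := hcomp.ultrafilter_le_nhds (F.map D) (by
    rw [le_principal_iff]; exact hmem)
  obtain ⟨g, hg⟩ := (InnerProductSpace.toDual ℂ (L2 ℓ n)).surjective (WeakDual.toStrongDual φ)
  have hlim : ∀ u : L2 ℓ n, Tendsto (fun s => inner ℂ u (Q s)) F (𝓝 (inner ℂ u g)) := by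
    intro u
    have h1 : Tendsto (fun s => D s u) F (𝓝 (φ u)) :=
      ((WeakDual.eval_continuous u).tendsto φ).comp hφ
    have h2 : φ u = inner ℂ g u := by
      have : WeakDual.toStrongDual φ u = inner ℂ g u := by rw [← hg]; simp
      exact this
    rw [h2] at h1
    have h3 := (Complex.continuous_conj.tendsto _).comp h1
    rw [inner_conj_symm] at h3
    refine h3.congr fun s => ?_
    simp [D]
  refine ⟨g, fun η hη => ?_⟩
  -- Paired with a test function the quotients converge along the full filter to the distributional
  -- derivative; comparison with the ultrafilter limit identifies `g`.
  have h1 := (hasDerivAt_integral_mul_flow hη j f).tendsto_slope_zero.mono_left hF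
  have h2 := hlim (hη.conj.memLp.toLp _)
  have h3 : (fun t : ℝ => t⁻¹ • ((∫ z, η z * flow j (0 + t) f z) - ∫ z, η z * flow j 0 f z)) =
      fun s => inner ℂ (hη.conj.memLp.toLp _) (Q s) := by
    funext s
    rw [integral_mul_eq_inner hη, integral_mul_eq_inner hη, flow_zero, zero_add,
      ← inner_sub_right]
    simp only [Q]
    rw [show s⁻¹ • (flow j s f - f) = ((s⁻¹ : ℝ) : ℂ) • (flow j s f - f) from
      (Complex.coe_smul s⁻¹ _).symm, inner_smul_right, Complex.real_smul]
  rw [h3] at h1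
  rw [integral_mul_eq_inner hη g, ← tendsto_nhds_unique h1 h2, neg_neg]

/-- The orbit of `f` has derivative the orbit of `g`, of constant norm by isometry, so the mean
value inequality applies globally. -/
theorem IsWeakRelDeriv.norm_flow_sub_le {j : Fin 3} {f g : L2 ℓ n} (h : IsWeakRelDeriv j f g)
    (s : ℝ) : ‖Polaron.flow j s f - f‖ ≤ ‖g‖ * |s| := by
  have h1 : ∀ r ∈ Set.univ, HasDerivWithinAt (fun s : ℝ => Polaron.flow j s f)
      (Polaron.flow j r g) Set.univ r := by
    intro r _
    have h2 := isWeakRelDeriv_iff_hasDerivAt.mp (h.flow r)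
    have h3 : HasDerivAt (fun s : ℝ => s - r) 1 r := (hasDerivAt_id r).sub_const r
    have h4 := HasDerivAt.scomp (𝕜 := ℝ) r (h := fun s : ℝ => s - r) (by simpa using h2) h3
    rw [one_smul] at h4
    refine (h4.congr_of_eventuallyEq (Eventually.of_forall fun s => ?_)).hasDerivWithinAt
    simp only [Function.comp_apply, flow_flow, sub_add_cancel]
  have h5 := convex_univ.norm_image_sub_le_of_norm_hasDerivWithin_le (C := ‖g‖) h1
    (fun r _ => by rw [LinearIsometry.norm_map]) (Set.mem_univ 0) (Set.mem_univ s)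
  simpa [flow_zero] using h5

theorem IsWeakRelDeriv.unique {j : Fin 3} {f g g' : L2 ℓ n} (h : IsWeakRelDeriv j f g)
    (h' : IsWeakRelDeriv j f g') : g = g' :=
  (isWeakRelDeriv_iff_hasDerivAt.mp h).unique (isWeakRelDeriv_iff_hasDerivAt.mp h')

theorem IsWeakRelDeriv.weakRelDeriv_eq {j : Fin 3} {f g : L2 ℓ n} (h : IsWeakRelDeriv j f g) :
    weakRelDeriv j f = g := by
  have hex : ∃ g, IsWeakRelDeriv j f g := ⟨g, h⟩
  rw [weakRelDeriv, dif_pos hex]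
  exact hex.choose_spec.unique h

theorem IsWeakRelDeriv.tendsto_slope {j : Fin 3} {f g : L2 ℓ n} (h : IsWeakRelDeriv j f g) :
    Tendsto (fun s : ℝ => s⁻¹ • (Polaron.flow j s f - f)) (𝓝[≠] 0) (𝓝 g) := by
  simpa [flow_zero] using (isWeakRelDeriv_iff_hasDerivAt.mp h).tendsto_slope_zero

theorem norm_weakRelDeriv_le {j : Fin 3} {f : L2 ℓ n} {C : ℝ}
    (h : ∀ s : ℝ, ‖flow j s f - f‖ ≤ C * |s|) : ‖weakRelDeriv j f‖ ≤ C := by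
  obtain ⟨g, hg⟩ := exists_isWeakRelDeriv_of_norm_flow_sub_le h
  rw [hg.weakRelDeriv_eq]
  refine le_of_tendsto hg.tendsto_slope.norm ?_
  filter_upwards [self_mem_nhdsWithin] with s hs
  have : 0 < |s| := abs_pos.mpr hs
  rw [norm_smul, norm_inv, Real.norm_eq_abs, inv_mul_le_iff₀ this, mul_comm]
  exact h s

end WeakDerivatives

/-! ### The domain of the relative momentum -/

section MomentumDomain

variable {ℓ : ℝ} [Fact (0 < ℓ)] {n : ℕ}

theorem IsWeakRelDeriv.add {j : Fin 3} {f f' g g' : L2 ℓ n} (h : IsWeakRelDeriv j f g)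
    (h' : IsWeakRelDeriv j f' g') : IsWeakRelDeriv j (f + f') (g + g') := by
  rw [isWeakRelDeriv_iff_hasDerivAt] at h h' ⊢
  simp only [map_add]
  exact HasDerivAt.fun_add h h'

theorem IsWeakRelDeriv.smul {j : Fin 3} {f g : L2 ℓ n} (h : IsWeakRelDeriv j f g) (c : ℂ) :
    IsWeakRelDeriv j (c • f) (c • g) := by
  rw [isWeakRelDeriv_iff_hasDerivAt] at h ⊢
  simp only [map_smul]
  exact HasDerivAt.fun_const_smul c h

theorem isWeakRelDeriv_zero (j : Fin 3) : IsWeakRelDeriv j (0 : L2 ℓ n) 0 := by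
  rw [isWeakRelDeriv_iff_hasDerivAt]
  simpa using hasDerivAt_const (0 : ℝ) (0 : L2 ℓ n)

variable (ℓ n) in
/-- The domain of `-i∇_x - P_f` in the `n`-phonon sector. -/
def momentumDomain : Submodule ℂ (L2 ℓ n) where
  carrier := {f | ∀ j, ∃ g, IsWeakRelDeriv j f g}
  zero_mem' := fun j => ⟨0, isWeakRelDeriv_zero j⟩
  add_mem' := fun hf hf' j => (hf j).elim fun g hg => (hf' j).elim fun g' hg' =>
    ⟨g + g', hg.add hg'⟩
  smul_mem' := fun c _ hf j => (hf j).elim fun g hg => ⟨c • g, hg.smul c⟩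

theorem isWeakRelDeriv_weakRelDeriv {f : L2 ℓ n} (hf : f ∈ momentumDomain ℓ n) (j : Fin 3) :
    IsWeakRelDeriv j f (weakRelDeriv j f) := by
  obtain ⟨g, hg⟩ := hf j
  rwa [hg.weakRelDeriv_eq]

theorem weakRelDeriv_add {f f' : L2 ℓ n} (hf : f ∈ momentumDomain ℓ n)
    (hf' : f' ∈ momentumDomain ℓ n) (j : Fin 3) :
    weakRelDeriv j (f + f') = weakRelDeriv j f + weakRelDeriv j f' :=
  ((isWeakRelDeriv_weakRelDeriv hf j).add (isWeakRelDeriv_weakRelDeriv hf' j)).weakRelDeriv_eq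

theorem weakRelDeriv_smul {f : L2 ℓ n} (hf : f ∈ momentumDomain ℓ n) (c : ℂ) (j : Fin 3) :
    weakRelDeriv j (c • f) = c • weakRelDeriv j f :=
  ((isWeakRelDeriv_weakRelDeriv hf j).smul c).weakRelDeriv_eq

theorem weakRelDeriv_zero (j : Fin 3) : weakRelDeriv j (0 : L2 ℓ n) = 0 :=
  (isWeakRelDeriv_zero j).weakRelDeriv_eq

theorem norm_relMomentum (j : Fin 3) (f : L2 ℓ n) : ‖relMomentum j f‖ = ‖weakRelDeriv j f‖ := by
  rw [relMomentum, norm_smul, norm_neg, Complex.norm_I, one_mul]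

theorem inner_relMomentum (j : Fin 3) (f g : L2 ℓ n) :
    inner ℂ (relMomentum j f) (relMomentum j g) =
      inner ℂ (weakRelDeriv j f) (weakRelDeriv j g) := by
  rw [relMomentum, relMomentum, inner_smul_left, inner_smul_right]
  simp [← mul_assoc]

/-- The form of `(-i∇_x - P_f)²` in the `n`-phonon sector. -/
def kinetic (f g : L2 ℓ n) : ℂ := ∑ j : Fin 3, inner ℂ (weakRelDeriv j f) (weakRelDeriv j g)

/-- The kinetic energy `‖(-i∇_x - P_f) f‖²`. -/
def kineticEnergy (f : L2 ℓ n) : ℝ := ∑ j : Fin 3, ‖weakRelDeriv j f‖ ^ 2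

theorem kineticEnergy_nonneg (f : L2 ℓ n) : 0 ≤ kineticEnergy f :=
  Finset.sum_nonneg fun _ _ => by positivity

theorem kinetic_self (f : L2 ℓ n) : kinetic f f = kineticEnergy f := by
  simp [kinetic, kineticEnergy, inner_self_eq_norm_sq_to_K]

theorem flow_compLp {F : ℂ → ℂ} {c : ℝ≥0} (hF : LipschitzWith c F) (hF0 : F 0 = 0) (j : Fin 3)
    (s : ℝ) (f : L2 ℓ n) : flow j s (hF.compLp hF0 f) = hF.compLp hF0 (flow j s f) := by
  apply Lp.ext
  have h1 := (measurePreserving_shift (ℓ := ℓ) (n := n)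
    (s • EuclideanSpace.single j (1 : ℝ))).quasiMeasurePreserving.ae_eq (hF.coeFn_compLp hF0 f)
  filter_upwards [coeFn_translate (s • EuclideanSpace.single j (1 : ℝ)) (hF.compLp hF0 f), h1,
    hF.coeFn_compLp hF0 (flow j s f),
    coeFn_translate (s • EuclideanSpace.single j (1 : ℝ)) f] with z h1 h2 h3 h4
  have h4' : flow j s f z = f (shift (s • EuclideanSpace.single j (1 : ℝ)) z) := h4
  rw [h3, Function.comp_apply, h4', flow, h1, h2]
  rfl

/-- A pointwise operation commutes with translations, so a Lipschitz `F` enlarges difference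
quotients by at most the factor `c`. This takes the place of the chain rule and requires no
differentiability of `F`. -/
theorem norm_flow_compLp_sub_le {F : ℂ → ℂ} {c : ℝ≥0} (hF : LipschitzWith c F) (hF0 : F 0 = 0)
    {f : L2 ℓ n} (hf : f ∈ momentumDomain ℓ n) (j : Fin 3) (s : ℝ) :
    ‖flow j s (hF.compLp hF0 f) - hF.compLp hF0 f‖ ≤ (c * ‖weakRelDeriv j f‖) * |s| := by
  rw [flow_compLp, mul_assoc]
  exact (hF.norm_compLp_sub_le hF0 _ _).trans (mul_le_mul_of_nonneg_left
    ((isWeakRelDeriv_weakRelDeriv hf j).norm_flow_sub_le s) c.2)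

theorem compLp_mem_momentumDomain {F : ℂ → ℂ} {c : ℝ≥0} (hF : LipschitzWith c F) (hF0 : F 0 = 0)
    {f : L2 ℓ n} (hf : f ∈ momentumDomain ℓ n) : hF.compLp hF0 f ∈ momentumDomain ℓ n :=
  fun j => exists_isWeakRelDeriv_of_norm_flow_sub_le (norm_flow_compLp_sub_le hF hF0 hf j)

theorem norm_weakRelDeriv_compLp_le {F : ℂ → ℂ} {c : ℝ≥0} (hF : LipschitzWith c F)
    (hF0 : F 0 = 0) {f : L2 ℓ n} (hf : f ∈ momentumDomain ℓ n) (j : Fin 3) :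
    ‖weakRelDeriv j (hF.compLp hF0 f)‖ ≤ c * ‖weakRelDeriv j f‖ :=
  norm_weakRelDeriv_le (norm_flow_compLp_sub_le hF hF0 hf j)

end MomentumDomain

/-! ### Hardy's inequality along the relative motion -/

section Hardy

variable {ℓ : ℝ} [Fact (0 < ℓ)] {n : ℕ}

/-- Multiplication by a bounded measurable function. -/
def mulBounded {w : Config ℓ n → ℂ} (hw : MemLp w ∞ volume) : L2 ℓ n →L[ℂ] L2 ℓ n :=
  (ContinuousLinearMap.mul ℂ ℂ).holderL volume ∞ 2 2 (hw.toLp w)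

theorem coeFn_mulBounded {w : Config ℓ n → ℂ} (hw : MemLp w ∞ volume) (f : L2 ℓ n) :
    mulBounded hw f =ᵐ[volume] fun z => w z * f z := by
  have h := (ContinuousLinearMap.mul ℂ ℂ).coeFn_holder (r := 2) (hw.toLp w) f
  filter_upwards [h, hw.coeFn_toLp] with z h1 h2
  refine h1.trans ?_
  rw [h2]
  rfl

theorem measurableEmbedding_shift (t : E3) :
    MeasurableEmbedding (shift t : Config ℓ n → Config ℓ n) :=
  Homeomorph.measurableEmbedding
    { toFun := shift t
      invFun := shift (-t)
      left_inv := fun z => by rw [shift_shift, neg_add_cancel, shift_zero]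
      right_inv := fun z => by rw [shift_shift, add_neg_cancel, shift_zero]
      continuous_toFun := continuous_shift t
      continuous_invFun := continuous_shift (-t) }

theorem integrable_norm_sq (f : L2 ℓ n) : Integrable (fun z => ‖f z‖ ^ 2) volume :=
  (Lp.memLp f).integrable_norm_pow (by simp)

theorem integral_norm_sq (f : L2 ℓ n) : ∫ z, ‖f z‖ ^ 2 = ‖f‖ ^ 2 := by
  have h := L2.inner_def (𝕜 := ℂ) f f
  rw [inner_self_eq_norm_sq_to_K] at h
  simp only [inner_self_eq_norm_sq_to_K] at h
  have h2 : ((‖f‖ ^ 2 : ℝ) : ℂ) = ((∫ z, ‖f z‖ ^ 2 : ℝ) : ℂ) := by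
    rw [← integral_complex_ofReal]
    simpa using h
  exact (Complex.ofReal_injective h2).symm

/-- The virial identity for a bounded weight in the position of the first phonon. -/
theorem integral_mul_norm_sq_le {j : Fin 3} {f : L2 ℓ (n + 1)} (hf : f ∈ momentumDomain ℓ (n + 1))
    {w w' : E3 → ℝ} {C : ℝ} (hwc : Continuous w) (hw'c : Continuous w') (hw : ∀ y, |w y| ≤ C)
    (hw' : ∀ y, |w' y| ≤ C)
    (hd : ∀ y (s : ℝ), HasDerivAt (fun s : ℝ => w (y + s • EuclideanSpace.single j (1 : ℝ)))
      (w' (y + s • EuclideanSpace.single j (1 : ℝ))) s) :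
    ∫ z, w' (z.2 0) * ‖f z‖ ^ 2 ≤
      2 * ‖weakRelDeriv j f‖ ^ 2 + 2⁻¹ * ∫ z, w (z.2 0) ^ 2 * ‖f z‖ ^ 2 := by
  set e : E3 := EuclideanSpace.single j (1 : ℝ) with he
  have hpc : Continuous (fun z : Config ℓ (n + 1) => z.2 0) := by fun_prop
  have hwL : MemLp (fun z : Config ℓ (n + 1) => (w (z.2 0) : ℂ)) ∞ volume := by
    refine memLp_top_of_bound
      (Complex.continuous_ofReal.comp (hwc.comp hpc)).aestronglyMeasurable C
      (Eventually.of_forall fun z => ?_)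
    simpa using hw (z.2 0)
  set M := mulBounded hwL with hM
  -- A change of variables moves the flow from `f` onto the weight. The shift subtracts `s • e` from
  -- every phonon coordinate, so the weight is displaced by `+s • e`.
  have hA : ∀ s : ℝ, (inner ℂ (flow j s f) (M (flow j s f)) : ℂ) =
      ((∫ z, w (z.2 0 + s • e) * ‖f z‖ ^ 2 : ℝ) : ℂ) := by
    intro s
    rw [← integral_complex_ofReal, ← (measurePreserving_shift (ℓ := ℓ) (n := n + 1)
      (s • e)).integral_comp (measurableEmbedding_shift (s • e)), L2.inner_def]
    refine integral_congr_ae ?_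
    filter_upwards [coeFn_mulBounded hwL (flow j s f), coeFn_translate (s • e) f] with z h1 h2
    have h2' : flow j s f z = f (shift (s • e) z) := h2
    rw [hM, h1, h2', RCLike.inner_apply]
    have h3 : (shift (s • e) z).2 0 + s • e = z.2 0 := by simp [shift]
    rw [h3, mul_assoc, Complex.mul_conj, Complex.normSq_eq_norm_sq]
    push_cast
    ring
  have hB : HasDerivAt (fun s : ℝ => ∫ z, w (z.2 0 + s • e) * ‖f z‖ ^ 2)
      (∫ z, w' (z.2 0) * ‖f z‖ ^ 2) 0 := by
    have hm : ∀ (u : E3 → ℝ) (s : ℝ), Continuous u →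
        AEStronglyMeasurable (fun z : Config ℓ (n + 1) => u (z.2 0 + s • e) * ‖f z‖ ^ 2) volume :=
      fun u s hu => (hu.comp (hpc.add continuous_const)).aestronglyMeasurable.mul
        (integrable_norm_sq f).aestronglyMeasurable
    have hbd : Integrable (fun z => C * ‖f z‖ ^ 2) volume := (integrable_norm_sq f).const_mul C
    have h := hasDerivAt_integral_of_dominated_loc_of_deriv_le (𝕜 := ℝ)
      (μ := (volume : Measure (Config ℓ (n + 1))))
      (F := fun s z => w (z.2 0 + s • e) * ‖f z‖ ^ 2)
      (F' := fun s z => w' (z.2 0 + s • e) * ‖f z‖ ^ 2) (x₀ := 0)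
      (bound := fun z => C * ‖f z‖ ^ 2)
      (Metric.ball_mem_nhds (0 : ℝ) one_pos) (Eventually.of_forall fun s => hm w s hwc)
      (hbd.mono' (hm w 0 hwc) (Eventually.of_forall fun z => ?_)) (hm w' 0 hw'c)
      (Eventually.of_forall fun z s hs => ?_) hbd
      (Eventually.of_forall fun z s _ => (hd (z.2 0) s).mul_const _)
    · simpa using h.2
    · rw [norm_mul, norm_pow, norm_norm]
      exact mul_le_mul_of_nonneg_right (hw _) (by positivity)
    · rw [norm_mul, norm_pow, norm_norm]
      exact mul_le_mul_of_nonneg_right (hw' _) (by positivity)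
  have hD := isWeakRelDeriv_iff_hasDerivAt.mp (isWeakRelDeriv_weakRelDeriv hf j)
  have hMD : HasDerivAt (fun s : ℝ => M (flow j s f)) (M (weakRelDeriv j f)) 0 :=
    (M.restrictScalars ℝ).hasFDerivAt.comp_hasDerivAt (0 : ℝ) hD
  -- The same function of `s` is differentiated at zero twice: by the product rule in `L²`, and
  -- under the integral through the weight (`hB`).
  have hI := HasDerivAt.inner ℂ hD hMD
  have hB' := hB.ofReal_comp
  simp only [hA] at hI
  have heq := hI.unique hB'
  rw [flow_zero] at heq
  have hMsymm : inner ℂ f (M (weakRelDeriv j f)) = inner ℂ (M f) (weakRelDeriv j f) := by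
    rw [L2.inner_def, L2.inner_def]
    refine integral_congr_ae ?_
    filter_upwards [coeFn_mulBounded hwL (weakRelDeriv j f), coeFn_mulBounded hwL f] with z h1 h2
    rw [hM, h1, h2, RCLike.inner_apply, RCLike.inner_apply, map_mul, Complex.conj_ofReal]
    ring
  have hMf : ‖M f‖ ^ 2 = ∫ z, w (z.2 0) ^ 2 * ‖f z‖ ^ 2 := by
    rw [← integral_norm_sq]
    refine integral_congr_ae ?_
    filter_upwards [coeFn_mulBounded hwL f] with z h1
    rw [hM, h1, norm_mul, mul_pow]
    simp
  have hre : ∫ z, w' (z.2 0) * ‖f z‖ ^ 2 ≤ 2 * (‖M f‖ * ‖weakRelDeriv j f‖) := by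
    have h1 := congrArg Complex.re heq
    rw [Complex.ofReal_re, Complex.add_re, hMsymm] at h1
    have h2 : (inner ℂ (M f) (weakRelDeriv j f)).re ≤ ‖M f‖ * ‖weakRelDeriv j f‖ :=
      re_inner_le_norm (𝕜 := ℂ) (M f) (weakRelDeriv j f)
    have h3 : (inner ℂ (weakRelDeriv j f) (M f)).re ≤ ‖weakRelDeriv j f‖ * ‖M f‖ :=
      re_inner_le_norm (𝕜 := ℂ) (weakRelDeriv j f) (M f)
    rw [← h1]
    linarith
  rw [← hMf]
  nlinarith [sq_nonneg (‖M f‖ - 2 * ‖weakRelDeriv j f‖)]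

/-- Hardy's inequality with a regularized weight. -/
theorem integral_div_norm_sq_add_le {f : L2 ℓ (n + 1)} (hf : f ∈ momentumDomain ℓ (n + 1))
    {ε : ℝ} (hε : 0 < ε) :
    ∫ z, (‖z.2 0‖ ^ 2 + ε ^ 2)⁻¹ * ‖f z‖ ^ 2 ≤ 4 * kineticEnergy f := by
  set r : E3 → ℝ := fun y => (‖y‖ ^ 2 + ε ^ 2)⁻¹ with hr
  have hpos : ∀ y : E3, 0 < ‖y‖ ^ 2 + ε ^ 2 := fun y => by positivity
  have hrc : Continuous r := Continuous.inv₀ (by fun_prop) fun y => (hpos y).ne'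
  have hr0 : ∀ y, 0 ≤ r y := fun y => (inv_pos.mpr (hpos y)).le
  have hrle : ∀ y, r y ≤ (ε ^ 2)⁻¹ := fun y =>
    inv_anti₀ (by positivity) (by nlinarith [sq_nonneg ‖y‖])
  have hyj : ∀ (y : E3) (j : Fin 3), (y j) ^ 2 ≤ ‖y‖ ^ 2 := fun y j => by
    have := PiLp.norm_apply_le y j
    rw [Real.norm_eq_abs] at this
    rw [← sq_abs (y j)]
    gcongr
  have hrn : ∀ y, r y * (‖y‖ ^ 2 + ε ^ 2) = 1 := fun y => inv_mul_cancel₀ (hpos y).ne'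
  have hpc : Continuous (fun z : Config ℓ (n + 1) => z.2 0) := by fun_prop
  -- The vector field `y / (|y|² + ε²)`. In dimension three its divergence is `3r - 2|y|²r² ≥ r`,
  -- while its squared length is `|y|²r² ≤ r`. Summing the virial inequalities over `j` gives `∫
  -- r|f|² ≤ 2T + ½ ∫ r|f|²` with `T` the kinetic energy, hence the constant 4.
  set w : Fin 3 → E3 → ℝ := fun j y => y j * r y with hw
  set w' : Fin 3 → E3 → ℝ := fun j y => r y - 2 * (y j) ^ 2 * r y ^ 2 with hw'
  have hwc : ∀ j, Continuous (w j) := fun j => Continuous.mul (by fun_prop) hrc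
  have hw'c : ∀ j, Continuous (w' j) := fun j =>
    hrc.sub (Continuous.mul (by fun_prop) (hrc.pow 2))
  have hsq : ∀ j y, (y j) ^ 2 * r y ≤ 1 := fun j y => by
    rw [← hrn y, mul_comm]
    exact mul_le_mul_of_nonneg_left (by nlinarith [hyj y j]) (hr0 y)
  have hwsq : ∀ j y, (w j y) ^ 2 ≤ r y := fun j y => by
    have h1 : (w j y) ^ 2 = ((y j) ^ 2 * r y) * r y := by simp only [hw]; ring
    rw [h1]
    exact mul_le_of_le_one_left (hr0 y) (hsq j y)
  set C : ℝ := 2 * (ε ^ 2)⁻¹ + 1 with hC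
  have hεi : 0 < (ε ^ 2)⁻¹ := by positivity
  have hwb : ∀ j y, |w j y| ≤ C := fun j y => by
    rw [abs_le]
    have := (hwsq j y).trans (hrle y)
    constructor <;> nlinarith [sq_nonneg (w j y - 1), sq_nonneg (w j y + 1)]
  have hw'b : ∀ j y, |w' j y| ≤ C := fun j y => by
    have h1 : 0 ≤ (y j) ^ 2 * r y ^ 2 := by positivity
    have h2 : (y j) ^ 2 * r y ^ 2 ≤ r y := by
      have : (y j) ^ 2 * r y ^ 2 = ((y j) ^ 2 * r y) * r y := by ring
      rw [this]
      exact mul_le_of_le_one_left (hr0 y) (hsq j y)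
    have h3 := hrle y
    have h4 := hr0 y
    simp only [hw']
    rw [abs_le]
    constructor <;> nlinarith
  have hderiv : ∀ (j : Fin 3) (y : E3) (s : ℝ),
      HasDerivAt (fun s : ℝ => w j (y + s • EuclideanSpace.single j (1 : ℝ)))
        (w' j (y + s • EuclideanSpace.single j (1 : ℝ))) s := by
    intro j y s
    set e : E3 := EuclideanSpace.single j (1 : ℝ) with he
    have hline : HasDerivAt (fun s : ℝ => y + s • e) e s := by
      simpa using ((hasDerivAt_id s).smul_const e).const_add y
    have hcoord : HasDerivAt (fun s : ℝ => (y + s • e) j) 1 s := by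
      have h1 : (fun s : ℝ => (y + s • e) j) = fun s => y j + s := by
        funext s; simp [he]
      rw [h1]
      exact (hasDerivAt_id s).const_add (y j)
    have hn : HasDerivAt (fun s : ℝ => ‖y + s • e‖ ^ 2 + ε ^ 2) (2 * (y + s • e) j) s := by
      have h1 := hline.norm_sq.add_const (ε ^ 2)
      have h2 : inner ℝ (y + s • e) e = (y + s • e) j := by
        rw [he, EuclideanSpace.inner_single_right]
        simp
      rwa [h2] at h1
    have h5 := hcoord.mul (hn.inv (hpos _).ne')
    refine h5.congr_deriv ?_
    simp only [hw', hr, Pi.inv_apply]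
    field_simp
    ring
  have hintegrable : ∀ (u : E3 → ℝ) (K : ℝ), Continuous u → (∀ y, |u y| ≤ K) →
      Integrable (fun z : Config ℓ (n + 1) => u (z.2 0) * ‖f z‖ ^ 2) volume := by
    intro u K hu hK
    refine ((integrable_norm_sq f).const_mul K).mono'
      ((hu.comp hpc).aestronglyMeasurable.mul (integrable_norm_sq f).aestronglyMeasurable)
      (Eventually.of_forall fun z => ?_)
    rw [norm_mul, norm_pow, norm_norm]
    exact mul_le_mul_of_nonneg_right (hK _) (by positivity)
  have hsum := Finset.sum_le_sum fun (j : Fin 3) (_ : j ∈ Finset.univ) =>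
    integral_mul_norm_sq_le (j := j) hf (hwc j) (hw'c j) (hwb j) (hw'b j) (hderiv j)
  rw [← integral_finsetSum _ fun j _ => hintegrable _ C (hw'c j) (hw'b j), Finset.sum_add_distrib,
    ← Finset.mul_sum, ← Finset.mul_sum, ← integral_finsetSum _ fun j _ =>
      hintegrable (fun y => w j y ^ 2) (ε ^ 2)⁻¹ ((hwc j).pow 2) fun y => by
        rw [abs_of_nonneg (sq_nonneg _)]; exact (hwsq j y).trans (hrle y)] at hsum
  have hrint := hintegrable r (ε ^ 2)⁻¹ hrc fun y => by rw [abs_of_nonneg (hr0 y)]; exact hrle y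
  have hn3 : ∀ y : E3, ∑ j, (y j) ^ 2 = ‖y‖ ^ 2 := fun y => by
    rw [EuclideanSpace.norm_sq_eq]; simp
  have hlow : ∫ z, r (z.2 0) * ‖f z‖ ^ 2 ≤ ∫ z, ∑ j, w' j (z.2 0) * ‖f z‖ ^ 2 := by
    refine integral_mono hrint (integrable_finsetSum _ fun j _ => hintegrable _ C (hw'c j) (hw'b j))
      fun z => ?_
    simp only
    rw [← Finset.sum_mul]
    refine mul_le_mul_of_nonneg_right ?_ (by positivity)
    have h1 : ∑ j, w' j (z.2 0) = 3 * r (z.2 0) - 2 * ‖z.2 0‖ ^ 2 * r (z.2 0) ^ 2 := by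
      simp only [hw', Finset.sum_sub_distrib, Finset.sum_const, Finset.card_univ,
        Fintype.card_fin, nsmul_eq_mul]
      rw [← Finset.sum_mul, ← Finset.mul_sum, hn3]
      norm_num
    rw [h1]
    have h2 : ‖z.2 0‖ ^ 2 * r (z.2 0) ≤ 1 := by
      rw [← hrn (z.2 0), mul_comm]
      exact mul_le_mul_of_nonneg_left (by nlinarith) (hr0 _)
    nlinarith [hr0 (z.2 0)]
  have hup : ∫ z, ∑ j, w j (z.2 0) ^ 2 * ‖f z‖ ^ 2 ≤ ∫ z, r (z.2 0) * ‖f z‖ ^ 2 := by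
    refine integral_mono (integrable_finsetSum _ fun j _ => hintegrable (fun y => w j y ^ 2)
      (ε ^ 2)⁻¹ ((hwc j).pow 2) fun y => by
        rw [abs_of_nonneg (sq_nonneg _)]; exact (hwsq j y).trans (hrle y)) hrint fun z => ?_
    simp only
    rw [← Finset.sum_mul]
    refine mul_le_mul_of_nonneg_right ?_ (by positivity)
    have h1 : ∑ j, w j (z.2 0) ^ 2 = ‖z.2 0‖ ^ 2 * r (z.2 0) ^ 2 := by
      simp only [hw, mul_pow]
      rw [← Finset.sum_mul, hn3]
    rw [h1]
    have h2 : ‖z.2 0‖ ^ 2 * r (z.2 0) ≤ 1 := by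
      rw [← hrn (z.2 0), mul_comm]
      exact mul_le_mul_of_nonneg_left (by nlinarith) (hr0 _)
    nlinarith [hr0 (z.2 0)]
  rw [kineticEnergy]
  change ∫ z, r (z.2 0) * ‖f z‖ ^ 2 ≤ _
  linarith

/-- Hardy's inequality. -/
theorem lintegral_div_norm_sq_le {f : L2 ℓ (n + 1)} (hf : f ∈ momentumDomain ℓ (n + 1)) :
    ∫⁻ z, ENNReal.ofReal (formFactor (z.2 0) * ‖f z‖ ^ 2) ≤
      ENNReal.ofReal (4 * kineticEnergy f) := by
  set ε : ℕ → ℝ := fun k => 1 / ((k : ℝ) + 1) with hε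
  have hεpos : ∀ k, 0 < ε k := fun k => by positivity
  have hpc : Continuous (fun z : Config ℓ (n + 1) => z.2 0) := by fun_prop
  have hlim : Tendsto ε atTop (𝓝 0) := tendsto_one_div_add_atTop_nhds_zero_nat
  set F : ℕ → Config ℓ (n + 1) → ℝ := fun k z => (‖z.2 0‖ ^ 2 + ε k ^ 2)⁻¹ * ‖f z‖ ^ 2 with hF
  have hcont : ∀ k, Continuous (fun z : Config ℓ (n + 1) => (‖z.2 0‖ ^ 2 + ε k ^ 2)⁻¹) :=
    fun k => Continuous.inv₀ (by fun_prop) fun z => by have := hεpos k; positivity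
  have hle : ∀ k, ∫⁻ z, ENNReal.ofReal (F k z) ≤ ENNReal.ofReal (4 * kineticEnergy f) := by
    intro k
    have hintegrable : Integrable (F k) volume := by
      refine ((integrable_norm_sq f).const_mul ((ε k ^ 2)⁻¹)).mono'
        ((hcont k).aestronglyMeasurable.mul (integrable_norm_sq f).aestronglyMeasurable)
        (Eventually.of_forall fun z => ?_)
      have h1 : (‖z.2 0‖ ^ 2 + ε k ^ 2)⁻¹ ≤ (ε k ^ 2)⁻¹ :=
        inv_anti₀ (by have := hεpos k; positivity) (by nlinarith [sq_nonneg ‖z.2 0‖])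
      rw [Real.norm_of_nonneg (by positivity)]
      exact mul_le_mul_of_nonneg_right h1 (by positivity)
    rw [← ofReal_integral_eq_lintegral_ofReal hintegrable
      (Eventually.of_forall fun z => by simp only [hF, Pi.zero_apply]; positivity)]
    exact ENNReal.ofReal_le_ofReal (integral_div_norm_sq_add_le hf (hεpos k))
  have hmeas : ∀ k, AEMeasurable (fun z => ENNReal.ofReal (F k z)) volume := fun k =>
    ((hcont k).aestronglyMeasurable.mul
      (integrable_norm_sq f).aestronglyMeasurable).aemeasurable.ennreal_ofReal
  -- Fatou's lemma removes the regularization. At `y₁ = 0` the form factor is `1 / 0 = 0`, so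
  -- nothing has to be shown there.
  calc ∫⁻ z, ENNReal.ofReal (formFactor (z.2 0) * ‖f z‖ ^ 2)
      ≤ ∫⁻ z, liminf (fun k => ENNReal.ofReal (F k z)) atTop := by
        refine lintegral_mono fun z => ?_
        by_cases hz : z.2 0 = 0
        · simp [formFactor, hz]
        · have h1 : Tendsto (fun k => F k z) atTop (𝓝 (formFactor (z.2 0) * ‖f z‖ ^ 2)) := by
            refine Tendsto.mul_const _ ?_
            have h2 : formFactor (z.2 0) = (‖z.2 0‖ ^ 2 + 0 ^ 2)⁻¹ := by simp [formFactor]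
            rw [h2]
            refine Tendsto.inv₀ (tendsto_const_nhds.add (hlim.pow 2)) ?_
            have : 0 < ‖z.2 0‖ := norm_pos_iff.mpr hz
            positivity
          exact ((ENNReal.tendsto_ofReal h1).liminf_eq).ge
    _ ≤ liminf (fun k => ∫⁻ z, ENNReal.ofReal (F k z)) atTop := lintegral_liminf_le' hmeas
    _ ≤ ENNReal.ofReal (4 * kineticEnergy f) :=
        liminf_le_of_frequently_le' (Frequently.of_forall hle)

end Hardy

/-! ### The interaction -/

section FormFactor

theorem formFactor_nonneg (y : E3) : 0 ≤ formFactor y := by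
  rw [formFactor]; positivity

theorem formFactor_pos {y : E3} (hy : y ≠ 0) : 0 < formFactor y := by
  have : 0 < ‖y‖ := norm_pos_iff.mpr hy
  rw [formFactor]; positivity

theorem measurable_formFactor : Measurable formFactor := by
  unfold formFactor; fun_prop

/-- In polar coordinates the radial density `t²` cancels the singularity `t⁻²`. -/
theorem integrableOn_formFactor_ball : IntegrableOn formFactor (Metric.ball (0 : E3) 1) := by
  have h := (integrableOn_fun_norm_addHaar (E := E3) volume (f := fun t : ℝ => 1 / t ^ 2)
    (r := 1)).mpr ?_
  · exact h
  · refine (integrableOn_congr_fun (g := fun _ : ℝ => (1 : ℝ)) ?_ measurableSet_Ioo).mpr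
      (integrableOn_const (by simp))
    intro t ht
    have : t ≠ 0 := ht.1.ne'
    simp only [finrank_euclideanSpace, Fintype.card_fin, smul_eq_mul]
    field_simp

/-- The balls of radius `1 / (k + 1)` decrease to a null set. The smallness obtained here
compensates the large factor `κ⁻¹` in `exists_interaction_bound`. -/
theorem exists_integral_formFactor_le {κ : ℝ} (hκ : 0 < κ) :
    ∃ r : ℝ, 0 < r ∧ IntegrableOn formFactor (Metric.ball (0 : E3) r) ∧
      ∫ y in Metric.ball (0 : E3) r, formFactor y ≤ κ := by
  have hanti : Antitone (fun k : ℕ => Metric.ball (0 : E3) (1 / ((k : ℝ) + 1))) := by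
    intro k l hkl
    refine Metric.ball_subset_ball ?_
    gcongr
  have h := tendsto_setIntegral_of_antitone (f := formFactor) (μ := volume)
    (fun k => measurableSet_ball) hanti ⟨0, by simpa using integrableOn_formFactor_ball⟩
  have hinter : ⋂ k : ℕ, Metric.ball (0 : E3) (1 / ((k : ℝ) + 1)) ⊆ {0} := by
    intro y hy
    rw [Set.mem_singleton_iff, ← norm_le_zero_iff]
    refine ge_of_tendsto (tendsto_one_div_add_atTop_nhds_zero_nat (𝕜 := ℝ))
      (Eventually.of_forall fun k => ?_)
    have := Set.mem_iInter.mp hy k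
    exact (mem_ball_zero_iff.mp this).le
  have h0 : volume (⋂ k : ℕ, Metric.ball (0 : E3) (1 / ((k : ℝ) + 1))) = 0 :=
    measure_mono_null hinter (by simp)
  rw [setIntegral_measure_zero _ h0] at h
  obtain ⟨k, hk⟩ := (h.eventually (gt_mem_nhds hκ)).exists
  refine ⟨1 / ((k : ℝ) + 1), by positivity, ?_, hk.le⟩
  refine integrableOn_formFactor_ball.mono_set (Metric.ball_subset_ball ?_)
  rw [div_le_one (by positivity)]
  linarith [(Nat.cast_nonneg k : (0 : ℝ) ≤ k)]

/-- The decay `|y|⁻⁴` beats dimension three. Off the ball `1 + ‖y‖ ≤ (r⁻¹ + 1) ‖y‖`, which permits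
comparison with an integrable power of `1 + ‖y‖`. -/
theorem integrableOn_formFactor_sq_compl_ball {r : ℝ} (hr : 0 < r) :
    IntegrableOn (fun y => formFactor y ^ 2) (Metric.ball (0 : E3) r)ᶜ := by
  have h1 : Integrable (fun y : E3 => (r⁻¹ + 1) ^ 4 * (1 + ‖y‖) ^ (-(4 : ℝ))) volume :=
    (integrable_one_add_norm (E := E3) (μ := volume) (r := 4)
      (by simp; norm_num)).const_mul ((r⁻¹ + 1) ^ 4)
  refine Integrable.mono' h1.integrableOn (measurable_formFactor.pow_const 2).aestronglyMeasurable ?_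
  filter_upwards [ae_restrict_mem measurableSet_ball.compl] with y hy
  have hy' : r ≤ ‖y‖ := by simpa using hy
  have hy0 : 0 < ‖y‖ := hr.trans_le hy'
  rw [Real.norm_of_nonneg (by positivity), formFactor, Real.rpow_neg (by positivity)]
  have h2 : 1 + ‖y‖ ≤ (r⁻¹ + 1) * ‖y‖ := by
    have : 1 ≤ r⁻¹ * ‖y‖ := by
      rw [← div_eq_inv_mul, one_le_div hr]; exact hy'
    linarith
  have h3 : (1 + ‖y‖) ^ 4 ≤ (r⁻¹ + 1) ^ 4 * ‖y‖ ^ 4 := by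
    rw [← mul_pow]; gcongr
  have h4 : (1 + ‖y‖) ^ (4 : ℝ) = (1 + ‖y‖) ^ 4 := by
    exact_mod_cast Real.rpow_natCast (1 + ‖y‖) 4
  rw [h4, ← div_eq_mul_inv, div_pow, one_pow, ← pow_mul, div_le_div_iff₀ (by positivity)
    (by positivity)]
  simpa using h3

end FormFactor

/-! ### Coupling of neighbouring sectors and its relative form bound -/

section Interaction

variable {ℓ : ℝ} [Fact (0 < ℓ)] {n : ℕ}

/-- Adjoining a phonon at the first place. -/
def consMap (p : Config ℓ n × E3) : Config ℓ (n + 1) :=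
  (p.1.1, (Fin.cons p.2 p.1.2 : Fin (n + 1) → E3))

variable (ℓ n) in
/-- Adjoining a phonon at the first place, as an equivalence of measurable spaces. -/
def consEquiv : Config ℓ n × E3 ≃ᵐ Config ℓ (n + 1) :=
  (MeasurableEquiv.prodAssoc.trans
    (MeasurableEquiv.prodCongr (MeasurableEquiv.refl (Torus ℓ)) MeasurableEquiv.prodComm)).trans
    (MeasurableEquiv.prodCongr (MeasurableEquiv.refl (Torus ℓ))
      (MeasurableEquiv.piFinSuccAbove (fun _ => E3) 0).symm)

theorem coe_consEquiv : ⇑(consEquiv ℓ n) = consMap := by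
  funext p
  refine Prod.ext rfl ?_
  change Fin.insertNth (α := fun _ => E3) 0 p.2 p.1.2 = Fin.cons p.2 p.1.2
  exact Fin.insertNth_zero' _ _

theorem measurableEmbedding_consMap :
    MeasurableEmbedding (consMap : Config ℓ n × E3 → Config ℓ (n + 1)) :=
  coe_consEquiv (ℓ := ℓ) (n := n) ▸ (consEquiv ℓ n).measurableEmbedding

theorem measurePreserving_consMap :
    MeasurePreserving (consMap : Config ℓ n × E3 → Config ℓ (n + 1))
      ((volume : Measure (Config ℓ n)).prod (volume : Measure E3)) volume := by
  rw [← coe_consEquiv]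
  have h1 := measurePreserving_prodAssoc (volume : Measure (Torus ℓ))
    (volume : Measure (Fin n → E3)) (volume : Measure E3)
  have h2 := (MeasurePreserving.id (volume : Measure (Torus ℓ))).prod
    (Measure.measurePreserving_swap (μ := (volume : Measure (Fin n → E3)))
      (ν := (volume : Measure E3)))
  have h3 := (MeasurePreserving.id (volume : Measure (Torus ℓ))).prod
    (volume_preserving_piFinSuccAbove (fun _ : Fin (n + 1) => E3) 0).symm
  exact (h3.comp h2).comp h1

/-- `∫ |θ(x, y₁, …)| v(y) |ψ(x, y, y₁, …)|`. -/
def absKernel (θ : L2 ℓ n) (ψ : L2 ℓ (n + 1)) (p : Config ℓ n × E3) : ℝ :=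
  ‖θ p.1‖ * (formFactor p.2 * ‖ψ (consMap p)‖)

/-- The integrand of `⟨θ, a(v) ψ⟩`, up to the factor `√(n+1)`. -/
def kernel (θ : L2 ℓ n) (ψ : L2 ℓ (n + 1)) (p : Config ℓ n × E3) : ℂ :=
  conj (θ p.1) * ((formFactor p.2 : ℂ) * ψ (consMap p))

/-- `⟨θ, a(v) ψ⟩ / √(n+1)`. -/
def pairing (θ : L2 ℓ n) (ψ : L2 ℓ (n + 1)) : ℂ :=
  ∫ p, kernel θ ψ p ∂((volume : Measure (Config ℓ n)).prod (volume : Measure E3))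

theorem norm_kernel (θ : L2 ℓ n) (ψ : L2 ℓ (n + 1)) (p : Config ℓ n × E3) :
    ‖kernel θ ψ p‖ = absKernel θ ψ p := by
  rw [kernel, absKernel, norm_mul, norm_mul, RCLike.norm_conj, Complex.norm_real,
    Real.norm_of_nonneg (formFactor_nonneg _)]

theorem aestronglyMeasurable_kernel (θ : L2 ℓ n) (ψ : L2 ℓ (n + 1)) :
    AEStronglyMeasurable (kernel θ ψ)
      ((volume : Measure (Config ℓ n)).prod (volume : Measure E3)) := by
  have h1 : AEStronglyMeasurable (fun p : Config ℓ n × E3 => θ p.1)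
      ((volume : Measure (Config ℓ n)).prod (volume : Measure E3)) :=
    (Lp.aestronglyMeasurable θ).comp_quasiMeasurePreserving Measure.quasiMeasurePreserving_fst
  have h2 : AEStronglyMeasurable (fun p : Config ℓ n × E3 => ψ (consMap p))
      ((volume : Measure (Config ℓ n)).prod (volume : Measure E3)) :=
    (Lp.aestronglyMeasurable ψ).comp_quasiMeasurePreserving
      measurePreserving_consMap.quasiMeasurePreserving
  have h3 : AEStronglyMeasurable (fun p : Config ℓ n × E3 => (formFactor p.2 : ℂ))
      ((volume : Measure (Config ℓ n)).prod (volume : Measure E3)) :=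
    (Complex.measurable_ofReal.comp
      (measurable_formFactor.comp measurable_snd)).aestronglyMeasurable
  exact (Complex.continuous_conj.comp_aestronglyMeasurable h1).mul (h3.mul h2)

theorem aestronglyMeasurable_absKernel (θ : L2 ℓ n) (ψ : L2 ℓ (n + 1)) :
    AEStronglyMeasurable (absKernel θ ψ)
      ((volume : Measure (Config ℓ n)).prod (volume : Measure E3)) := by
  have h := (aestronglyMeasurable_kernel θ ψ).norm
  simpa only [norm_kernel] using h

theorem integrable_formFactor_mul_norm_sq {ψ : L2 ℓ (n + 1)}
    (hψ : ψ ∈ momentumDomain ℓ (n + 1)) :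
    Integrable (fun z => formFactor (z.2 0) * ‖ψ z‖ ^ 2) volume := by
  have hpc : Continuous (fun z : Config ℓ (n + 1) => z.2 0) := by fun_prop
  refine ⟨(measurable_formFactor.comp hpc.measurable).aestronglyMeasurable.mul
    (integrable_norm_sq ψ).aestronglyMeasurable, ?_⟩
  rw [hasFiniteIntegral_iff_ofReal (Eventually.of_forall fun z =>
    mul_nonneg (formFactor_nonneg _) (by positivity))]
  exact (lintegral_div_norm_sq_le hψ).trans_lt ENNReal.ofReal_lt_top

theorem integral_formFactor_mul_norm_sq_le {ψ : L2 ℓ (n + 1)}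
    (hψ : ψ ∈ momentumDomain ℓ (n + 1)) :
    ∫ z, formFactor (z.2 0) * ‖ψ z‖ ^ 2 ≤ 4 * kineticEnergy ψ := by
  have h := lintegral_div_norm_sq_le hψ
  rw [← ofReal_integral_eq_lintegral_ofReal (integrable_formFactor_mul_norm_sq hψ)
    (Eventually.of_forall fun z => mul_nonneg (formFactor_nonneg _) (by positivity))] at h
  exact (ENNReal.ofReal_le_ofReal_iff (mul_nonneg (by norm_num) (kineticEnergy_nonneg ψ))).mp h

/-- The interaction is infinitesimally form bounded. -/
theorem exists_interaction_bound {κ : ℝ} (hκ : 0 < κ) :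
    ∃ C : ℝ, 0 ≤ C ∧ ∀ (n : ℕ) (θ : L2 ℓ n) (ψ : L2 ℓ (n + 1)), ψ ∈ momentumDomain ℓ (n + 1) →
      Integrable (absKernel θ ψ) ((volume : Measure (Config ℓ n)).prod (volume : Measure E3)) ∧
      √(n + 1) * ∫ p, absKernel θ ψ p ∂((volume : Measure (Config ℓ n)).prod (volume : Measure E3))
        ≤ κ * ((n + 1) * ‖θ‖ ^ 2 + kineticEnergy ψ + (n + 1) * ‖ψ‖ ^ 2) + C * ‖θ‖ ^ 2 := by
  -- The form factor is cut at radius `r`: the singular part has integral at most `κ²`, the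
  -- remainder is square integrable.
  obtain ⟨r, hr, hint1, hle1⟩ := exists_integral_formFactor_le (κ := κ ^ 2) (by positivity)
  have hint2 := integrableOn_formFactor_sq_compl_ball hr
  set k1 : E3 → ℝ := (Metric.ball (0 : E3) r).indicator formFactor with hk1
  set k2 : E3 → ℝ := (Metric.ball (0 : E3) r)ᶜ.indicator (fun y => formFactor y ^ 2) with hk2
  have hk1i : Integrable k1 volume := (integrable_indicator_iff measurableSet_ball).mpr hint1
  have hk2i : Integrable k2 volume :=
    (integrable_indicator_iff measurableSet_ball.compl).mpr hint2
  have hk1le : ∫ y, k1 y ≤ κ ^ 2 := by rwa [hk1, integral_indicator measurableSet_ball]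
  have hk1n : ∀ y, 0 ≤ k1 y := fun y => Set.indicator_nonneg (fun y _ => formFactor_nonneg y) y
  have hk2n : ∀ y, 0 ≤ k2 y := fun y => Set.indicator_nonneg (fun y _ => by positivity) y
  refine ⟨(4 * κ)⁻¹ * ∫ y, k2 y, mul_nonneg (by positivity) (integral_nonneg hk2n),
    fun n θ ψ hψ => ?_⟩
  set μ := (volume : Measure (Config ℓ n)).prod (volume : Measure E3) with hμ
  set N : ℝ := (n : ℝ) + 1 with hN
  have hNpos : 0 < N := by positivity
  -- Majorant from two weighted arithmetic-geometric mean inequalities. Inside the ball `√N a b` is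
  -- split and then multiplied by `v`: the `θ` term costs `κ⁻¹ · κ² = κ`, and the weight `κ / 4` on
  -- the `ψ` term cancels the constant of Hardy's inequality. Outside the ball `v` is grouped with
  -- `θ`, which produces the constant `C`, and `√N` with `ψ`.
  set B : Config ℓ n × E3 → ℝ := fun p =>
    (κ⁻¹ * N) * (‖θ p.1‖ ^ 2 * k1 p.2) + (κ / 4) * (formFactor p.2 * ‖ψ (consMap p)‖ ^ 2)
      + ((4 * κ)⁻¹ * (‖θ p.1‖ ^ 2 * k2 p.2) + (κ * N) * ‖ψ (consMap p)‖ ^ 2) with hB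
  have hi1 : Integrable (fun p : Config ℓ n × E3 => ‖θ p.1‖ ^ 2 * k1 p.2) μ :=
    (integrable_norm_sq θ).mul_prod hk1i
  have hi2 : Integrable (fun p : Config ℓ n × E3 => ‖θ p.1‖ ^ 2 * k2 p.2) μ :=
    (integrable_norm_sq θ).mul_prod hk2i
  have hi3 : Integrable (fun p : Config ℓ n × E3 => formFactor p.2 * ‖ψ (consMap p)‖ ^ 2) μ :=
    (measurePreserving_consMap.integrable_comp_emb measurableEmbedding_consMap).mpr
      (integrable_formFactor_mul_norm_sq hψ)
  have hi4 : Integrable (fun p : Config ℓ n × E3 => ‖ψ (consMap p)‖ ^ 2) μ :=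
    (measurePreserving_consMap.integrable_comp_emb measurableEmbedding_consMap).mpr
      (integrable_norm_sq ψ)
  have hBi : Integrable B μ :=
    ((hi1.const_mul _).add (hi3.const_mul _)).add ((hi2.const_mul _).add (hi4.const_mul _))
  have hpt : ∀ p, √N * absKernel θ ψ p ≤ B p := by
    intro p
    have hs : √N * √N = N := Real.mul_self_sqrt hNpos.le
    have hv := formFactor_nonneg p.2
    have ha := norm_nonneg (θ p.1)
    have hb := norm_nonneg (ψ (consMap p))
    simp only [hB, absKernel]
    set a := ‖θ p.1‖
    set b := ‖ψ (consMap p)‖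
    set v := formFactor p.2 with hvdef
    by_cases hp : p.2 ∈ Metric.ball (0 : E3) r
    · have e1 : k1 p.2 = v := Set.indicator_of_mem hp _
      have e2 : k2 p.2 = 0 := Set.indicator_of_notMem (by simpa using hp) _
      rw [e1, e2]
      have h1 : √N * a * b ≤ κ⁻¹ * N * a ^ 2 + κ / 4 * b ^ 2 := by
        have h2 : ∀ q : ℝ, κ⁻¹ * (q * q) * a ^ 2 + κ / 4 * b ^ 2 - q * a * b
            = κ⁻¹ * (q * a - κ / 2 * b) ^ 2 := fun q => by
          field_simp
          ring
        have h2 := h2 (√N)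
        rw [hs] at h2
        have h3 : 0 ≤ κ⁻¹ * (√N * a - κ / 2 * b) ^ 2 := by positivity
        linarith
      have h4 := mul_le_mul_of_nonneg_left h1 hv
      have h5 : 0 ≤ κ * N * b ^ 2 := by positivity
      nlinarith
    · have e1 : k1 p.2 = 0 := Set.indicator_of_notMem hp _
      have e2 : k2 p.2 = v ^ 2 := Set.indicator_of_mem (by simpa using hp) _
      rw [e1, e2]
      have h1 : √N * (a * (v * b)) ≤ (4 * κ)⁻¹ * (a ^ 2 * v ^ 2) + κ * N * b ^ 2 := by
        have h2 : ∀ q : ℝ, (4 * κ)⁻¹ * (a ^ 2 * v ^ 2) + κ * (q * q) * b ^ 2 - q * (a * (v * b))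
            = (4 * κ)⁻¹ * (a * v - 2 * κ * q * b) ^ 2 := fun q => by
          field_simp
          ring
        have h2 := h2 (√N)
        rw [hs] at h2
        have h3 : 0 ≤ (4 * κ)⁻¹ * (a * v - 2 * κ * √N * b) ^ 2 := by positivity
        linarith
      have h5 : 0 ≤ κ / 4 * (v * b ^ 2) := by positivity
      linarith
  have hnn : ∀ p, 0 ≤ absKernel θ ψ p := fun p =>
    mul_nonneg (norm_nonneg _) (mul_nonneg (formFactor_nonneg _) (norm_nonneg _))
  have hsN : 1 ≤ √N := Real.one_le_sqrt.mpr (by simp [hN])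
  have hai : Integrable (absKernel θ ψ) μ := by
    refine hBi.mono' (aestronglyMeasurable_absKernel θ ψ) (Eventually.of_forall fun p => ?_)
    rw [Real.norm_of_nonneg (hnn p)]
    exact (le_mul_of_one_le_left (hnn p) hsN).trans (hpt p)
  refine ⟨hai, ?_⟩
  rw [← integral_const_mul]
  refine (integral_mono (hai.const_mul _) hBi hpt).trans ?_
  have hBint : ∫ p, B p ∂μ = (κ⁻¹ * N) * (‖θ‖ ^ 2 * ∫ y, k1 y)
      + (κ / 4) * (∫ z, formFactor (z.2 0) * ‖ψ z‖ ^ 2)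
      + ((4 * κ)⁻¹ * (‖θ‖ ^ 2 * ∫ y, k2 y) + (κ * N) * ‖ψ‖ ^ 2) := by
    have e3 : ∫ p, formFactor p.2 * ‖ψ (consMap p)‖ ^ 2 ∂μ =
        ∫ z, formFactor (z.2 0) * ‖ψ z‖ ^ 2 :=
      measurePreserving_consMap.integral_comp measurableEmbedding_consMap
        (fun z : Config ℓ (n + 1) => formFactor (z.2 0) * ‖ψ z‖ ^ 2)
    have e4 : ∫ p, ‖ψ (consMap p)‖ ^ 2 ∂μ = ‖ψ‖ ^ 2 := by
      rw [← integral_norm_sq ψ]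
      exact measurePreserving_consMap.integral_comp measurableEmbedding_consMap
        (fun z : Config ℓ (n + 1) => ‖ψ z‖ ^ 2)
    have e1 : ∫ p : Config ℓ n × E3, ‖θ p.1‖ ^ 2 * k1 p.2 ∂μ = ‖θ‖ ^ 2 * ∫ y, k1 y := by
      rw [← integral_norm_sq θ]; exact integral_prod_mul (fun z => ‖θ z‖ ^ 2) k1
    have e2 : ∫ p : Config ℓ n × E3, ‖θ p.1‖ ^ 2 * k2 p.2 ∂μ = ‖θ‖ ^ 2 * ∫ y, k2 y := by
      rw [← integral_norm_sq θ]; exact integral_prod_mul (fun z => ‖θ z‖ ^ 2) k2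
    rw [← e1, ← e2, ← e3, ← e4, ← integral_const_mul, ← integral_const_mul, ← integral_const_mul,
      ← integral_const_mul, ← integral_add (hi1.const_mul _) (hi3.const_mul _),
      ← integral_add (hi2.const_mul _) (hi4.const_mul _)]
    exact integral_add ((hi1.const_mul _).add (hi3.const_mul _))
      ((hi2.const_mul _).add (hi4.const_mul _))
  rw [hBint]
  have h1 : (κ⁻¹ * N) * (‖θ‖ ^ 2 * ∫ y, k1 y) ≤ κ * (N * ‖θ‖ ^ 2) := by
    have h2 : (κ⁻¹ * N) * (‖θ‖ ^ 2 * ∫ y, k1 y) ≤ (κ⁻¹ * N) * (‖θ‖ ^ 2 * κ ^ 2) := by gcongr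
    refine h2.trans (le_of_eq ?_)
    field_simp
  have h2 := integral_formFactor_mul_norm_sq_le hψ
  have h3 : (κ / 4) * (∫ z, formFactor (z.2 0) * ‖ψ z‖ ^ 2) ≤ κ * kineticEnergy ψ := by
    nlinarith
  nlinarith

theorem integrable_kernel (θ : L2 ℓ n) {ψ : L2 ℓ (n + 1)} (hψ : ψ ∈ momentumDomain ℓ (n + 1)) :
    Integrable (kernel θ ψ) ((volume : Measure (Config ℓ n)).prod (volume : Measure E3)) := by
  obtain ⟨C, -, h⟩ := exists_interaction_bound (ℓ := ℓ) one_pos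
  rw [← integrable_norm_iff (aestronglyMeasurable_kernel θ ψ)]
  simpa only [norm_kernel] using (h n θ ψ hψ).1

theorem norm_pairing_le (θ : L2 ℓ n) (ψ : L2 ℓ (n + 1)) :
    ‖pairing θ ψ‖ ≤
      ∫ p, absKernel θ ψ p ∂((volume : Measure (Config ℓ n)).prod (volume : Measure E3)) := by
  simpa only [norm_kernel, pairing] using norm_integral_le_integral_norm (kernel θ ψ)

/-- Fubini's theorem; the joint integrability it needs comes from Hardy's inequality through the
momentum domain. From here on the interaction is handled by `pairing` alone. -/
theorem integral_conj_mul_annihilate (θ : L2 ℓ n) {ψ : L2 ℓ (n + 1)}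
    (hψ : ψ ∈ momentumDomain ℓ (n + 1)) :
    ∫ z, conj (θ z) * annihilate ψ z = √(n + 1) * pairing θ ψ := by
  rw [pairing, integral_prod _ (integrable_kernel θ hψ), ← integral_const_mul]
  refine integral_congr_ae (Eventually.of_forall fun z => ?_)
  simp only [kernel, annihilate, integral_const_mul]
  rw [mul_left_comm]
  rfl

theorem integral_conj_annihilate_mul (θ : L2 ℓ n) {ψ : L2 ℓ (n + 1)}
    (hψ : ψ ∈ momentumDomain ℓ (n + 1)) :
    ∫ z, conj (annihilate ψ z) * θ z = √(n + 1) * conj (pairing θ ψ) := by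
  have h := congrArg conj (integral_conj_mul_annihilate θ hψ)
  rw [← integral_conj, map_mul, Complex.conj_ofReal] at h
  rw [← h]
  refine integral_congr_ae (Eventually.of_forall fun z => ?_)
  simp [mul_comm]

theorem ae_fst {P : Config ℓ n → Prop} (h : ∀ᵐ z, P z) :
    ∀ᵐ p : Config ℓ n × E3 ∂((volume : Measure (Config ℓ n)).prod (volume : Measure E3)), P p.1 :=
  Measure.quasiMeasurePreserving_fst.ae h

theorem ae_consMap {P : Config ℓ (n + 1) → Prop} (h : ∀ᵐ z, P z) :
    ∀ᵐ p ∂((volume : Measure (Config ℓ n)).prod (volume : Measure E3)), P (consMap p) :=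
  measurePreserving_consMap.quasiMeasurePreserving.ae h

theorem pairing_add_left (θ θ' : L2 ℓ n) {ψ : L2 ℓ (n + 1)} (hψ : ψ ∈ momentumDomain ℓ (n + 1)) :
    pairing (θ + θ') ψ = pairing θ ψ + pairing θ' ψ := by
  rw [pairing, pairing, pairing,
    ← integral_add (integrable_kernel θ hψ) (integrable_kernel θ' hψ)]
  refine integral_congr_ae ?_
  filter_upwards [ae_fst (Lp.coeFn_add θ θ')] with p hp
  simp only [kernel, hp, Pi.add_apply, map_add]
  ring

theorem pairing_smul_left (c : ℂ) (θ : L2 ℓ n) (ψ : L2 ℓ (n + 1)) :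
    pairing (c • θ) ψ = conj c * pairing θ ψ := by
  rw [pairing, pairing, ← integral_const_mul]
  refine integral_congr_ae ?_
  filter_upwards [ae_fst (Lp.coeFn_smul c θ)] with p hp
  simp only [kernel, hp, Pi.smul_apply, smul_eq_mul, map_mul]
  ring

theorem pairing_add_right (θ : L2 ℓ n) {ψ ψ' : L2 ℓ (n + 1)} (hψ : ψ ∈ momentumDomain ℓ (n + 1))
    (hψ' : ψ' ∈ momentumDomain ℓ (n + 1)) :
    pairing θ (ψ + ψ') = pairing θ ψ + pairing θ ψ' := by
  rw [pairing, pairing, pairing,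
    ← integral_add (integrable_kernel θ hψ) (integrable_kernel θ hψ')]
  refine integral_congr_ae ?_
  filter_upwards [ae_consMap (Lp.coeFn_add ψ ψ')] with p hp
  simp only [kernel, hp, Pi.add_apply]
  ring

theorem pairing_smul_right (c : ℂ) (θ : L2 ℓ n) (ψ : L2 ℓ (n + 1)) :
    pairing θ (c • ψ) = c * pairing θ ψ := by
  rw [pairing, pairing, ← integral_const_mul]
  refine integral_congr_ae ?_
  filter_upwards [ae_consMap (Lp.coeFn_smul c ψ)] with p hp
  simp only [kernel, hp, Pi.smul_apply, smul_eq_mul]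
  ring

theorem pairing_zero_left (ψ : L2 ℓ (n + 1)) : pairing (0 : L2 ℓ n) ψ = 0 := by
  simpa using pairing_smul_left 0 (0 : L2 ℓ n) ψ

theorem pairing_zero_right (θ : L2 ℓ n) : pairing θ (0 : L2 ℓ (n + 1)) = 0 := by
  simpa using pairing_smul_right 0 θ (0 : L2 ℓ (n + 1))

end Interaction

/-! ### Hermitian forms and the bottom of the spectrum -/

section HermitianForms

variable {H : Type*} [NormedAddCommGroup H] [InnerProductSpace ℂ H]

/-- `q` is a hermitian sesquilinear form on `D`. -/
structure IsHermitianFormOn (D : Submodule ℂ H) (q : H → H → ℂ) : Prop where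
  add_right : ∀ {Θ Ψ Ψ' : H}, Θ ∈ D → Ψ ∈ D → Ψ' ∈ D → q Θ (Ψ + Ψ') = q Θ Ψ + q Θ Ψ'
  smul_right : ∀ {Θ Ψ : H} (c : ℂ), Θ ∈ D → Ψ ∈ D → q Θ (c • Ψ) = c * q Θ Ψ
  conj_symm : ∀ {Θ Ψ : H}, Θ ∈ D → Ψ ∈ D → conj (q Ψ Θ) = q Θ Ψ

namespace IsHermitianFormOn

variable {D : Submodule ℂ H} {q : H → H → ℂ}

theorem add_left (h : IsHermitianFormOn D q) {Θ Θ' Ψ : H} (hΘ : Θ ∈ D) (hΘ' : Θ' ∈ D)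
    (hΨ : Ψ ∈ D) : q (Θ + Θ') Ψ = q Θ Ψ + q Θ' Ψ := by
  rw [← h.conj_symm (D.add_mem hΘ hΘ') hΨ, h.add_right hΨ hΘ hΘ', map_add, h.conj_symm hΘ hΨ,
    h.conj_symm hΘ' hΨ]

theorem smul_left (h : IsHermitianFormOn D q) (c : ℂ) {Θ Ψ : H} (hΘ : Θ ∈ D) (hΨ : Ψ ∈ D) :
    q (c • Θ) Ψ = conj c * q Θ Ψ := by
  rw [← h.conj_symm (D.smul_mem c hΘ) hΨ, h.smul_right c hΨ hΘ, map_mul, h.conj_symm hΘ hΨ]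

theorem sub_inner (h : IsHermitianFormOn D q) (E : ℝ) :
    IsHermitianFormOn D (fun Θ Ψ => q Θ Ψ - E * inner ℂ Θ Ψ) where
  add_right hΘ hΨ hΨ' := by rw [h.add_right hΘ hΨ hΨ', inner_add_right]; ring
  smul_right c hΘ hΨ := by rw [h.smul_right c hΘ hΨ, inner_smul_right]; ring
  conj_symm hΘ hΨ := by
    rw [map_sub, map_mul, Complex.conj_ofReal, inner_conj_symm, h.conj_symm hΘ hΨ]

/-- Cauchy–Schwarz for a form that is only semidefinite. -/
theorem norm_sq_le (h : IsHermitianFormOn D q) (hpos : ∀ Ψ ∈ D, 0 ≤ (q Ψ Ψ).re) {Θ Ψ : H}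
    (hΘ : Θ ∈ D) (hΨ : Ψ ∈ D) : ‖q Θ Ψ‖ ^ 2 ≤ (q Θ Θ).re * (q Ψ Ψ).re := by
  set c := q Θ Ψ with hc
  -- The form is evaluated at `t c Θ + Ψ`; the factor `c` absorbs the phase, so that a quadratic
  -- polynomial in real `t` results. Its discriminant contains a superfluous `‖c‖²`, divided out at
  -- the end.
  have key : ∀ t : ℝ, 0 ≤ (‖c‖ ^ 2 * (q Θ Θ).re) * (t * t) + (2 * ‖c‖ ^ 2) * t + (q Ψ Ψ).re := by
    intro t
    have hl : ((t : ℂ) * c) • Θ ∈ D := D.smul_mem _ hΘ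
    have h1 := hpos _ (D.add_mem hl hΨ)
    have hΨΘ : q Ψ Θ = conj c := (h.conj_symm hΨ hΘ).symm
    rw [h.add_right (D.add_mem hl hΨ) hl hΨ, h.add_left hl hΨ hl, h.add_left hl hΨ hΨ,
      h.smul_right _ hl hΘ, h.smul_left _ hΘ hΘ, h.smul_right _ hΨ hΘ, h.smul_left _ hΘ hΨ,
      hΨΘ, ← hc] at h1
    refine h1.trans (le_of_eq ?_)
    have h2 : ‖c‖ ^ 2 = c.re * c.re + c.im * c.im := by
      rw [← Complex.normSq_eq_norm_sq, Complex.normSq_apply]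
    have h3 : (q Θ Θ).im = 0 := by
      have := congrArg Complex.im (h.conj_symm hΘ hΘ)
      rw [Complex.conj_im] at this
      linarith
    rw [h2]
    simp [h3]
    ring
  have hdisc := discrim_le_zero key
  rw [discrim] at hdisc
  rcases (sq_nonneg ‖c‖).eq_or_lt with h0 | h0
  · rw [← h0]
    exact mul_nonneg (hpos _ hΘ) (hpos _ hΨ)
  · have h4 : ‖c‖ ^ 2 * (‖c‖ ^ 2) ≤ ‖c‖ ^ 2 * ((q Θ Θ).re * (q Ψ Ψ).re) := by nlinarith
    exact le_of_mul_le_mul_left h4 h0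

/-- For the form shifted by the ground state energy, this says that a minimizer solves the weak
eigenvalue equation. -/
theorem eq_zero_of_re_nonpos (h : IsHermitianFormOn D q) (hpos : ∀ Ψ ∈ D, 0 ≤ (q Ψ Ψ).re)
    {Θ Ψ : H} (hΘ : Θ ∈ D) (hΨ : Ψ ∈ D) (h0 : (q Ψ Ψ).re ≤ 0) : q Θ Ψ = 0 := by
  have h1 := h.norm_sq_le hpos hΘ hΨ
  have h2 : ‖q Θ Ψ‖ ^ 2 ≤ 0 :=
    h1.trans (mul_nonpos_of_nonneg_of_nonpos (hpos _ hΘ) h0)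
  simpa using le_antisymm h2 (sq_nonneg _)

/-- A semibounded form is bounded below by the infimum of the spectrum of its operator. -/
theorem mul_norm_sq_le_of_isGLB (h : IsHermitianFormOn D q) {C : ℝ}
    (hC : ∀ Ψ ∈ D, -C * ‖Ψ‖ ^ 2 ≤ (q Ψ Ψ).re) {E : ℝ}
    (hE : E ∈ lowerBounds {t : ℝ | (t : ℂ) ∈ opSpectrum (formOperator (D : Set H) q)})
    {Ψ : H} (hΨ : Ψ ∈ D) : E * ‖Ψ‖ ^ 2 ≤ (q Ψ Ψ).re := by
  rcases eq_or_ne Ψ 0 with rfl | hΨ0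
  · have := hC 0 hΨ
    simpa using this
  by_contra hlt
  rw [not_le] at hlt
  have hsq : ∀ {Φ : H}, Φ ≠ 0 → 0 < ‖Φ‖ ^ 2 := fun hΦ => by
    have := norm_pos_iff.mpr hΦ
    positivity
  set S : Set ℝ := {t | ∃ Φ ∈ D, Φ ≠ 0 ∧ t = (q Φ Φ).re / ‖Φ‖ ^ 2} with hS
  have hbdd : BddBelow S := by
    refine ⟨-C, ?_⟩
    rintro t ⟨Φ, hΦ, hΦ0, rfl⟩
    rw [le_div_iff₀ (hsq hΦ0)]
    exact hC Φ hΦ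
  have hne : S.Nonempty := ⟨_, Ψ, hΨ, hΨ0, rfl⟩
  -- The bottom of the Rayleigh quotients. If some quotient lies below `E`, so does `m`, and `m`
  -- then belongs to the resolvent set; the bounded inverse will yield a gap above `m`,
  -- contradicting its definition.
  set m := sInf S with hm
  have hmE : m < E := by
    refine (csInf_le hbdd ⟨Ψ, hΨ, hΨ0, rfl⟩).trans_lt ?_
    rwa [div_lt_iff₀ (hsq hΨ0)]
  have hmD : ∀ Φ ∈ D, m * ‖Φ‖ ^ 2 ≤ (q Φ Φ).re := by
    intro Φ hΦ
    rcases eq_or_ne Φ 0 with rfl | hΦ0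
    · have := hC 0 hΦ
      simpa using this
    · rw [← le_div_iff₀ (hsq hΦ0)]
      exact csInf_le hbdd ⟨Φ, hΦ, hΦ0, rfl⟩
  have hres : (m : ℂ) ∈ opResolventSet (formOperator (D : Set H) q) := by
    by_contra hnot
    exact absurd (hE hnot) (not_le.mpr hmE)
  obtain ⟨R, hR⟩ := hres
  have hp := h.sub_inner m
  have hself : ∀ Φ : H, (inner ℂ Φ Φ : ℂ) = ((‖Φ‖ ^ 2 : ℝ) : ℂ) := fun Φ => by
    rw [inner_self_eq_norm_sq_to_K]; norm_cast
  have hppos : ∀ Φ ∈ D, 0 ≤ (q Φ Φ - m * inner ℂ Φ Φ).re := by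
    intro Φ hΦ
    rw [hself, Complex.sub_re, ← Complex.ofReal_mul, Complex.ofReal_re]
    linarith [hmD Φ hΦ]
  have hkey : ∀ Φ ∈ D, ‖Φ‖ ^ 2 ≤ (‖R‖ + 1) * ((q Φ Φ).re - m * ‖Φ‖ ^ 2) := by
    intro Φ hΦ
    obtain ⟨hRD, hRq⟩ := (hR Φ (R Φ)).mpr rfl
    have e1 : ∀ Θ ∈ D, q Θ (R Φ) - m * inner ℂ Θ (R Φ) = inner ℂ Θ Φ := by
      intro Θ hΘ
      have := hRq Θ hΘ
      simp only at this
      rw [this, inner_add_right, inner_smul_right]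
      ring
    -- Cauchy–Schwarz for the form shifted by `m`, between `Φ` and `R Φ`. The weak equation for `R
    -- Φ` turns the mixed term into `‖Φ‖²` and the diagonal term at `R Φ` into `⟨R Φ, Φ⟩`, which is
    -- at most `‖R‖ ‖Φ‖²`.
    have h1 := hp.norm_sq_le hppos hΦ hRD
    simp only at h1
    rw [e1 Φ hΦ, e1 (R Φ) hRD, hself, Complex.norm_real, Complex.sub_re, ← Complex.ofReal_mul,
      Complex.ofReal_re, Real.norm_of_nonneg (by positivity)] at h1
    have h2 : (inner ℂ (R Φ) Φ).re ≤ ‖R‖ * ‖Φ‖ ^ 2 := by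
      refine (re_inner_le_norm (𝕜 := ℂ) (R Φ) Φ).trans ?_
      nlinarith [R.le_opNorm Φ, norm_nonneg Φ]
    have h3 : 0 ≤ (q Φ Φ).re - m * ‖Φ‖ ^ 2 := by linarith [hmD Φ hΦ]
    rcases eq_or_ne Φ 0 with rfl | hΦ0
    · have := norm_nonneg R
      rw [norm_zero] at h3 ⊢
      have := mul_nonneg (by positivity : (0 : ℝ) ≤ ‖R‖ + 1) h3
      simpa using this
    · have h4 : ‖Φ‖ ^ 2 * ‖Φ‖ ^ 2 ≤ ‖Φ‖ ^ 2 * ((‖R‖ + 1) * ((q Φ Φ).re - m * ‖Φ‖ ^ 2)) := by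
        have h5 := mul_le_mul_of_nonneg_left h2 h3
        have h6 := mul_nonneg h3 (sq_nonneg ‖Φ‖)
        nlinarith
      exact le_of_mul_le_mul_left h4 (hsq hΦ0)
  have hR1 : 0 < ‖R‖ + 1 := by positivity
  -- The coercivity raises every Rayleigh quotient by `(‖R‖ + 1)⁻¹`; the added one keeps this finite
  -- and positive even for `R = 0`.
  have hle : m + (‖R‖ + 1)⁻¹ ≤ m := by
    refine le_csInf hne ?_
    rintro t ⟨Φ, hΦ, hΦ0, rfl⟩
    rw [le_div_iff₀ (hsq hΦ0), add_mul]
    have := hkey Φ hΦ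
    rw [← div_le_iff₀' hR1] at this
    rw [← div_eq_inv_mul]
    linarith
  have : 0 < (‖R‖ + 1)⁻¹ := inv_pos.mpr hR1
  linarith

end IsHermitianFormOn

end HermitianForms

/-! ### The quadratic form on the form domain -/

section EnergyForm

variable {ℓ : ℝ} [Fact (0 < ℓ)] {n : ℕ}

theorem comp_add (Θ Ψ : Space ℓ) (n : ℕ) : comp (Θ + Ψ) n = comp Θ n + comp Ψ n := rfl

theorem comp_smul (c : ℂ) (Ψ : Space ℓ) (n : ℕ) : comp (c • Ψ) n = c • comp Ψ n := rfl

theorem comp_zero (n : ℕ) : comp (0 : Space ℓ) n = 0 := rfl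

theorem space_ext {Θ Ψ : Space ℓ} (h : ∀ n, comp Θ n = comp Ψ n) : Θ = Ψ :=
  lp.ext (funext fun n => Subtype.ext (h n))

theorem summable_norm_sq_comp (Ψ : Space ℓ) : Summable (fun n => ‖comp Ψ n‖ ^ 2) := by
  have h := (lp.memℓp Ψ).summable (by simp)
  simpa [comp] using h

theorem hasSum_inner_comp (Θ Ψ : Space ℓ) :
    HasSum (fun n => inner ℂ (comp Θ n) (comp Ψ n)) (inner ℂ Θ Ψ) :=
  lp.hasSum_inner Θ Ψ

theorem hasSum_norm_sq_comp (Ψ : Space ℓ) : HasSum (fun n => ‖comp Ψ n‖ ^ 2) (‖Ψ‖ ^ 2) := by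
  have h := lp.hasSum_norm (p := 2) (by simp) Ψ
  simpa [comp] using h

theorem kineticEnergy_add_le {f g : L2 ℓ n} (hf : f ∈ momentumDomain ℓ n)
    (hg : g ∈ momentumDomain ℓ n) :
    kineticEnergy (f + g) ≤ 2 * kineticEnergy f + 2 * kineticEnergy g := by
  rw [kineticEnergy, kineticEnergy, kineticEnergy, Finset.mul_sum, Finset.mul_sum,
    ← Finset.sum_add_distrib]
  refine Finset.sum_le_sum fun j _ => ?_
  rw [weakRelDeriv_add hf hg]
  have h1 := norm_add_le (weakRelDeriv j f) (weakRelDeriv j g)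
  have h2 : ‖weakRelDeriv j f + weakRelDeriv j g‖ ^ 2 ≤
      (‖weakRelDeriv j f‖ + ‖weakRelDeriv j g‖) ^ 2 := by gcongr
  nlinarith [sq_nonneg (‖weakRelDeriv j f‖ - ‖weakRelDeriv j g‖)]

theorem kineticEnergy_smul {f : L2 ℓ n} (hf : f ∈ momentumDomain ℓ n) (c : ℂ) :
    kineticEnergy (c • f) = ‖c‖ ^ 2 * kineticEnergy f := by
  rw [kineticEnergy, kineticEnergy, Finset.mul_sum]
  refine Finset.sum_congr rfl fun j _ => ?_
  rw [weakRelDeriv_smul hf, norm_smul, mul_pow]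

theorem kineticEnergy_zero : kineticEnergy (0 : L2 ℓ n) = 0 := by
  simp [kineticEnergy, weakRelDeriv_zero]

theorem norm_kinetic_le (f g : L2 ℓ n) : ‖kinetic f g‖ ≤ kineticEnergy f + kineticEnergy g := by
  rw [kinetic, kineticEnergy, kineticEnergy, ← Finset.sum_add_distrib]
  refine (norm_sum_le _ _).trans (Finset.sum_le_sum fun j _ => ?_)
  refine (norm_inner_le_norm _ _).trans ?_
  nlinarith [sq_nonneg (‖weakRelDeriv j f‖ - ‖weakRelDeriv j g‖),
    sq_nonneg ‖weakRelDeriv j f‖, sq_nonneg ‖weakRelDeriv j g‖]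

theorem kinetic_add_right (f : L2 ℓ n) {g g' : L2 ℓ n} (hg : g ∈ momentumDomain ℓ n)
    (hg' : g' ∈ momentumDomain ℓ n) : kinetic f (g + g') = kinetic f g + kinetic f g' := by
  simp only [kinetic, weakRelDeriv_add hg hg', inner_add_right, Finset.sum_add_distrib]

theorem kinetic_smul_right (c : ℂ) (f : L2 ℓ n) {g : L2 ℓ n} (hg : g ∈ momentumDomain ℓ n) :
    kinetic f (c • g) = c * kinetic f g := by
  simp only [kinetic, weakRelDeriv_smul hg, inner_smul_right, Finset.mul_sum]

theorem kinetic_conj_symm (f g : L2 ℓ n) : conj (kinetic g f) = kinetic f g := by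
  simp only [kinetic, map_sum, inner_conj_symm]

theorem kinetic_zero_left (f : L2 ℓ n) : kinetic 0 f = 0 := by
  simp [kinetic, weakRelDeriv_zero]

theorem mem_formDomain_iff {Ψ : Space ℓ} : Ψ ∈ formDomain ℓ ↔
    (∀ n, comp Ψ n ∈ momentumDomain ℓ n) ∧
      Summable (fun n : ℕ => kineticEnergy (comp Ψ n) + n * ‖comp Ψ n‖ ^ 2) := by
  simp only [formDomain, norm_relMomentum]
  rfl

variable (ℓ) in
/-- The form domain as a subspace. -/
def formSubmodule : Submodule ℂ (Space ℓ) where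
  carrier := formDomain ℓ
  zero_mem' := by
    rw [mem_formDomain_iff]
    refine ⟨fun n => (momentumDomain ℓ n).zero_mem, ?_⟩
    simp only [comp_zero, kineticEnergy_zero]
    simp
  add_mem' := by
    intro Ψ Φ hΨ hΦ
    rw [mem_formDomain_iff] at hΨ hΦ ⊢
    refine ⟨fun n => (momentumDomain ℓ n).add_mem (hΨ.1 n) (hΦ.1 n), ?_⟩
    refine Summable.of_nonneg_of_le
      (fun n => add_nonneg (kineticEnergy_nonneg _) (by positivity)) (fun n => ?_)
      ((hΨ.2.mul_left 2).add (hΦ.2.mul_left 2))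
    rw [comp_add]
    have h1 := kineticEnergy_add_le (hΨ.1 n) (hΦ.1 n)
    have h2 : ‖comp Ψ n + comp Φ n‖ ^ 2 ≤ 2 * ‖comp Ψ n‖ ^ 2 + 2 * ‖comp Φ n‖ ^ 2 := by
      have h3 : ‖comp Ψ n + comp Φ n‖ ^ 2 ≤ (‖comp Ψ n‖ + ‖comp Φ n‖) ^ 2 := by
        gcongr; exact norm_add_le _ _
      nlinarith [sq_nonneg (‖comp Ψ n‖ - ‖comp Φ n‖)]
    have h3 := mul_le_mul_of_nonneg_left h2 (Nat.cast_nonneg n : (0 : ℝ) ≤ n)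
    nlinarith
  smul_mem' := by
    intro c Ψ hΨ
    rw [mem_formDomain_iff] at hΨ ⊢
    refine ⟨fun n => (momentumDomain ℓ n).smul_mem c (hΨ.1 n), ?_⟩
    refine (hΨ.2.mul_left (‖c‖ ^ 2)).congr fun n => ?_
    rw [comp_smul, kineticEnergy_smul (hΨ.1 n), norm_smul]
    ring

theorem mem_formSubmodule {Ψ : Space ℓ} : Ψ ∈ formSubmodule ℓ ↔
    (∀ n, comp Ψ n ∈ momentumDomain ℓ n) ∧
      Summable (fun n : ℕ => kineticEnergy (comp Ψ n) + n * ‖comp Ψ n‖ ^ 2) :=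
  mem_formDomain_iff

/-- The contribution of the `n`-phonon sector to the non-interacting form. -/
def freeTerm (Θ Ψ : Space ℓ) (n : ℕ) : ℂ :=
  kinetic (comp Θ n) (comp Ψ n) + n * inner ℂ (comp Θ n) (comp Ψ n)

/-- The coupling of the `n`- and the `(n+1)`-phonon sectors. -/
def interactionTerm (Θ Ψ : Space ℓ) (n : ℕ) : ℂ :=
  √(n + 1) * pairing (comp Θ n) (comp Ψ (n + 1))
    + √(n + 1) * conj (pairing (comp Ψ n) (comp Θ (n + 1)))

theorem freeForm_eq (Θ Ψ : Space ℓ) : freeForm ℓ Θ Ψ = ∑' n, freeTerm Θ Ψ n := by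
  simp only [freeForm, inner_relMomentum]
  rfl

theorem interactionForm_eq {Θ Ψ : Space ℓ} (hΘ : Θ ∈ formSubmodule ℓ) (hΨ : Ψ ∈ formSubmodule ℓ) :
    interactionForm ℓ Θ Ψ = ∑' n, interactionTerm Θ Ψ n := by
  rw [mem_formSubmodule] at hΘ hΨ
  refine tsum_congr fun n => ?_
  rw [integral_conj_mul_annihilate _ (hΨ.1 (n + 1)),
    integral_conj_annihilate_mul _ (hΘ.1 (n + 1))]
  rfl

theorem summable_freeTerm {Θ Ψ : Space ℓ} (hΘ : Θ ∈ formSubmodule ℓ) (hΨ : Ψ ∈ formSubmodule ℓ) :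
    Summable (freeTerm Θ Ψ) := by
  rw [mem_formSubmodule] at hΘ hΨ
  refine Summable.of_norm_bounded (hΘ.2.add hΨ.2) fun n => ?_
  have h1 := norm_kinetic_le (comp Θ n) (comp Ψ n)
  have h2 : ‖inner ℂ (comp Θ n) (comp Ψ n)‖ ≤ ‖comp Θ n‖ ^ 2 + ‖comp Ψ n‖ ^ 2 := by
    refine (norm_inner_le_norm _ _).trans ?_
    nlinarith [sq_nonneg (‖comp Θ n‖ - ‖comp Ψ n‖), sq_nonneg ‖comp Θ n‖, sq_nonneg ‖comp Ψ n‖]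
  have h3 := mul_le_mul_of_nonneg_left h2 (Nat.cast_nonneg n : (0 : ℝ) ≤ n)
  refine (norm_add_le _ _).trans ?_
  rw [norm_mul, Complex.norm_natCast]
  nlinarith

/-- The form bound with `κ = 1` majorizes the terms by the energy densities of `Θ` in sector `n` and
of `Ψ` in sector `n + 1`, plus a multiple of the mass of `Θ`. -/
theorem summable_sqrt_mul_pairing {Θ Ψ : Space ℓ} (hΘ : Θ ∈ formSubmodule ℓ)
    (hΨ : Ψ ∈ formSubmodule ℓ) :
    Summable (fun n : ℕ => (√(n + 1) : ℂ) * pairing (comp Θ n) (comp Ψ (n + 1))) := by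
  rw [mem_formSubmodule] at hΘ hΨ
  obtain ⟨C, hC0, hC⟩ := exists_interaction_bound (ℓ := ℓ) one_pos
  have hs1 := (summable_nat_add_iff 1).mpr hΨ.2
  refine Summable.of_norm_bounded
    ((hΘ.2.add hs1).add ((summable_norm_sq_comp Θ).mul_left (1 + C))) fun n => ?_
  have h1 := (hC n (comp Θ n) (comp Ψ (n + 1)) (hΨ.1 (n + 1))).2
  rw [norm_mul, Complex.norm_real, Real.norm_of_nonneg (Real.sqrt_nonneg _)]
  have h2 := mul_le_mul_of_nonneg_left (norm_pairing_le (comp Θ n) (comp Ψ (n + 1)))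
    (Real.sqrt_nonneg ((n : ℝ) + 1))
  have h3 := kineticEnergy_nonneg (comp Θ n)
  push_cast
  nlinarith

theorem summable_interactionTerm {Θ Ψ : Space ℓ} (hΘ : Θ ∈ formSubmodule ℓ)
    (hΨ : Ψ ∈ formSubmodule ℓ) : Summable (interactionTerm Θ Ψ) := by
  refine (summable_sqrt_mul_pairing hΘ hΨ).add ?_
  refine (Complex.summable_conj.mpr (summable_sqrt_mul_pairing hΨ hΘ)).congr fun n => ?_
  rw [map_mul, Complex.conj_ofReal]

variable (ℓ) in
/-- The form of `(-i∇_x - P_f)² + N + g φ(v)`. -/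
def energyForm (g : ℝ) (Θ Ψ : Space ℓ) : ℂ := freeForm ℓ Θ Ψ + g * interactionForm ℓ Θ Ψ

theorem hasSum_energyForm (g : ℝ) {Θ Ψ : Space ℓ} (hΘ : Θ ∈ formSubmodule ℓ)
    (hΨ : Ψ ∈ formSubmodule ℓ) :
    HasSum (fun n => freeTerm Θ Ψ n + g * interactionTerm Θ Ψ n) (energyForm ℓ g Θ Ψ) := by
  rw [energyForm, freeForm_eq, interactionForm_eq hΘ hΨ]
  exact (summable_freeTerm hΘ hΨ).hasSum.add ((summable_interactionTerm hΘ hΨ).hasSum.mul_left _)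

theorem isHermitianFormOn_energyForm (g : ℝ) :
    IsHermitianFormOn (formSubmodule ℓ) (energyForm ℓ g) where
  add_right := by
    intro Θ Ψ Ψ' hΘ hΨ hΨ'
    refine (hasSum_energyForm g hΘ ((formSubmodule ℓ).add_mem hΨ hΨ')).unique ?_
    refine ((hasSum_energyForm g hΘ hΨ).add (hasSum_energyForm g hΘ hΨ')).congr_fun fun n => ?_
    have h1 := (mem_formSubmodule.mp hΨ).1
    have h2 := (mem_formSubmodule.mp hΨ').1
    have h3 := (mem_formSubmodule.mp hΘ).1
    simp only [freeTerm, interactionTerm, comp_add, kinetic_add_right _ (h1 n) (h2 n),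
      inner_add_right, pairing_add_right _ (h1 (n + 1)) (h2 (n + 1)),
      pairing_add_left _ _ (h3 (n + 1)), map_add]
    ring
  smul_right := by
    intro Θ Ψ c hΘ hΨ
    refine (hasSum_energyForm g hΘ ((formSubmodule ℓ).smul_mem c hΨ)).unique ?_
    refine ((hasSum_energyForm g hΘ hΨ).mul_left c).congr_fun fun n => ?_
    have h1 := (mem_formSubmodule.mp hΨ).1
    simp only [freeTerm, interactionTerm, comp_smul, kinetic_smul_right c _ (h1 n),
      inner_smul_right, pairing_smul_right, pairing_smul_left, map_mul, Complex.conj_conj]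
    ring
  conj_symm := by
    intro Θ Ψ hΘ hΨ
    refine HasSum.unique ?_ (hasSum_energyForm g hΘ hΨ)
    refine (Complex.hasSum_conj'.mpr (hasSum_energyForm g hΨ hΘ)).congr_fun fun n => ?_
    simp only [freeTerm, interactionTerm, map_add, map_mul, Complex.conj_ofReal,
      Complex.conj_conj, kinetic_conj_symm, inner_conj_symm, map_natCast]
    ring

/-- The form is bounded below. -/
theorem exists_energyForm_lower_bound (g : ℝ) :
    ∃ C : ℝ, ∀ Ψ ∈ formSubmodule ℓ, -C * ‖Ψ‖ ^ 2 ≤ (energyForm ℓ g Ψ Ψ).re := by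
  -- This `κ` satisfies `2 |g| κ ≤ 1/2`, where the 2 counts the creation and the annihilation term.
  obtain ⟨C, hC0, hC⟩ := exists_interaction_bound (ℓ := ℓ) (κ := (4 * (|g| + 1))⁻¹) (by positivity)
  refine ⟨1 / 2 + 2 * |g| * C, fun Ψ hΨ => ?_⟩
  obtain ⟨hdom, hsum⟩ := mem_formSubmodule.mp hΨ
  set b : ℕ → ℝ := fun n => kineticEnergy (comp Ψ n) + n * ‖comp Ψ n‖ ^ 2 with hb
  have hb0 : ∀ n, 0 ≤ b n := fun n => add_nonneg (kineticEnergy_nonneg _) (by positivity)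
  have hs1 : Summable fun n => b (n + 1) := (summable_nat_add_iff 1).mpr hsum
  have hre := Complex.hasSum_re (hasSum_energyForm g hΨ hΨ)
  -- The coupling of sectors `n` and `n + 1` is charged half to `b n` and half to `b (n + 1)`. In
  -- the sum each sector is charged at most its full free energy, so only the mass term survives.
  have hlow : HasSum (fun n => b n - (2⁻¹ * b n + 2⁻¹ * b (n + 1)
      + (1 / 2 + 2 * |g| * C) * ‖comp Ψ n‖ ^ 2))
      (∑' n, b n - (2⁻¹ * ∑' n, b n + 2⁻¹ * ∑' n, b (n + 1) + (1 / 2 + 2 * |g| * C) * ‖Ψ‖ ^ 2)) :=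
    hsum.hasSum.sub (((hsum.hasSum.mul_left _).add (hs1.hasSum.mul_left _)).add
      ((hasSum_norm_sq_comp Ψ).mul_left _))
  have hle := hasSum_le (fun n => ?_) hlow hre
  · have h0 : ∑' n, b n = b 0 + ∑' n, b (n + 1) := hsum.tsum_eq_zero_add
    have := hb0 0
    linarith
  · have h1 := (hC n (comp Ψ n) (comp Ψ (n + 1)) (hdom (n + 1))).2
    have h2 := norm_pairing_le (comp Ψ n) (comp Ψ (n + 1))
    set s : ℝ := √((n : ℝ) + 1) with hs
    have hs0 : 0 ≤ s := Real.sqrt_nonneg _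
    set P := pairing (comp Ψ n) (comp Ψ (n + 1)) with hP
    have hintegrable : (interactionTerm Ψ Ψ n).re = 2 * (s * P.re) := by
      simp only [interactionTerm, ← hP, ← hs]
      rw [Complex.add_re, Complex.re_ofReal_mul, Complex.re_ofReal_mul, Complex.conj_re]
      ring
    have hfree : (freeTerm Ψ Ψ n).re = b n := by
      simp only [freeTerm, kinetic_self, hb]
      rw [inner_self_eq_norm_sq_to_K, Complex.add_re, Complex.ofReal_re]
      congr 1
      norm_cast
      rw [← Complex.ofReal_natCast, Complex.re_ofReal_mul]
      rfl
    rw [Complex.add_re, Complex.re_ofReal_mul, hintegrable, hfree]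
    have h3 : |P.re| ≤ ‖P‖ := Complex.abs_re_le_norm P
    have h4 : |g * (2 * (s * P.re))| ≤ 2 * |g| * (s * ‖P‖) := by
      rw [abs_mul, abs_mul, abs_mul, abs_of_nonneg hs0, abs_two]
      nlinarith [mul_le_mul_of_nonneg_left h3 (mul_nonneg (abs_nonneg g) hs0)]
    have h5 := mul_le_mul_of_nonneg_left h2 hs0
    have h6 := mul_le_mul_of_nonneg_left (h5.trans h1) (by positivity : 0 ≤ 2 * |g|)
    set X := ((n : ℝ) + 1) * ‖comp Ψ n‖ ^ 2 + kineticEnergy (comp Ψ (n + 1))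
      + ((n : ℝ) + 1) * ‖comp Ψ (n + 1)‖ ^ 2 with hX
    have hX0 : 0 ≤ X := add_nonneg (add_nonneg (by positivity) (kineticEnergy_nonneg _))
      (by positivity)
    have h7 : 2 * |g| * (4 * (|g| + 1))⁻¹ ≤ 2⁻¹ := by
      rw [← div_eq_mul_inv, div_le_iff₀ (by positivity)]
      nlinarith [abs_nonneg g]
    have h8 := mul_le_mul_of_nonneg_right h7 hX0
    have h9 := neg_abs_le (g * (2 * (s * P.re)))
    -- The bound weighs the `n`-phonon component by `n + 1` instead of `n`; the surplus mass is the
    -- origin of the constant `1 / 2`.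
    have h10 : X ≤ b n + b (n + 1) + ‖comp Ψ n‖ ^ 2 := by
      simp only [hX, hb]
      push_cast
      nlinarith [kineticEnergy_nonneg (comp Ψ n)]
    nlinarith

end EnergyForm

/-! ### Positivity in `L²` -/

section Positivity

variable {ℓ : ℝ} [Fact (0 < ℓ)] {n : ℕ}

/-- The function `f` takes nonnegative real values. -/
def IsNonneg (f : L2 ℓ n) : Prop := ∀ᵐ z, f z = (‖f z‖ : ℂ)

theorem IsNonneg.flow {f : L2 ℓ n} (hf : IsNonneg f) (j : Fin 3) (s : ℝ) :
    IsNonneg (flow j s f) := by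
  have h1 := (measurePreserving_shift (ℓ := ℓ) (n := n)
    (s • EuclideanSpace.single j (1 : ℝ))).quasiMeasurePreserving.ae hf
  filter_upwards [coeFn_translate (s • EuclideanSpace.single j (1 : ℝ)) f, h1] with z h2 h3
  rw [Polaron.flow, h2]
  exact h3

theorem IsNonneg.inner_eq {f g : L2 ℓ n} (hf : IsNonneg f) (hg : IsNonneg g) :
    inner ℂ f g = ((∫ z, ‖f z‖ * ‖g z‖ : ℝ) : ℂ) := by
  rw [L2.inner_def, ← integral_complex_ofReal]
  refine integral_congr_ae ?_
  filter_upwards [hf, hg] with z h1 h2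
  rw [RCLike.inner_apply, h1, h2]
  simp [mul_comm]

theorem IsNonneg.re_inner_nonneg {f g : L2 ℓ n} (hf : IsNonneg f) (hg : IsNonneg g) :
    0 ≤ (inner ℂ f g).re := by
  rw [hf.inner_eq hg, Complex.ofReal_re]
  exact integral_nonneg fun z => by positivity

theorem inner_eq_zero_of_ae_mul_eq_zero {f g : L2 ℓ n} (h : ∀ᵐ z, f z * g z = 0) :
    inner ℂ f g = 0 := by
  rw [L2.inner_def]
  refine integral_eq_zero_of_ae ?_
  filter_upwards [h] with z hz
  rw [RCLike.inner_apply]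
  rcases mul_eq_zero.mp hz with h | h <;> simp [h]

/-- Nonnegative functions with disjoint supports have nonpositive kinetic overlap. -/
theorem IsNonneg.re_kinetic_nonpos {f g : L2 ℓ n} (hf : IsNonneg f) (hg : IsNonneg g)
    (hfd : f ∈ momentumDomain ℓ n) (hgd : g ∈ momentumDomain ℓ n)
    (h : ∀ᵐ z, f z * g z = 0) : (kinetic f g).re ≤ 0 := by
  rw [kinetic, Complex.re_sum]
  refine Finset.sum_nonpos fun j _ => ?_
  have h1 := (isWeakRelDeriv_weakRelDeriv hfd j).tendsto_slope
  have h2 := (isWeakRelDeriv_weakRelDeriv hgd j).tendsto_slope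
  have h3 := (Complex.continuous_re.tendsto _).comp (h1.inner (𝕜 := ℂ) h2)
  refine le_of_tendsto h3 (Eventually.of_forall fun s => ?_)
  have h4 : inner ℂ (s⁻¹ • (Polaron.flow j s f - f)) (s⁻¹ • (Polaron.flow j s g - g)) =
      ((s⁻¹ * s⁻¹ : ℝ) : ℂ) *
        inner ℂ (Polaron.flow j s f - f) (Polaron.flow j s g - g) := by
    rw [show s⁻¹ • (Polaron.flow j s f - f) = ((s⁻¹ : ℝ) : ℂ) • (Polaron.flow j s f - f) from
      (Complex.coe_smul s⁻¹ _).symm,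
      show s⁻¹ • (Polaron.flow j s g - g) = ((s⁻¹ : ℝ) : ℂ) • (Polaron.flow j s g - g) from
      (Complex.coe_smul s⁻¹ _).symm, inner_smul_left, inner_smul_right, Complex.conj_ofReal]
    push_cast
    ring
  -- Disjoint supports remove `⟨f, g⟩` and its translate. The remaining overlaps of nonnegative
  -- functions enter with a minus sign.
  have h5 : inner ℂ (Polaron.flow j s f - f) (Polaron.flow j s g - g) =
      -(inner ℂ (Polaron.flow j s f) g) - inner ℂ f (Polaron.flow j s g) := by
    rw [inner_sub_left, inner_sub_right, inner_sub_right, LinearIsometry.inner_map_map,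
      inner_eq_zero_of_ae_mul_eq_zero h]
    ring
  simp only [Function.comp_apply]
  rw [h4, Complex.re_ofReal_mul, h5, Complex.sub_re, Complex.neg_re]
  have h6 := (hf.flow j s).re_inner_nonneg hg
  have h7 := hf.re_inner_nonneg (hg.flow j s)
  exact mul_nonpos_of_nonneg_of_nonpos (mul_self_nonneg _) (by linarith)

theorem IsNonneg.pairing_eq {θ : L2 ℓ n} {ψ : L2 ℓ (n + 1)} (hθ : IsNonneg θ) (hψ : IsNonneg ψ) :
    pairing θ ψ = ((∫ p, absKernel θ ψ p
      ∂((volume : Measure (Config ℓ n)).prod (volume : Measure E3)) : ℝ) : ℂ) := by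
  rw [pairing, ← integral_complex_ofReal]
  refine integral_congr_ae ?_
  filter_upwards [ae_fst hθ, ae_consMap hψ] with p h1 h2
  rw [kernel, absKernel, h1, h2]
  simp

theorem absKernel_nonneg (θ : L2 ℓ n) (ψ : L2 ℓ (n + 1)) (p : Config ℓ n × E3) :
    0 ≤ absKernel θ ψ p :=
  mul_nonneg (norm_nonneg _) (mul_nonneg (formFactor_nonneg _) (norm_nonneg _))

theorem IsNonneg.re_pairing_nonneg {θ : L2 ℓ n} {ψ : L2 ℓ (n + 1)} (hθ : IsNonneg θ)
    (hψ : IsNonneg ψ) : 0 ≤ (pairing θ ψ).re := by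
  rw [hθ.pairing_eq hψ, Complex.ofReal_re]
  exact integral_nonneg fun p => absKernel_nonneg θ ψ p

/-! ### Complex conjugation -/

/-- Complex conjugation as a continuous real-linear map. -/
def starL : L2 ℓ n →L[ℝ] L2 ℓ n :=
  (Complex.conjCLE : ℂ →L[ℝ] ℂ).compLpL 2 volume

theorem starL_apply (f : L2 ℓ n) : starL f = star f := by
  apply Lp.ext
  filter_upwards [(Complex.conjCLE : ℂ →L[ℝ] ℂ).coeFn_compLpL f, Lp.coeFn_star f] with z h1 h2
  rw [starL, h1, h2]
  rfl

theorem star_add_L2 (f g : L2 ℓ n) : star (f + g) = star f + star g := by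
  simp only [← starL_apply, map_add]

theorem inner_star_star (f g : L2 ℓ n) : inner ℂ (star f) (star g) = conj (inner ℂ f g) := by
  rw [L2.inner_def, L2.inner_def, ← integral_conj]
  refine integral_congr_ae ?_
  filter_upwards [Lp.coeFn_star f, Lp.coeFn_star g] with z h1 h2
  rw [h1, h2, RCLike.inner_apply, RCLike.inner_apply]
  simp

theorem flow_star (j : Fin 3) (s : ℝ) (f : L2 ℓ n) : flow j s (star f) = star (flow j s f) := by
  apply Lp.ext
  have h1 := (measurePreserving_shift (ℓ := ℓ) (n := n)
    (s • EuclideanSpace.single j (1 : ℝ))).quasiMeasurePreserving.ae_eq (Lp.coeFn_star f)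
  filter_upwards [coeFn_translate (s • EuclideanSpace.single j (1 : ℝ)) (star f), h1,
    Lp.coeFn_star (flow j s f),
    coeFn_translate (s • EuclideanSpace.single j (1 : ℝ)) f] with z h1 h2 h3 h4
  have h4' : flow j s f z = f (shift (s • EuclideanSpace.single j (1 : ℝ)) z) := h4
  rw [h3, Pi.star_apply, h4', flow, h1, h2]
  rfl

theorem IsWeakRelDeriv.star {j : Fin 3} {f g : L2 ℓ n} (h : IsWeakRelDeriv j f g) :
    IsWeakRelDeriv j (star f) (star g) := by
  rw [isWeakRelDeriv_iff_hasDerivAt] at h ⊢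
  simp only [flow_star]
  simp only [← starL_apply]
  exact starL.hasFDerivAt.comp_hasDerivAt (0 : ℝ) h

theorem weakRelDeriv_star {f : L2 ℓ n} (hf : f ∈ momentumDomain ℓ n) (j : Fin 3) :
    weakRelDeriv j (star f) = star (weakRelDeriv j f) :=
  (isWeakRelDeriv_weakRelDeriv hf j).star.weakRelDeriv_eq

theorem kinetic_star_star {f g : L2 ℓ n} (hf : f ∈ momentumDomain ℓ n)
    (hg : g ∈ momentumDomain ℓ n) : kinetic (star f) (star g) = conj (kinetic f g) := by
  simp only [kinetic, weakRelDeriv_star hf, weakRelDeriv_star hg, inner_star_star, map_sum]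

theorem pairing_star_star (θ : L2 ℓ n) (ψ : L2 ℓ (n + 1)) :
    pairing (star θ) (star ψ) = conj (pairing θ ψ) := by
  rw [pairing, pairing, ← integral_conj]
  refine integral_congr_ae ?_
  filter_upwards [ae_fst (Lp.coeFn_star θ), ae_consMap (Lp.coeFn_star ψ)] with p h1 h2
  rw [kernel, kernel, h1, h2]
  simp

end Positivity

/-! ### Operations on states -/

section Operations

variable {ℓ : ℝ} [Fact (0 < ℓ)] {n : ℕ}

theorem compLp_mem_sector {F : ℂ → ℂ} {c : ℝ≥0} (hF : LipschitzWith c F) (hF0 : F 0 = 0)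
    {f : L2 ℓ n} (hf : f ∈ sector ℓ n) : hF.compLp hF0 f ∈ sector ℓ n := by
  intro σ
  apply Lp.ext
  have h0 := (measurePreserving_permute ℓ σ).quasiMeasurePreserving.ae_eq (hF.coeFn_compLp hF0 f)
  have h1 := Lp.coeFn_compMeasurePreserving (hF.compLp hF0 f) (measurePreserving_permute ℓ σ)
  have h2 := Lp.coeFn_compMeasurePreserving f (measurePreserving_permute ℓ σ)
  rw [hf σ] at h2
  filter_upwards [h0, h1, h2, hF.coeFn_compLp hF0 f] with z h0 h1 h2 h3
  rw [h1, h0, h3, Function.comp_apply, Function.comp_apply, Function.comp_apply, h2]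
  rfl

/-- The state with the components `F ∘ Ψ⁽ⁿ⁾`. -/
def compSpace {F : ℂ → ℂ} {c : ℝ≥0} (hF : LipschitzWith c F) (hF0 : F 0 = 0) (Ψ : Space ℓ) :
    Space ℓ :=
  ⟨fun n => ⟨hF.compLp hF0 (comp Ψ n), compLp_mem_sector hF hF0 (Ψ n).2⟩, by
    refine memℓp_gen ?_
    refine Summable.of_nonneg_of_le (fun n => by positivity) (fun n => ?_)
      ((summable_norm_sq_comp Ψ).mul_left ((c : ℝ) ^ 2))
    have h := hF.norm_compLp_le hF0 (comp Ψ n)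
    have h2 : ‖hF.compLp hF0 (comp Ψ n)‖ ^ 2 ≤ (c * ‖comp Ψ n‖) ^ 2 := by gcongr
    simpa [mul_pow] using h2⟩

theorem comp_compSpace {F : ℂ → ℂ} {c : ℝ≥0} (hF : LipschitzWith c F) (hF0 : F 0 = 0)
    (Ψ : Space ℓ) (n : ℕ) : comp (compSpace hF hF0 Ψ) n = hF.compLp hF0 (comp Ψ n) := rfl

theorem compSpace_mem_formSubmodule {F : ℂ → ℂ} {c : ℝ≥0} (hF : LipschitzWith c F)
    (hF0 : F 0 = 0) {Ψ : Space ℓ} (hΨ : Ψ ∈ formSubmodule ℓ) :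
    compSpace hF hF0 Ψ ∈ formSubmodule ℓ := by
  rw [mem_formSubmodule] at hΨ ⊢
  refine ⟨fun n => compLp_mem_momentumDomain hF hF0 (hΨ.1 n), ?_⟩
  refine Summable.of_nonneg_of_le
    (fun n => add_nonneg (kineticEnergy_nonneg _) (by positivity)) (fun n => ?_)
    (hΨ.2.mul_left ((c : ℝ) ^ 2))
  rw [comp_compSpace, mul_add]
  refine add_le_add ?_ ?_
  · rw [kineticEnergy, kineticEnergy, Finset.mul_sum]
    refine Finset.sum_le_sum fun j _ => ?_
    rw [← mul_pow]
    gcongr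
    exact norm_weakRelDeriv_compLp_le hF hF0 (hΨ.1 n) j
  · have h := hF.norm_compLp_le hF0 (comp Ψ n)
    have h2 : ‖hF.compLp hF0 (comp Ψ n)‖ ^ 2 ≤ (c * ‖comp Ψ n‖) ^ 2 := by gcongr
    have h3 := mul_le_mul_of_nonneg_left h2 (Nat.cast_nonneg n : (0 : ℝ) ≤ n)
    rw [mul_pow] at h3
    linarith

theorem lipschitzWith_conj : LipschitzWith 1 (fun z : ℂ => conj z) :=
  Complex.isometry_conj.lipschitz

/-- The complex conjugate of a state. -/
def conjSpace (Ψ : Space ℓ) : Space ℓ := compSpace lipschitzWith_conj (map_zero _) Ψ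

theorem comp_conjSpace (Ψ : Space ℓ) (n : ℕ) : comp (conjSpace Ψ) n = star (comp Ψ n) := by
  apply Lp.ext
  filter_upwards [lipschitzWith_conj.coeFn_compLp (map_zero _) (comp Ψ n),
    Lp.coeFn_star (comp Ψ n)] with z h1 h2
  rw [conjSpace, comp_compSpace, h1, h2]
  rfl

theorem conjSpace_mem_formSubmodule {Ψ : Space ℓ} (hΨ : Ψ ∈ formSubmodule ℓ) :
    conjSpace Ψ ∈ formSubmodule ℓ :=
  compSpace_mem_formSubmodule _ _ hΨ

theorem conjSpace_add (Θ Ψ : Space ℓ) : conjSpace (Θ + Ψ) = conjSpace Θ + conjSpace Ψ :=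
  space_ext fun n => by simp only [comp_conjSpace, comp_add, star_add_L2]

theorem conjSpace_smul (c : ℂ) (Ψ : Space ℓ) : conjSpace (c • Ψ) = conj c • conjSpace Ψ :=
  space_ext fun n => by
    simp only [comp_conjSpace, comp_smul]
    apply Lp.ext
    filter_upwards [Lp.coeFn_star (c • comp Ψ n), Lp.coeFn_star (comp Ψ n),
      Lp.coeFn_smul c (comp Ψ n), Lp.coeFn_smul (conj c) (star (comp Ψ n))] with z h1 h2 h3 h4
    rw [h1, h4, Pi.star_apply, h3, Pi.smul_apply, Pi.smul_apply, h2]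
    simp

theorem conjSpace_conjSpace (Ψ : Space ℓ) : conjSpace (conjSpace Ψ) = Ψ :=
  space_ext fun n => by simp only [comp_conjSpace, star_star]

theorem inner_conjSpace (Θ Ψ : Space ℓ) :
    inner ℂ (conjSpace Θ) (conjSpace Ψ) = conj (inner ℂ Θ Ψ) := by
  refine (hasSum_inner_comp (conjSpace Θ) (conjSpace Ψ)).unique ?_
  refine (Complex.hasSum_conj'.mpr (hasSum_inner_comp Θ Ψ)).congr_fun fun n => ?_
  rw [comp_conjSpace, comp_conjSpace, inner_star_star]

/-- Translations, the form factor and the coupling constant are all real, so the form commutes with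
complex conjugation. -/
theorem energyForm_conjSpace (g : ℝ) {Θ Ψ : Space ℓ} (hΘ : Θ ∈ formSubmodule ℓ)
    (hΨ : Ψ ∈ formSubmodule ℓ) :
    energyForm ℓ g (conjSpace Θ) (conjSpace Ψ) = conj (energyForm ℓ g Θ Ψ) := by
  refine (hasSum_energyForm g (conjSpace_mem_formSubmodule hΘ)
    (conjSpace_mem_formSubmodule hΨ)).unique ?_
  refine (Complex.hasSum_conj'.mpr (hasSum_energyForm g hΘ hΨ)).congr_fun fun n => ?_
  have h1 := (mem_formSubmodule.mp hΘ).1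
  have h2 := (mem_formSubmodule.mp hΨ).1
  simp only [freeTerm, interactionTerm, comp_conjSpace, kinetic_star_star (h1 n) (h2 n),
    inner_star_star, pairing_star_star, map_add, map_mul, Complex.conj_ofReal, map_natCast]

/-- The operator `(-1)^N`. -/
def flipSpace (Ψ : Space ℓ) : Space ℓ :=
  ⟨fun n => ((-1 : ℂ) ^ n) • Ψ n, by
    refine memℓp_gen ((summable_norm_sq_comp Ψ).congr fun n => ?_)
    simp [norm_smul, comp]⟩

theorem comp_flipSpace (Ψ : Space ℓ) (n : ℕ) : comp (flipSpace Ψ) n = ((-1 : ℂ) ^ n) • comp Ψ n :=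
  rfl

theorem flipSpace_flipSpace (Ψ : Space ℓ) : flipSpace (flipSpace Ψ) = Ψ :=
  space_ext fun n => by
    rw [comp_flipSpace, comp_flipSpace, smul_smul, ← mul_pow]
    simp

theorem flipSpace_smul (c : ℂ) (Ψ : Space ℓ) : flipSpace (c • Ψ) = c • flipSpace Ψ :=
  space_ext fun n => by rw [comp_flipSpace, comp_smul, comp_smul, comp_flipSpace, smul_comm]

theorem flipSpace_mem_formSubmodule {Ψ : Space ℓ} (hΨ : Ψ ∈ formSubmodule ℓ) :
    flipSpace Ψ ∈ formSubmodule ℓ := by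
  rw [mem_formSubmodule] at hΨ ⊢
  refine ⟨fun n => (momentumDomain ℓ n).smul_mem _ (hΨ.1 n), hΨ.2.congr fun n => ?_⟩
  rw [comp_flipSpace, kineticEnergy_smul (hΨ.1 n), norm_smul]
  simp

theorem conj_neg_one_pow_mul (n : ℕ) : conj ((-1 : ℂ) ^ n) * (-1) ^ n = 1 := by
  rw [map_pow, map_neg, map_one, ← mul_pow]
  simp

theorem inner_flipSpace (Θ Ψ : Space ℓ) : inner ℂ (flipSpace Θ) (flipSpace Ψ) = inner ℂ Θ Ψ := by
  refine (hasSum_inner_comp (flipSpace Θ) (flipSpace Ψ)).unique ?_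
  refine (hasSum_inner_comp Θ Ψ).congr_fun fun n => ?_
  rw [comp_flipSpace, comp_flipSpace, inner_smul_left, inner_smul_right, ← mul_assoc,
    conj_neg_one_pow_mul, one_mul]

/-- The free form is diagonal in the phonon number, whereas the interaction joins neighbouring
sectors and picks up exactly one sign. -/
theorem energyForm_flipSpace (g : ℝ) {Θ Ψ : Space ℓ} (hΘ : Θ ∈ formSubmodule ℓ)
    (hΨ : Ψ ∈ formSubmodule ℓ) :
    energyForm ℓ g (flipSpace Θ) (flipSpace Ψ) = energyForm ℓ (-g) Θ Ψ := by
  refine (hasSum_energyForm g (flipSpace_mem_formSubmodule hΘ)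
    (flipSpace_mem_formSubmodule hΨ)).unique ?_
  refine (hasSum_energyForm (-g) hΘ hΨ).congr_fun fun n => ?_
  have h1 := (mem_formSubmodule.mp hΘ).1
  have h2 := (mem_formSubmodule.mp hΨ).1
  have hk : kinetic (comp (flipSpace Θ) n) (comp (flipSpace Ψ) n) =
      kinetic (comp Θ n) (comp Ψ n) := by
    refine Finset.sum_congr rfl fun j _ => ?_
    rw [comp_flipSpace, comp_flipSpace, weakRelDeriv_smul (h1 n), weakRelDeriv_smul (h2 n),
      inner_smul_left, inner_smul_right, ← mul_assoc, conj_neg_one_pow_mul, one_mul]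
  have hi : inner ℂ (comp (flipSpace Θ) n) (comp (flipSpace Ψ) n) =
      inner ℂ (comp Θ n) (comp Ψ n) := by
    rw [comp_flipSpace, comp_flipSpace, inner_smul_left, inner_smul_right, ← mul_assoc,
      conj_neg_one_pow_mul, one_mul]
  have hp : ∀ Θ Ψ : Space ℓ, pairing (comp (flipSpace Θ) n) (comp (flipSpace Ψ) (n + 1)) =
      -pairing (comp Θ n) (comp Ψ (n + 1)) := by
    intro Θ Ψ
    rw [comp_flipSpace, comp_flipSpace, pairing_smul_left, pairing_smul_right, ← mul_assoc,
      pow_succ, ← mul_assoc, conj_neg_one_pow_mul]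
    ring
  simp only [freeTerm, interactionTerm, hk, hi, hp, map_neg, Complex.ofReal_neg]
  ring

/-- The state with the single component `θ` in the `n`-phonon sector. -/
def singleSpace (n : ℕ) {θ : L2 ℓ n} (hθ : θ ∈ sector ℓ n) : Space ℓ :=
  lp.single 2 n ⟨θ, hθ⟩

theorem comp_singleSpace_self {θ : L2 ℓ n} (hθ : θ ∈ sector ℓ n) :
    comp (singleSpace n hθ) n = θ := by
  simp only [comp, singleSpace, lp.single_apply_self]

theorem comp_singleSpace_ne {θ : L2 ℓ n} (hθ : θ ∈ sector ℓ n) {k : ℕ} (hk : k ≠ n) :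
    comp (singleSpace n hθ) k = 0 := by
  simp only [comp, singleSpace, lp.single_apply_ne _ _ _ hk, ZeroMemClass.coe_zero]

theorem singleSpace_mem_formSubmodule {θ : L2 ℓ n} (hθ : θ ∈ sector ℓ n)
    (hd : θ ∈ momentumDomain ℓ n) : singleSpace n hθ ∈ formSubmodule ℓ := by
  rw [mem_formSubmodule]
  constructor
  · intro k
    rcases eq_or_ne k n with rfl | hk
    · rwa [comp_singleSpace_self]
    · rw [comp_singleSpace_ne hθ hk]
      exact Submodule.zero_mem _
  · refine summable_of_ne_finset_zero (s := {n}) fun k hk => ?_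
    rw [comp_singleSpace_ne hθ (by simpa using hk), kineticEnergy_zero]
    simp

theorem inner_singleSpace {θ : L2 ℓ n} (hθ : θ ∈ sector ℓ n) (Ψ : Space ℓ) :
    inner ℂ (singleSpace n hθ) Ψ = inner ℂ θ (comp Ψ n) := by
  refine (hasSum_inner_comp _ _).unique ?_
  have h := hasSum_single (f := fun k => inner ℂ (comp (singleSpace n hθ) k) (comp Ψ k)) n
    fun k hk => by simp only [comp_singleSpace_ne hθ hk, inner_zero_left]
  simpa only [comp_singleSpace_self] using h

end Operations

/-! ### Ground states with the sign of the interaction reversed -/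

section GroundStates

variable {ℓ : ℝ} [Fact (0 < ℓ)] {n : ℕ} {g E : ℝ}

/-- `Ψ` solves the eigenvalue equation of `(-i∇_x - P_f)² + N - g φ(v)` at energy `E`. -/
def IsGround (g E : ℝ) (Ψ : Space ℓ) : Prop :=
  Ψ ∈ formSubmodule ℓ ∧ ∀ Θ ∈ formSubmodule ℓ, energyForm ℓ (-g) Θ Ψ = E * inner ℂ Θ Ψ

theorem IsGround.add {Ψ Φ : Space ℓ} (hΨ : IsGround g E Ψ) (hΦ : IsGround g E Φ) :
    IsGround g E (Ψ + Φ) :=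
  ⟨(formSubmodule ℓ).add_mem hΨ.1 hΦ.1, fun Θ hΘ => by
    rw [(isHermitianFormOn_energyForm (-g)).add_right hΘ hΨ.1 hΦ.1, hΨ.2 Θ hΘ, hΦ.2 Θ hΘ,
      inner_add_right, mul_add]⟩

theorem IsGround.smul {Ψ : Space ℓ} (hΨ : IsGround g E Ψ) (c : ℂ) : IsGround g E (c • Ψ) :=
  ⟨(formSubmodule ℓ).smul_mem c hΨ.1, fun Θ hΘ => by
    rw [(isHermitianFormOn_energyForm (-g)).smul_right c hΘ hΨ.1, hΨ.2 Θ hΘ, inner_smul_right]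
    ring⟩

theorem IsGround.conjSpace {Ψ : Space ℓ} (hΨ : IsGround g E Ψ) :
    IsGround g E (conjSpace Ψ) := by
  refine ⟨conjSpace_mem_formSubmodule hΨ.1, fun Θ hΘ => ?_⟩
  have h := congrArg conj (hΨ.2 _ (conjSpace_mem_formSubmodule hΘ))
  rw [← energyForm_conjSpace _ (conjSpace_mem_formSubmodule hΘ) hΨ.1, map_mul,
    Complex.conj_ofReal, ← inner_conjSpace, conjSpace_conjSpace] at h
  exact h

/-! ### Positive and negative parts of real states -/

theorem lipschitzWith_posPart : LipschitzWith 1 (fun z : ℂ => ((max z.re 0 : ℝ) : ℂ)) := by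
  refine LipschitzWith.of_dist_le_mul fun z w => ?_
  rw [NNReal.coe_one, one_mul, Complex.dist_eq, Complex.dist_eq, ← Complex.ofReal_sub,
    Complex.norm_real, Real.norm_eq_abs]
  refine (abs_max_sub_max_le_abs z.re w.re 0).trans ?_
  rw [← Complex.sub_re]
  exact Complex.abs_re_le_norm _

/-- The positive part of the real part of a state. -/
def posSpace (Ψ : Space ℓ) : Space ℓ := compSpace lipschitzWith_posPart (by simp) Ψ

/-- The negative part of the real part of a state. -/
def negSpace (Ψ : Space ℓ) : Space ℓ := posSpace ((-1 : ℂ) • Ψ)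

theorem coeFn_comp_posSpace (Ψ : Space ℓ) (n : ℕ) :
    ∀ᵐ z, comp (posSpace Ψ) n z = ((max (comp Ψ n z).re 0 : ℝ) : ℂ) :=
  lipschitzWith_posPart.coeFn_compLp (by simp) (comp Ψ n)

theorem coeFn_comp_negSpace (Ψ : Space ℓ) (n : ℕ) :
    ∀ᵐ z, comp (negSpace Ψ) n z = ((max (-(comp Ψ n z).re) 0 : ℝ) : ℂ) := by
  filter_upwards [coeFn_comp_posSpace ((-1 : ℂ) • Ψ) n, Lp.coeFn_smul (-1 : ℂ) (comp Ψ n)]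
    with z h1 h2
  rw [negSpace, h1, comp_smul, h2]
  simp

theorem isNonneg_posSpace (Ψ : Space ℓ) (n : ℕ) : IsNonneg (comp (posSpace Ψ) n) := by
  filter_upwards [coeFn_comp_posSpace Ψ n] with z hz
  rw [hz, Complex.norm_real, Real.norm_of_nonneg (le_max_right _ _)]

theorem isNonneg_negSpace (Ψ : Space ℓ) (n : ℕ) : IsNonneg (comp (negSpace Ψ) n) :=
  isNonneg_posSpace _ n

theorem posSpace_mul_negSpace (Ψ : Space ℓ) (n : ℕ) :
    ∀ᵐ z, comp (posSpace Ψ) n z * comp (negSpace Ψ) n z = 0 := by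
  filter_upwards [coeFn_comp_posSpace Ψ n, coeFn_comp_negSpace Ψ n] with z h1 h2
  rw [h1, h2, mul_eq_zero]
  rcases le_total (comp Ψ n z).re 0 with h | h
  · left; simp [h]
  · right; simp [h]

theorem eq_posSpace_add_negSpace {Ψ : Space ℓ} (h : conjSpace Ψ = Ψ) :
    Ψ = posSpace Ψ + (-1 : ℂ) • negSpace Ψ := by
  refine space_ext fun n => ?_
  apply Lp.ext
  have h0 : star (comp Ψ n) = comp Ψ n := by rw [← comp_conjSpace, h]
  have hs := Lp.coeFn_star (comp Ψ n)
  rw [h0] at hs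
  rw [comp_add, comp_smul]
  filter_upwards [coeFn_comp_posSpace Ψ n, coeFn_comp_negSpace Ψ n, hs,
    Lp.coeFn_add (comp (posSpace Ψ) n) ((-1 : ℂ) • comp (negSpace Ψ) n),
    Lp.coeFn_smul (-1 : ℂ) (comp (negSpace Ψ) n)] with z h1 h2 h3 h4 h5
  rw [h4, Pi.add_apply, h5, Pi.smul_apply, h1, h2]
  have him : (comp Ψ n z).im = 0 := by
    have := congrArg Complex.im h3
    simp only [Pi.star_apply, RCLike.star_def, Complex.conj_im] at this
    linarith
  apply Complex.ext
  · rcases le_total (comp Ψ n z).re 0 with h | h <;> simp [h]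
  · simp [him]

/-- The form is nonpositive on pairs of nonnegative states with disjoint supports. -/
theorem re_energyForm_nonpos (hg : 0 ≤ g) {Θ Ψ : Space ℓ} (hΘ : Θ ∈ formSubmodule ℓ)
    (hΨ : Ψ ∈ formSubmodule ℓ) (hΘ0 : ∀ n, IsNonneg (comp Θ n)) (hΨ0 : ∀ n, IsNonneg (comp Ψ n))
    (h : ∀ n, ∀ᵐ z, comp Θ n z * comp Ψ n z = 0) : (energyForm ℓ (-g) Θ Ψ).re ≤ 0 := by
  have hs := Complex.hasSum_re (hasSum_energyForm (-g) hΘ hΨ)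
  refine hasSum_le (fun n => ?_) hs hasSum_zero
  have h1 := (hΘ0 n).re_kinetic_nonpos (hΨ0 n) ((mem_formSubmodule.mp hΘ).1 n)
    ((mem_formSubmodule.mp hΨ).1 n) (h n)
  have h2 := (hΘ0 n).re_pairing_nonneg (hΨ0 (n + 1))
  have h3 := (hΨ0 n).re_pairing_nonneg (hΘ0 (n + 1))
  rw [freeTerm, interactionTerm, inner_eq_zero_of_ae_mul_eq_zero (h n), mul_zero, add_zero,
    Complex.add_re, Complex.re_ofReal_mul, Complex.add_re, Complex.re_ofReal_mul,
    Complex.re_ofReal_mul, Complex.conj_re]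
  have h4 := Real.sqrt_nonneg ((n : ℝ) + 1)
  have h5 : 0 ≤ g * (√((n : ℝ) + 1) * (pairing (comp Θ n) (comp Ψ (n + 1))).re
    + √((n : ℝ) + 1) * (pairing (comp Ψ n) (comp Θ (n + 1))).re) := by positivity
  linarith

theorem inner_eq_zero_of_disjoint {Θ Ψ : Space ℓ}
    (h : ∀ n, ∀ᵐ z, comp Θ n z * comp Ψ n z = 0) : inner ℂ Θ Ψ = 0 := by
  refine (hasSum_inner_comp Θ Ψ).unique ?_
  simpa only [inner_eq_zero_of_ae_mul_eq_zero (h _)] using hasSum_zero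

theorem re_inner_self_eq (Φ : Space ℓ) : (inner ℂ Φ Φ : ℂ).re = ‖Φ‖ ^ 2 :=
  inner_self_eq_norm_sq (𝕜 := ℂ) Φ

/-- The positive and negative parts of a real ground state are ground states. -/
theorem IsGround.posSpace_negSpace (hg : 0 ≤ g)
    (hlow : ∀ Φ ∈ formSubmodule ℓ, E * ‖Φ‖ ^ 2 ≤ (energyForm ℓ (-g) Φ Φ).re)
    {Ψ : Space ℓ} (hΨ : IsGround g E Ψ) (hreal : Polaron.conjSpace Ψ = Ψ) :
    IsGround g E (posSpace Ψ) ∧ IsGround g E (negSpace Ψ) := by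
  have hform := isHermitianFormOn_energyForm (ℓ := ℓ) (-g)
  have hQ := hform.sub_inner E
  have hQpos : ∀ Φ ∈ formSubmodule ℓ,
      0 ≤ (energyForm ℓ (-g) Φ Φ - E * inner ℂ Φ Φ).re := by
    intro Φ hΦ
    rw [Complex.sub_re, Complex.re_ofReal_mul, re_inner_self_eq]
    linarith [hlow Φ hΦ]
  have hp : posSpace Ψ ∈ formSubmodule ℓ := compSpace_mem_formSubmodule _ _ hΨ.1
  have hm : negSpace Ψ ∈ formSubmodule ℓ :=
    compSpace_mem_formSubmodule _ _ ((formSubmodule ℓ).smul_mem _ hΨ.1)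
  set p := posSpace Ψ with hpdef
  set m := negSpace Ψ with hmdef
  have hdec : Ψ = p + (-1 : ℂ) • m := eq_posSpace_add_negSpace hreal
  have hm' : (-1 : ℂ) • m ∈ formSubmodule ℓ := (formSubmodule ℓ).smul_mem _ hm
  have hcross : (energyForm ℓ (-g) p m).re ≤ 0 := re_energyForm_nonpos hg hp hm
    (isNonneg_posSpace Ψ) (isNonneg_negSpace Ψ) (posSpace_mul_negSpace Ψ)
  have hinner : inner ℂ p m = 0 := inner_eq_zero_of_disjoint (posSpace_mul_negSpace Ψ)
  have h0 : energyForm ℓ (-g) Ψ Ψ - E * inner ℂ Ψ Ψ = 0 := by rw [hΨ.2 Ψ hΨ.1, sub_self]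
  -- For `Ψ = p - m` the shifted form, zero at `Ψ`, splits into its values at `p` and `m` and `-2 Re
  -- q(p, m)`. All three are nonnegative, so `p` and `m` are minimizers as well.
  have hexp : (energyForm ℓ (-g) Ψ Ψ - E * inner ℂ Ψ Ψ).re =
      (energyForm ℓ (-g) p p - E * inner ℂ p p).re + (energyForm ℓ (-g) m m - E * inner ℂ m m).re
        - 2 * (energyForm ℓ (-g) p m).re := by
    have e1 := hQ.add_right hΨ.1 hp hm'
    have e2 := hQ.add_left hp hm' hp
    have e3 := hQ.add_left hp hm' hm'
    simp only [← hdec] at e1 e2 e3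
    rw [e1, e2, e3]
    have e4 := hQ.smul_right (-1) hp hm
    have e5 := hQ.smul_left (-1) hm hp
    have e6 := hQ.smul_left (-1) hm hm'
    have e7 := hQ.smul_right (-1) hm hm
    have e8 := hQ.conj_symm hp hm
    rw [e4, e5, e6, e7, ← e8]
    simp only [hinner, mul_zero, sub_zero, map_neg, map_one, Complex.add_re, Complex.neg_re,
      Complex.conj_re, neg_mul, one_mul, neg_neg] at e8 ⊢
    have e9 : (energyForm ℓ (-g) m p - E * inner ℂ m p).re = (energyForm ℓ (-g) p m).re := by
      rw [← e8, Complex.conj_re]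
    rw [e9]
    ring
  rw [h0, Complex.zero_re] at hexp
  have hp0 := hQpos p hp
  have hm0 := hQpos m hm
  refine ⟨⟨hp, fun Θ hΘ => ?_⟩, ⟨hm, fun Θ hΘ => ?_⟩⟩
  · exact sub_eq_zero.mp (hQ.eq_zero_of_re_nonpos hQpos hΘ hp (by linarith))
  · exact sub_eq_zero.mp (hQ.eq_zero_of_re_nonpos hQpos hΘ hm (by linarith))

/-! ### Cone functions as test states -/

/-- The function `max (R - ‖(y₁, …, yₙ)‖) 0`. -/
def cone (R : ℝ) (z : Config ℓ n) : ℂ := ((max (R - ‖z.2‖) 0 : ℝ) : ℂ)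

theorem continuous_cone (R : ℝ) : Continuous (cone R : Config ℓ n → ℂ) := by
  unfold cone; fun_prop

theorem cone_eq_zero {R : ℝ} {z : Config ℓ n} (hz : R < ‖z.2‖) : cone R z = 0 := by
  rw [cone, max_eq_right (by linarith), Complex.ofReal_zero]

theorem memLp_cone (R : ℝ) : MemLp (cone R : Config ℓ n → ℂ) 2 volume :=
  (continuous_cone R).memLp_of_hasCompactSupport
    (hasCompactSupport_of_norm_snd_le R fun _ => cone_eq_zero)

variable (ℓ n) in
/-- The cone function as an element of `L²`. -/
def coneL2 (R : ℝ) : L2 ℓ n := (memLp_cone R).toLp _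

theorem coeFn_coneL2 (R : ℝ) : coneL2 ℓ n R =ᵐ[volume] cone R := (memLp_cone R).coeFn_toLp

theorem isNonneg_coneL2 (R : ℝ) : IsNonneg (coneL2 ℓ n R) := by
  filter_upwards [coeFn_coneL2 R] with z hz
  rw [hz, cone, Complex.norm_real, Real.norm_of_nonneg (le_max_right _ _)]

/-- The norm on tuples is the maximum of the norms of the entries, hence permutation invariant. -/
theorem coneL2_mem_sector (R : ℝ) : coneL2 ℓ n R ∈ sector ℓ n := by
  intro σ
  rw [coneL2, Lp.toLp_compMeasurePreserving]
  refine MemLp.toLp_congr _ _ (Eventually.of_forall fun z => ?_)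
  have h : ‖fun i => z.2 (σ i)‖ = ‖z.2‖ := by
    refine le_antisymm ((pi_norm_le_iff_of_nonneg (norm_nonneg _)).mpr fun i =>
      norm_le_pi_norm z.2 (σ i)) ((pi_norm_le_iff_of_nonneg (norm_nonneg _)).mpr fun i => ?_)
    have := norm_le_pi_norm (fun i => z.2 (σ i)) (σ.symm i)
    simpa using this
  simp only [Function.comp_apply, cone, permute, h]

theorem norm_single_smul (j : Fin 3) (s : ℝ) :
    ‖s • (EuclideanSpace.single j (1 : ℝ) : E3)‖ = |s| := by
  rw [norm_smul, PiLp.norm_single, norm_one, mul_one, Real.norm_eq_abs]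

theorem abs_norm_shift_sub_le (t : E3) (z : Config ℓ n) : |‖(shift t z).2‖ - ‖z.2‖| ≤ ‖t‖ := by
  refine (abs_norm_sub_norm_le _ _).trans ((pi_norm_le_iff_of_nonneg (norm_nonneg _)).mpr
    fun i => ?_)
  simp [shift]

/-- A cone is 1-Lipschitz along the motion and supported on a compact set, so its difference
quotients are bounded in `L²`. -/
theorem coneL2_mem_momentumDomain (R : ℝ) : coneL2 ℓ n R ∈ momentumDomain ℓ n := by
  intro j
  set K : Set (Config ℓ n) := Set.univ ×ˢ Metric.closedBall (0 : Fin n → E3) (R + 1) with hK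
  have hKc : IsCompact K := isCompact_univ.prod (isCompact_closedBall _ _)
  have hKm : volume K ^ (1 / (2 : ℝ≥0∞).toReal) ≠ ⊤ :=
    ENNReal.rpow_ne_top_of_nonneg (by simp) hKc.measure_ne_top
  set M : ℝ := (volume K ^ (1 / (2 : ℝ≥0∞).toReal)).toReal with hM
  have hM0 : 0 ≤ M := ENNReal.toReal_nonneg
  -- `M` serves for `|s| ≤ 1`, when both functions are supported in `K`; for `|s| > 1` the triangle
  -- inequality gives twice the norm.
  refine exists_isWeakRelDeriv_of_norm_flow_sub_le (C := M + 2 * ‖coneL2 ℓ n R‖) fun s => ?_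
  rcases le_or_gt |s| 1 with hs | hs
  · set t : E3 := s • EuclideanSpace.single j (1 : ℝ) with ht
    have htn : ‖t‖ = |s| := norm_single_smul j s
    have hflow : flow j s (coneL2 ℓ n R) =
        ((memLp_cone R).comp_measurePreserving (measurePreserving_shift t)).toLp _ :=
      Lp.toLp_compMeasurePreserving (memLp_cone R) (measurePreserving_shift t)
    rw [hflow, coneL2, ← MemLp.toLp_sub, Lp.norm_toLp]
    have hb := eLpNorm_sub_le_of_dist_bdd (volume : Measure (Config ℓ n)) (p := 2) (by simp)
      hKc.measurableSet (c := |s|) (abs_nonneg s)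
      (f := cone R ∘ shift t) (g := cone R) (fun z => ?_) ?_ ?_
    · rw [← ENNReal.ofReal_toReal hKm, ← ENNReal.ofReal_mul (abs_nonneg s)] at hb
      refine (ENNReal.toReal_le_of_le_ofReal (by positivity) hb).trans ?_
      rw [← hM]
      nlinarith [mul_nonneg (norm_nonneg ((memLp_cone (ℓ := ℓ) (n := n) R).toLp (cone R)))
        (abs_nonneg s)]
    · simp only [Function.comp_apply, cone]
      rw [Complex.dist_eq, ← Complex.ofReal_sub, Complex.norm_real, Real.norm_eq_abs]
      refine (abs_max_sub_max_le_abs _ _ 0).trans ?_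
      have := abs_norm_shift_sub_le t z
      rw [← htn, sub_sub_sub_cancel_left, abs_sub_comm]
      exact this
    · intro z hz
      refine ⟨Set.mem_univ _, ?_⟩
      by_contra hzK
      have h1 : R + 1 < ‖z.2‖ := by simpa using hzK
      have h2 := (abs_le.mp (abs_norm_shift_sub_le t z)).1
      exact hz (cone_eq_zero (by linarith))
    · intro z hz
      refine ⟨Set.mem_univ _, ?_⟩
      by_contra hzK
      have h1 : R + 1 < ‖z.2‖ := by simpa using hzK
      exact hz (cone_eq_zero (by linarith))
  · refine (norm_sub_le _ _).trans ?_
    rw [LinearIsometry.norm_map]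
    nlinarith [norm_nonneg (coneL2 ℓ n R), mul_nonneg hM0 (abs_nonneg s)]

/-! ### The eigenvalue equation in a single sector -/

/-- `hlow` removes the coupling to the sector below; for `n = 0` there is none and the hypothesis is
vacuous. -/
theorem energyForm_singleSpace {θ : L2 ℓ n} (hθ : θ ∈ sector ℓ n)
    (hd : θ ∈ momentumDomain ℓ n) {Ψ : Space ℓ} (hΨ : Ψ ∈ formSubmodule ℓ)
    (hlow : ∀ k, k + 1 = n → comp Ψ k = 0) (c : ℝ) :
    energyForm ℓ c (singleSpace n hθ) Ψ = kinetic θ (comp Ψ n) + n * inner ℂ θ (comp Ψ n)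
      + c * (√(n + 1) * pairing θ (comp Ψ (n + 1))) := by
  refine (hasSum_energyForm c (singleSpace_mem_formSubmodule hθ hd) hΨ).unique ?_
  have h := hasSum_single (f := fun k => freeTerm (singleSpace n hθ) Ψ k
    + c * interactionTerm (singleSpace n hθ) Ψ k) n fun k hk => ?_
  · convert h using 1
    simp only [freeTerm, interactionTerm, comp_singleSpace_self,
      comp_singleSpace_ne hθ (Nat.succ_ne_self n), pairing_zero_right, map_zero, mul_zero,
      add_zero]
  · have hz : pairing (comp Ψ k) (comp (singleSpace n hθ) (k + 1)) = 0 := by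
      rcases eq_or_ne (k + 1) n with h1 | h1
      · rw [hlow k h1, pairing_zero_left]
      · rw [comp_singleSpace_ne hθ h1, pairing_zero_right]
    simp only [freeTerm, interactionTerm, comp_singleSpace_ne hθ hk, kinetic_zero_left,
      inner_zero_left, pairing_zero_left, hz, map_zero, mul_zero, add_zero]

theorem ae_of_ae_consMap {P : Config ℓ (n + 1) → Prop}
    (h : ∀ᵐ p ∂((volume : Measure (Config ℓ n)).prod (volume : Measure E3)), P (consMap p)) :
    ∀ᵐ z, P z := by
  rw [← (measurePreserving_consMap (ℓ := ℓ) (n := n)).map_eq,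
    measurableEmbedding_consMap.ae_map_iff]
  exact h

/-- A nonnegative function annihilated by `a(v)` against all cones vanishes. -/
theorem eq_zero_of_forall_pairing_coneL2 {ψ : L2 ℓ (n + 1)} (hψ : IsNonneg ψ)
    (hd : ψ ∈ momentumDomain ℓ (n + 1)) (h : ∀ R : ℕ, pairing (coneL2 ℓ n R) ψ = 0) : ψ = 0 := by
  obtain ⟨C, -, hC⟩ := exists_interaction_bound (ℓ := ℓ) one_pos
  have hae : ∀ R : ℕ, ∀ᵐ p ∂((volume : Measure (Config ℓ n)).prod (volume : Measure E3)),
      absKernel (coneL2 ℓ n R) ψ p = 0 := by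
    intro R
    have h1 := h R
    rw [(isNonneg_coneL2 (R : ℝ)).pairing_eq hψ, Complex.ofReal_eq_zero,
      integral_eq_zero_iff_of_nonneg (fun p => absKernel_nonneg _ _ p) (hC n _ ψ hd).1] at h1
    exact h1
  -- The form factor takes the value 0 at the origin and is strictly positive elsewhere.
  have hne : ∀ᵐ p : Config ℓ n × E3 ∂((volume : Measure (Config ℓ n)).prod (volume : Measure E3)),
      p.2 ≠ 0 := by
    have h0 : ∀ᵐ y : E3, y ≠ 0 := by
      rw [ae_iff]
      simp
    exact Measure.quasiMeasurePreserving_snd.ae h0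
  have hz : ∀ᵐ z, ψ z = 0 := by
    refine ae_of_ae_consMap ?_
    filter_upwards [ae_all_iff.mpr hae, hne,
      ae_all_iff.mpr fun R : ℕ => ae_fst (coeFn_coneL2 (ℓ := ℓ) (n := n) (R : ℝ))] with p h1 h2 h3
    obtain ⟨R, hR⟩ := exists_nat_gt ‖p.1.2‖
    have h4 := h1 R
    rw [absKernel, h3 R] at h4
    have h5 : ‖cone (R : ℝ) p.1‖ ≠ 0 := by
      rw [cone, max_eq_left (by linarith), Complex.norm_real, Real.norm_eq_abs, abs_ne_zero]
      linarith
    have h6 := (formFactor_pos h2).ne'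
    simpa [h5, h6] using h4
  apply Lp.ext
  filter_upwards [hz, Lp.coeFn_zero ℂ 2 (volume : Measure (Config ℓ (n + 1)))] with z h1 h2
  rw [h1, h2, Pi.zero_apply]

/-- A nonnegative ground state without vacuum component vanishes. -/
theorem IsGround.eq_zero_of_comp_zero (hg : 0 < g) {Ψ : Space ℓ} (hΨ : IsGround g E Ψ)
    (h0 : ∀ n, IsNonneg (comp Ψ n)) (hvac : comp Ψ 0 = 0) : Ψ = 0 := by
  suffices h : ∀ n, ∀ k ≤ n, comp Ψ k = 0 from space_ext fun n => h n n le_rfl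
  intro n
  induction n with
  | zero => intro k hk; rw [Nat.le_zero.mp hk]; exact hvac
  | succ n ih =>
    intro k hk
    rcases Nat.le_succ_iff.mp hk with hk | rfl
    · exact ih k hk
    refine eq_zero_of_forall_pairing_coneL2 (h0 (n + 1)) ((mem_formSubmodule.mp hΨ.1).1 (n + 1))
      fun R => ?_
    have hs := coneL2_mem_sector (ℓ := ℓ) (n := n) (R : ℝ)
    have hd := coneL2_mem_momentumDomain (ℓ := ℓ) (n := n) (R : ℝ)
    -- With the components up to `n` zero, the eigenvalue equation tested in sector `n` retains only
    -- the annihilation of the `(n+1)`-st component.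
    have h1 := hΨ.2 _ (singleSpace_mem_formSubmodule hs hd)
    rw [energyForm_singleSpace hs hd hΨ.1 (fun k hk => ih k (by omega)), inner_singleSpace,
      ih n le_rfl, inner_zero_right, ← kinetic_conj_symm, kinetic_zero_left] at h1
    have h2 : (√((n : ℝ) + 1) : ℂ) ≠ 0 := by
      rw [Complex.ofReal_ne_zero]
      positivity
    have h3 : (g : ℂ) ≠ 0 := Complex.ofReal_ne_zero.mpr hg.ne'
    simpa [h2, h3] using h1

end GroundStates

/-! ### Positivity of the vacuum component -/

section Vacuum

variable {ℓ : ℝ} [Fact (0 < ℓ)] {n : ℕ} {g E : ℝ}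

/-- The functions with values in `{0, 1}`. -/
def IsZeroOne (f : L2 ℓ n) : Prop := ∀ᵐ z, f z = 0 ∨ f z = 1

theorem IsZeroOne.flow {f : L2 ℓ n} (hf : IsZeroOne f) (j : Fin 3) (s : ℝ) :
    IsZeroOne (flow j s f) := by
  have h1 := (measurePreserving_shift (ℓ := ℓ) (n := n)
    (s • EuclideanSpace.single j (1 : ℝ))).quasiMeasurePreserving.ae hf
  filter_upwards [coeFn_translate (s • EuclideanSpace.single j (1 : ℝ)) f, h1] with z h2 h3
  rw [Polaron.flow, h2]
  exact h3

/-- Differences of indicators take values in `{-1, 0, 1}`, where the square equals the absolute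
value; the triangle inequality therefore holds for the squared norms. -/
theorem IsZeroOne.norm_sub_sq_le {f₁ f₂ f₃ : L2 ℓ n} (h₁ : IsZeroOne f₁) (h₂ : IsZeroOne f₂)
    (h₃ : IsZeroOne f₃) : ‖f₁ - f₃‖ ^ 2 ≤ ‖f₁ - f₂‖ ^ 2 + ‖f₂ - f₃‖ ^ 2 := by
  simp only [← integral_norm_sq]
  rw [← integral_add (integrable_norm_sq _) (integrable_norm_sq _)]
  refine integral_mono_ae (integrable_norm_sq _)
    ((integrable_norm_sq _).add (integrable_norm_sq _)) ?_
  filter_upwards [h₁, h₂, h₃, Lp.coeFn_sub f₁ f₃, Lp.coeFn_sub f₁ f₂, Lp.coeFn_sub f₂ f₃]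
    with z h1 h2 h3 e1 e2 e3
  simp only [e1, e2, e3, Pi.sub_apply]
  rcases h1 with h1 | h1 <;> rcases h2 with h2 | h2 <;> rcases h3 with h3 | h3 <;>
    simp [h1, h2, h3]

/-- An indicator function that is Lipschitz along the flow in the `L²` norm is invariant. -/
theorem IsZeroOne.flow_eq {f : L2 ℓ n} (hf : IsZeroOne f) {j : Fin 3} {B : ℝ}
    (hB : ∀ s, ‖Polaron.flow j s f - f‖ ^ 2 ≤ B * s ^ 2) (s : ℝ) : Polaron.flow j s f = f := by
  have hdouble : ∀ t, ‖Polaron.flow j (2 * t) f - f‖ ^ 2 ≤ 2 * ‖Polaron.flow j t f - f‖ ^ 2 := by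
    intro t
    have h1 := (hf.flow j (2 * t)).norm_sub_sq_le (hf.flow j t) hf
    have h2 : ‖Polaron.flow j (2 * t) f - Polaron.flow j t f‖ = ‖Polaron.flow j t f - f‖ := by
      rw [two_mul, ← flow_flow, ← map_sub, LinearIsometry.norm_map]
    rw [h2] at h1
    linarith
  have hiter : ∀ k : ℕ, ‖Polaron.flow j s f - f‖ ^ 2 ≤ B * s ^ 2 * (1 / 2) ^ k := by
    intro k
    have h : ∀ k : ℕ, ‖Polaron.flow j s f - f‖ ^ 2
        ≤ 2 ^ k * ‖Polaron.flow j (s * (1 / 2) ^ k) f - f‖ ^ 2 := by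
      intro k
      induction k with
      | zero => simp
      | succ k ih =>
        have h1 := hdouble (s * (1 / 2) ^ (k + 1))
        have h2 : 2 * (s * (1 / 2) ^ (k + 1)) = s * (1 / 2) ^ k := by ring
        rw [h2] at h1
        refine ih.trans ?_
        rw [pow_succ (2 : ℝ), mul_assoc]
        gcongr
    refine (h k).trans ?_
    -- After `k` halvings of the time the doubling inequality costs `2^k`, while the quadratic bound
    -- gains `4^(-k)`; the product tends to zero.
    have h3 := hB (s * (1 / 2) ^ k)
    have h4 : (2 : ℝ) ^ k * (1 / 2) ^ k = 1 := by rw [← mul_pow]; norm_num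
    calc (2 : ℝ) ^ k * ‖Polaron.flow j (s * (1 / 2) ^ k) f - f‖ ^ 2
        ≤ 2 ^ k * (B * (s * (1 / 2) ^ k) ^ 2) := by gcongr
      _ = B * s ^ 2 * (1 / 2) ^ k * (2 ^ k * (1 / 2) ^ k) := by ring
      _ = _ := by rw [h4, mul_one]
  have hlim : Tendsto (fun k : ℕ => B * s ^ 2 * (1 / 2 : ℝ) ^ k) atTop (𝓝 0) := by
    simpa using (tendsto_pow_atTop_nhds_zero_of_lt_one (r := (1 / 2 : ℝ)) (by norm_num)
      (by norm_num)).const_mul (B * s ^ 2)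
  have h0 : ‖Polaron.flow j s f - f‖ ^ 2 ≤ 0 := ge_of_tendsto' hlim hiter
  have h1 : ‖Polaron.flow j s f - f‖ = 0 := by
    nlinarith [norm_nonneg (Polaron.flow j s f - f)]
  exact sub_eq_zero.mp (norm_eq_zero.mp h1)

theorem translate_eq_of_forall_flow_eq {f : L2 ℓ n} (h : ∀ j s, flow j s f = f) (t : E3) :
    translate t f = f := by
  have ht : t = t 0 • EuclideanSpace.single 0 1 + (t 1 • EuclideanSpace.single 1 1
      + t 2 • EuclideanSpace.single 2 1) := by
    ext i
    fin_cases i <;> simp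
  rw [ht, ← translate_translate, ← translate_translate]
  have h' : ∀ (j : Fin 3) (s : ℝ), translate (s • EuclideanSpace.single j (1 : ℝ)) f = f := h
  rw [h', h', h']

/-! ### Ergodicity of translations in the vacuum sector -/

instance : (volume : Measure (Config ℓ 0)).IsAddHaarMeasure :=
  Measure.prod.instIsAddHaarMeasure (volume : Measure (Torus ℓ)) (volume : Measure (Fin 0 → E3))

theorem measurableSet_ne_zero (f : L2 ℓ n) : MeasurableSet {z | f z ≠ 0} :=
  (Lp.stronglyMeasurable f).measurable (measurableSet_singleton (0 : ℂ)).compl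

/-- Without phonons, the relative motion acts ergodically. -/
theorem ae_zero_or_ae_ne_zero_of_translate_eq {f : L2 ℓ 0} (h : ∀ t, translate t f = f) :
    (∀ᵐ z, f z = 0) ∨ ∀ᵐ z, f z ≠ 0 := by
  -- Without phonons a configuration is a point of the torus together with the empty tuple. The
  -- configurations then form a group, on which `shift` is translation by `cover`, and the action of
  -- the group on itself is ergodic.
  have : ErgodicVAdd (Config ℓ 0) (Config ℓ 0) (volume : Measure (Config ℓ 0)) :=
    instErgodicVAddOfIsAddLeftInvariant
  have hc := aeconst_of_forall_preimage_vadd_ae_eq (Config ℓ 0) (μ := volume)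
    (measurableSet_ne_zero f).nullMeasurableSet fun w => ?_
  · rcases (eventuallyConst_set.mp hc) with h1 | h1
    · exact Or.inr h1
    · left
      filter_upwards [h1] with z hz
      simpa using hz
  · obtain ⟨p, rfl⟩ := isOpenQuotientMap_cover.surjective w
    have h1 := coeFn_translate p.1 f
    rw [h p.1] at h1
    refine eventuallyEq_set.mpr ?_
    filter_upwards [h1] with z hz
    have h2 : shift p.1 z = cover ℓ 0 p +ᵥ z := by
      refine Prod.ext (funext fun j => ?_) (Subsingleton.elim _ _)
      simp [shift, cover, add_comm]
    rw [Function.comp_apply, h2] at hz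
    exact not_congr (iff_of_eq (congrArg (· = 0) hz.symm))

/-- The truncation `z ↦ min 1 (k (Re z)₊)`. -/
def trunc (k : ℕ) (z : ℂ) : ℂ := ((min 1 (k * max z.re 0) : ℝ) : ℂ)

theorem lipschitzWith_trunc (k : ℕ) : LipschitzWith k (trunc k) := by
  refine LipschitzWith.of_dist_le_mul fun z w => ?_
  rw [trunc, trunc, Complex.dist_eq, ← Complex.ofReal_sub, Complex.norm_real, Real.norm_eq_abs]
  have h1 := abs_min_sub_min_le_max 1 ((k : ℝ) * max z.re 0) 1 (k * max w.re 0)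
  have h2 := lipschitzWith_posPart.dist_le_mul z w
  rw [Complex.dist_eq, ← Complex.ofReal_sub, Complex.norm_real, Real.norm_eq_abs, NNReal.coe_one,
    one_mul] at h2
  refine h1.trans ?_
  rw [sub_self, abs_zero, max_eq_right (abs_nonneg _), ← mul_sub, abs_mul, Nat.abs_cast]
  simpa using mul_le_mul_of_nonneg_left h2 (Nat.cast_nonneg k)

theorem trunc_zero (k : ℕ) : trunc k 0 = 0 := by simp [trunc]

/-- The truncation of a function. -/
def truncLp (k : ℕ) (f : L2 ℓ n) : L2 ℓ n := (lipschitzWith_trunc k).compLp (trunc_zero k) f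

theorem coeFn_truncLp (k : ℕ) (f : L2 ℓ n) : ∀ᵐ z, truncLp k f z = trunc k (f z) :=
  (lipschitzWith_trunc k).coeFn_compLp (trunc_zero k) f

theorem coeFn_truncLp_of_isNonneg (k : ℕ) {f : L2 ℓ n} (hf : IsNonneg f) :
    ∀ᵐ z, truncLp k f z = ((min 1 (k * ‖f z‖) : ℝ) : ℂ) := by
  filter_upwards [coeFn_truncLp k f, hf] with z h1 h2
  rw [h1, trunc, h2, Complex.ofReal_re, max_eq_left (norm_nonneg _)]
  simp

/-- The empty tuple has norm zero, so in the vacuum sector the cone of height one is the constant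
function one. -/
theorem coeFn_coneL2_zero : ∀ᵐ z, coneL2 ℓ 0 1 z = 1 := by
  filter_upwards [coeFn_coneL2 (ℓ := ℓ) (n := 0) 1] with z hz
  rw [hz, cone, Subsingleton.elim z.2 0, norm_zero]
  simp

theorem weakRelDeriv_coneL2_zero (j : Fin 3) : weakRelDeriv j (coneL2 ℓ 0 1) = 0 := by
  refine IsWeakRelDeriv.weakRelDeriv_eq ?_
  rw [isWeakRelDeriv_iff_hasDerivAt]
  have h : ∀ s, flow j s (coneL2 ℓ 0 1) = coneL2 ℓ 0 1 := by
    intro s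
    apply Lp.ext
    have h1 := (measurePreserving_shift (ℓ := ℓ) (n := 0)
      (s • EuclideanSpace.single j (1 : ℝ))).quasiMeasurePreserving.ae coeFn_coneL2_zero
    filter_upwards [coeFn_translate (s • EuclideanSpace.single j (1 : ℝ)) (coneL2 ℓ 0 1), h1,
      coeFn_coneL2_zero] with z h2 h3 h4
    rw [flow, h2, h4]
    exact h3
  simp only [h]
  exact hasDerivAt_const _ _

/-- The truncations of the vacuum component have uniformly bounded kinetic energy. -/
theorem IsGround.kineticEnergy_truncLp_le (hg : 0 ≤ g) {Ψ : Space ℓ} (hΨ : IsGround g E Ψ)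
    (h0 : ∀ n, IsNonneg (comp Ψ n)) (k : ℕ) :
    kineticEnergy (truncLp k (comp Ψ 0)) ≤ |E| * ‖coneL2 ℓ 0 1‖ ^ 2 := by
  set u := comp Ψ 0 with hu
  set m := truncLp k u with hm
  set one := coneL2 ℓ 0 1 with hone
  have hud : u ∈ momentumDomain ℓ 0 := (mem_formSubmodule.mp hΨ.1).1 0
  have hmd : m ∈ momentumDomain ℓ 0 := compLp_mem_momentumDomain _ _ hud
  have honed : one ∈ momentumDomain ℓ 0 := coneL2_mem_momentumDomain 1
  -- With `m = min(1, k u)` the functions `f = 1 - m` and `h = k u - m` are nonnegative with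
  -- disjoint supports: `f` vanishes where `k u ≥ 1`, and `h` where `k u ≤ 1`. Thus their kinetic
  -- overlap is nonpositive and their inner product zero.
  set f := one + (-1 : ℂ) • m with hf
  set h := (k : ℂ) • u + (-1 : ℂ) • m with hh
  have hm1 : (-1 : ℂ) • m ∈ momentumDomain ℓ 0 := Submodule.smul_mem _ _ hmd
  have hku : (k : ℂ) • u ∈ momentumDomain ℓ 0 := Submodule.smul_mem _ _ hud
  have hfd : f ∈ momentumDomain ℓ 0 := Submodule.add_mem _ honed hm1
  have hhd : h ∈ momentumDomain ℓ 0 := Submodule.add_mem _ hku hm1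
  have hms : m ∈ sector ℓ 0 := compLp_mem_sector _ _ (Ψ 0).2
  have hfs : f ∈ sector ℓ 0 :=
    Submodule.add_mem _ (coneL2_mem_sector 1) (Submodule.smul_mem _ _ hms)
  have hmz : ∀ᵐ z, m z = ((min 1 (k * ‖u z‖) : ℝ) : ℂ) := coeFn_truncLp_of_isNonneg k (h0 0)
  have hfz : ∀ᵐ z, f z = ((1 - min 1 (k * ‖u z‖) : ℝ) : ℂ) := by
    filter_upwards [Lp.coeFn_add one ((-1 : ℂ) • m), Lp.coeFn_smul (-1 : ℂ) m, hmz,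
      coeFn_coneL2_zero (ℓ := ℓ)] with z e1 e2 e3 e4
    rw [hf, e1, Pi.add_apply, e2, Pi.smul_apply, e3, e4]
    push_cast
    simp [sub_eq_add_neg]
  have hhz : ∀ᵐ z, h z = ((k * ‖u z‖ - min 1 (k * ‖u z‖) : ℝ) : ℂ) := by
    filter_upwards [Lp.coeFn_add ((k : ℂ) • u) ((-1 : ℂ) • m), Lp.coeFn_smul (-1 : ℂ) m, hmz,
      Lp.coeFn_smul (k : ℂ) u, h0 0] with z e1 e2 e3 e4 e5
    have e6 : u z = (‖u z‖ : ℂ) := e5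
    rw [hh, e1, Pi.add_apply, e2, Pi.smul_apply, e3, e4, Pi.smul_apply]
    nth_rw 1 [e6]
    push_cast
    simp [sub_eq_add_neg]
  have hf0 : IsNonneg f := by
    filter_upwards [hfz] with z hz
    rw [hz, Complex.norm_real, Real.norm_of_nonneg (sub_nonneg.mpr (min_le_left _ _))]
  have hh0 : IsNonneg h := by
    filter_upwards [hhz] with z hz
    rw [hz, Complex.norm_real, Real.norm_of_nonneg (sub_nonneg.mpr (min_le_right _ _))]
  have hprod : ∀ᵐ z, f z * h z = 0 := by
    filter_upwards [hfz, hhz] with z e1 e2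
    rw [e1, e2, mul_eq_zero]
    rcases le_total 1 (k * ‖u z‖) with h | h
    · left; simp [h]
    · right; simp [h]
  have hkin := hf0.re_kinetic_nonpos hh0 hfd hhd hprod
  have hin := inner_eq_zero_of_ae_mul_eq_zero hprod
  -- The constant has zero derivative, so `f` and `-m` have the same derivatives.
  have hfm : kinetic f m = -kineticEnergy m := by
    rw [← kinetic_self, kinetic, kinetic, ← Finset.sum_neg_distrib]
    refine Finset.sum_congr rfl fun j _ => ?_
    rw [hf, weakRelDeriv_add honed hm1, weakRelDeriv_smul hmd, weakRelDeriv_coneL2_zero,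
      zero_add, inner_smul_left]
    simp
  rw [hh, kinetic_add_right f hku hm1, kinetic_smul_right _ f hud, kinetic_smul_right _ f hmd,
    hfm] at hkin
  rw [hh, inner_add_right, inner_smul_right, inner_smul_right] at hin
  -- Testing the eigenvalue equation with `f` evaluates `kinetic f u`. The interaction has the
  -- favourable sign, and `k ⟨f, u⟩ = ⟨f, m⟩` eliminates the factor `k`, so the bound is uniform in
  -- `k`.
  have heq := hΨ.2 _ (singleSpace_mem_formSubmodule hfs hfd)
  rw [energyForm_singleSpace hfs hfd hΨ.1 (fun k hk => absurd hk (Nat.succ_ne_zero k)),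
    inner_singleSpace] at heq
  have hre := congrArg Complex.re heq
  have hpair := hf0.re_pairing_nonneg (h0 1)
  have hin' := congrArg Complex.re hin
  simp only [Complex.add_re, Complex.neg_re, Complex.natCast_re,
    Complex.natCast_im, Complex.mul_re, Complex.ofReal_re, Complex.ofReal_im, Complex.ofReal_neg,
    neg_mul, one_mul, CharP.cast_eq_zero, zero_mul, zero_add, add_zero, sub_zero,
    Complex.zero_re, Real.sqrt_one, Complex.ofReal_one, neg_neg] at hre hkin hin'
  have hmle : ‖m‖ ≤ ‖one‖ := by
    refine Lp.norm_le_norm_of_ae_le ?_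
    filter_upwards [hmz, coeFn_coneL2_zero (ℓ := ℓ)] with z e1 e2
    rw [e1, e2, Complex.norm_real, Real.norm_of_nonneg (by positivity)]
    simp
  have hfle : ‖f‖ ≤ ‖one‖ := by
    refine Lp.norm_le_norm_of_ae_le ?_
    filter_upwards [hfz, coeFn_coneL2_zero (ℓ := ℓ)] with z e1 e2
    rw [e1, e2, Complex.norm_real, Real.norm_of_nonneg (sub_nonneg.mpr (min_le_left _ _))]
    have : 0 ≤ min 1 ((k : ℝ) * ‖u z‖) := by positivity
    simpa using this
  have hfm' : |(inner ℂ f m : ℂ).re| ≤ ‖one‖ ^ 2 := by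
    refine (Complex.abs_re_le_norm _).trans ((norm_inner_le_norm f m).trans ?_)
    rw [sq]
    gcongr
  have h1 : -(E * (inner ℂ f m : ℂ).re) ≤ |E| * ‖one‖ ^ 2 :=
    (neg_le_abs _).trans (by rw [abs_mul]; gcongr)
  have h2 : 0 ≤ (k : ℝ) * (g * (pairing f (comp Ψ 1)).re) := by positivity
  have h3 : (inner ℂ f m : ℂ).re = k * (inner ℂ f u : ℂ).re := by linarith
  rw [h3] at h1
  have h4 : (kinetic f u).re = E * (inner ℂ f u : ℂ).re + g * (pairing f (comp Ψ 1)).re := by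
    linarith
  rw [h4] at hkin
  linarith

theorem memLp_indicator_support (f : L2 ℓ 0) :
    MemLp ({z | f z ≠ 0}.indicator (coneL2 ℓ 0 1)) 2 volume :=
  (Lp.memLp (coneL2 ℓ 0 1)).indicator (measurableSet_ne_zero f)

/-- The indicator function of the support of a function without phonons. -/
def supportL2 (f : L2 ℓ 0) : L2 ℓ 0 := (memLp_indicator_support f).toLp _

open Classical in
theorem coeFn_supportL2 (f : L2 ℓ 0) : ∀ᵐ z, supportL2 f z = if f z = 0 then 0 else 1 := by
  filter_upwards [(memLp_indicator_support f).coeFn_toLp, coeFn_coneL2_zero (ℓ := ℓ)] with z h1 h2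
  rw [supportL2, h1]
  by_cases h : f z = 0
  · rw [Set.indicator_of_notMem (not_not_intro h : ¬ f z ≠ 0), if_pos h]
  · rw [Set.indicator_of_mem h, if_neg h, h2]

theorem isZeroOne_supportL2 (f : L2 ℓ 0) : IsZeroOne (supportL2 f) := by
  filter_upwards [coeFn_supportL2 f] with z hz
  rw [hz]
  split_ifs <;> simp

/-- Dominated convergence, with the constant one as majorant: where `f` is positive, the truncations
equal one as soon as `k ‖f z‖ ≥ 1`. -/
theorem tendsto_truncLp {f : L2 ℓ 0} (hf : IsNonneg f) :
    Tendsto (fun k : ℕ => truncLp k f) atTop (𝓝 (supportL2 f)) := by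
  rw [tendsto_iff_norm_sub_tendsto_zero]
  have h2 : Tendsto (fun k : ℕ => ‖truncLp k f - supportL2 f‖ ^ 2) atTop (𝓝 0) := by
    simp only [← integral_norm_sq]
    rw [← integral_zero (Config ℓ 0) ℝ (μ := volume)]
    refine tendsto_integral_of_dominated_convergence (fun z => ‖coneL2 ℓ 0 1 z‖ ^ 2)
      (fun k => (integrable_norm_sq _).aestronglyMeasurable) (integrable_norm_sq _)
      (fun k => ?_) ?_
    · filter_upwards [Lp.coeFn_sub (truncLp k f) (supportL2 f), coeFn_truncLp_of_isNonneg k hf,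
        coeFn_supportL2 f, coeFn_coneL2_zero (ℓ := ℓ)] with z e1 e2 e3 e4
      rw [e1, Pi.sub_apply, e2, e3, e4, norm_pow, norm_norm]
      have h1 : 0 ≤ min 1 ((k : ℝ) * ‖f z‖) := by positivity
      gcongr
      split_ifs with h
      · simp [h]
      · rw [← Complex.ofReal_one, ← Complex.ofReal_sub, Complex.norm_real, Complex.ofReal_one,
          norm_one, Real.norm_eq_abs, abs_le]
        have h2 : min 1 ((k : ℝ) * ‖f z‖) ≤ 1 := min_le_left _ _
        constructor <;> linarith
    · filter_upwards [ae_all_iff.mpr fun k : ℕ => Lp.coeFn_sub (truncLp k f) (supportL2 f),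
        ae_all_iff.mpr fun k : ℕ => coeFn_truncLp_of_isNonneg k hf, coeFn_supportL2 f]
        with z e1 e2 e3
      refine tendsto_const_nhds.congr' ?_
      by_cases h : f z = 0
      · filter_upwards with k
        rw [e1, Pi.sub_apply, e2, e3, if_pos h, h]
        simp
      · obtain ⟨K, hK⟩ := exists_nat_gt (1 / ‖f z‖)
        filter_upwards [eventually_ge_atTop K] with k hk
        have hpos : 0 < ‖f z‖ := norm_pos_iff.mpr h
        have h1 : 1 ≤ (k : ℝ) * ‖f z‖ := by
          rw [div_lt_iff₀ hpos] at hK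
          have : (K : ℝ) ≤ k := by exact_mod_cast hk
          nlinarith
        rw [e1, Pi.sub_apply, e2, e3, if_neg h, min_eq_left h1]
        simp
  have h3 := h2.sqrt
  simpa using h3

/-- The vacuum component of a nonnegative ground state vanishes almost everywhere or almost
nowhere. -/
theorem IsGround.ae_zero_or_ae_ne_zero (hg : 0 ≤ g) {Ψ : Space ℓ} (hΨ : IsGround g E Ψ)
    (h0 : ∀ n, IsNonneg (comp Ψ n)) :
    (∀ᵐ z, comp Ψ 0 z = 0) ∨ ∀ᵐ z, comp Ψ 0 z ≠ 0 := by
  have hflow : ∀ j s, flow j s (supportL2 (comp Ψ 0)) = supportL2 (comp Ψ 0) := by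
    intro j s
    -- The kinetic bound on the truncations does not depend on `k`, so their quadratic estimate
    -- along the flow passes to the limiting indicator.
    refine (isZeroOne_supportL2 (comp Ψ 0)).flow_eq (B := |E| * ‖coneL2 ℓ 0 1‖ ^ 2)
      (fun s => ?_) s
    have hlim := tendsto_truncLp (h0 0)
    have hlim' := ((((flow j s).continuous.tendsto _).comp hlim).sub hlim).norm.pow 2
    refine le_of_tendsto' hlim' fun k => ?_
    have hd : truncLp k (comp Ψ 0) ∈ momentumDomain ℓ 0 :=
      compLp_mem_momentumDomain _ _ ((mem_formSubmodule.mp hΨ.1).1 0)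
    have h1 := (isWeakRelDeriv_weakRelDeriv hd j).norm_flow_sub_le s
    have h2 : ‖weakRelDeriv j (truncLp k (comp Ψ 0))‖ ^ 2 ≤ |E| * ‖coneL2 ℓ 0 1‖ ^ 2 :=
      (Finset.single_le_sum (f := fun j => ‖weakRelDeriv j (truncLp k (comp Ψ 0))‖ ^ 2)
        (fun _ _ => by positivity) (Finset.mem_univ j)).trans
        (hΨ.kineticEnergy_truncLp_le hg h0 k)
    calc ‖flow j s (truncLp k (comp Ψ 0)) - truncLp k (comp Ψ 0)‖ ^ 2
        ≤ (‖weakRelDeriv j (truncLp k (comp Ψ 0))‖ * |s|) ^ 2 := by gcongr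
      _ = ‖weakRelDeriv j (truncLp k (comp Ψ 0))‖ ^ 2 * s ^ 2 := by rw [mul_pow, sq_abs]
      _ ≤ _ := by gcongr
  rcases ae_zero_or_ae_ne_zero_of_translate_eq (translate_eq_of_forall_flow_eq hflow) with h | h
  · left
    filter_upwards [h, coeFn_supportL2 (comp Ψ 0)] with z h1 h2
    by_contra h3
    rw [h1, if_neg h3] at h2
    exact zero_ne_one h2
  · right
    filter_upwards [h, coeFn_supportL2 (comp Ψ 0)] with z h1 h2 h3
    rw [if_pos h3] at h2
    exact h1 h2

/-- The vacuum component of a nonzero nonnegative ground state is almost everywhere nonzero. -/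
theorem IsGround.ae_ne_zero (hg : 0 < g) {Ψ : Space ℓ} (hΨ : IsGround g E Ψ)
    (h0 : ∀ n, IsNonneg (comp Ψ n)) (hne : Ψ ≠ 0) : ∀ᵐ z, comp Ψ 0 z ≠ 0 := by
  refine (hΨ.ae_zero_or_ae_ne_zero hg.le h0).resolve_left fun h => hne ?_
  refine hΨ.eq_zero_of_comp_zero hg h0 ?_
  apply Lp.ext
  filter_upwards [h, Lp.coeFn_zero ℂ 2 (volume : Measure (Config ℓ 0))] with z h1 h2
  rw [h1, h2, Pi.zero_apply]

end Vacuum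

/-! ### Uniqueness of the ground state -/

section Uniqueness

variable {ℓ : ℝ} [Fact (0 < ℓ)] {g E : ℝ}

/-- Two nonzero nonnegative ground states have strictly positive overlap. -/
theorem IsGround.inner_ne_zero (hg : 0 < g) {Ψ Φ : Space ℓ} (hΨ : IsGround g E Ψ)
    (hΦ : IsGround g E Φ) (hΨ0 : ∀ n, IsNonneg (comp Ψ n)) (hΦ0 : ∀ n, IsNonneg (comp Φ n))
    (hΨne : Ψ ≠ 0) (hΦne : Φ ≠ 0) : inner ℂ Ψ Φ ≠ 0 := by
  intro h
  have hs := Complex.hasSum_re (hasSum_inner_comp Ψ Φ)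
  rw [h, Complex.zero_re] at hs
  -- Every sector contributes a nonnegative overlap, so a vanishing sum would make the vacuum
  -- overlap vanish too.
  have h1 := (hasSum_zero_iff_of_nonneg fun n => (hΨ0 n).re_inner_nonneg (hΦ0 n)).mp hs
  have h2 : (inner ℂ (comp Ψ 0) (comp Φ 0)).re = 0 := congrFun h1 0
  rw [(hΨ0 0).inner_eq (hΦ0 0), Complex.ofReal_re] at h2
  have hintegrable : Integrable (fun z => ‖comp Ψ 0 z‖ * ‖comp Φ 0 z‖) volume :=
    (Lp.memLp (comp Ψ 0)).norm.integrable_mul (Lp.memLp (comp Φ 0)).norm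
  rw [integral_eq_zero_iff_of_nonneg (fun z => by positivity) hintegrable] at h2
  have h3 : ∀ᵐ z : Config ℓ 0, False := by
    filter_upwards [h2, hΨ.ae_ne_zero hg hΨ0 hΨne, hΦ.ae_ne_zero hg hΦ0 hΦne] with z e1 e2 e3
    simp [e2, e3] at e1
  have : (ae (volume : Measure (Config ℓ 0))).NeBot := by
    rw [ae_neBot, ← Measure.measure_univ_ne_zero]
    exact isOpen_univ.measure_ne_zero _ Set.univ_nonempty
  exact h3.exists.choose_spec

/-- A real ground state is nonnegative up to a sign. -/
theorem IsGround.nonneg_or_nonpos (hg : 0 < g)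
    (hlow : ∀ Φ ∈ formSubmodule ℓ, E * ‖Φ‖ ^ 2 ≤ (energyForm ℓ (-g) Φ Φ).re)
    {Ψ : Space ℓ} (hΨ : IsGround g E Ψ) (hreal : Polaron.conjSpace Ψ = Ψ) :
    ∃ (Φ : Space ℓ) (c : ℂ), Ψ = c • Φ ∧ IsGround g E Φ ∧ ∀ n, IsNonneg (comp Φ n) := by
  obtain ⟨hp, hm⟩ := hΨ.posSpace_negSpace hg.le hlow hreal
  have hdec := eq_posSpace_add_negSpace hreal
  by_cases h1 : posSpace Ψ = 0
  · refine ⟨_, -1, ?_, hm, isNonneg_negSpace Ψ⟩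
    rwa [h1, zero_add] at hdec
  by_cases h2 : negSpace Ψ = 0
  · refine ⟨_, 1, ?_, hp, isNonneg_posSpace Ψ⟩
    rwa [h2, smul_zero, add_zero, ← one_smul ℂ (posSpace Ψ)] at hdec
  exact absurd (inner_eq_zero_of_disjoint (posSpace_mul_negSpace Ψ))
    (hp.inner_ne_zero hg hm (isNonneg_posSpace Ψ) (isNonneg_negSpace Ψ) h1 h2)

theorem conjSpace_eq_of_isNonneg {Ψ : Space ℓ} (h : ∀ n, IsNonneg (comp Ψ n)) :
    conjSpace Ψ = Ψ := by
  refine space_ext fun n => ?_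
  rw [comp_conjSpace]
  apply Lp.ext
  filter_upwards [Lp.coeFn_star (comp Ψ n), h n] with z h1 h2
  rw [h1, Pi.star_apply, h2, RCLike.star_def, Complex.conj_ofReal]

/-- A real ground state is a multiple of any nonzero nonnegative ground state. -/
theorem IsGround.mem_span_of_real (hg : 0 < g)
    (hlow : ∀ Φ ∈ formSubmodule ℓ, E * ‖Φ‖ ^ 2 ≤ (energyForm ℓ (-g) Φ Φ).re)
    {Ψ Φ : Space ℓ} (hΨ : IsGround g E Ψ) (hΨ0 : ∀ n, IsNonneg (comp Ψ n)) (hne : Ψ ≠ 0)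
    (hΦ : IsGround g E Φ) (hreal : Polaron.conjSpace Φ = Φ) : Φ ∈ Submodule.span ℂ {Ψ} := by
  have hΨreal := conjSpace_eq_of_isNonneg hΨ0
  have hΨΨ : inner ℂ Ψ Ψ ≠ 0 := inner_self_ne_zero.mpr hne
  -- The projection coefficient is real because both states are. The remainder is thus a real ground
  -- state orthogonal to `Ψ`, hence a multiple of a nonnegative one, and strict overlap leaves only
  -- zero.
  set c : ℂ := inner ℂ Ψ Φ / inner ℂ Ψ Ψ with hc
  have hcr : conj c = c := by
    rw [hc, map_div₀, ← inner_conjSpace, ← inner_conjSpace, hΨreal, hreal]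
  have hD : IsGround g E (Φ + (-c) • Ψ) := hΦ.add (hΨ.smul (-c))
  have hDreal : Polaron.conjSpace (Φ + (-c) • Ψ) = Φ + (-c) • Ψ := by
    rw [conjSpace_add, conjSpace_smul, hΨreal, hreal, map_neg, hcr]
  obtain ⟨w, a, hw, hwg, hw0⟩ := hD.nonneg_or_nonpos hg hlow hDreal
  have hperp : inner ℂ Ψ (Φ + (-c) • Ψ) = 0 := by
    rw [inner_add_right, inner_smul_right, hc, neg_mul, div_mul_cancel₀ _ hΨΨ, add_neg_cancel]
  have hzero : Φ + (-c) • Ψ = 0 := by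
    rw [hw, inner_smul_right, mul_eq_zero] at hperp
    rcases hperp with h | h
    · rw [hw, h, zero_smul]
    · by_cases hw' : w = 0
      · rw [hw, hw', smul_zero]
      · exact absurd h (hΨ.inner_ne_zero hg hwg hΨ0 hw0 hne hw')
  rw [neg_smul, ← sub_eq_add_neg, sub_eq_zero] at hzero
  exact Submodule.mem_span_singleton.mpr ⟨c, hzero.symm⟩

/-- The decomposition of a ground state into a real and an imaginary ground state. -/
theorem IsGround.exists_real_imag {Ψ : Space ℓ} (hΨ : IsGround g E Ψ) :
    ∃ A B : Space ℓ, (IsGround g E A ∧ Polaron.conjSpace A = A) ∧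
      (IsGround g E B ∧ Polaron.conjSpace B = B) ∧ Ψ = A + Complex.I • B := by
  refine ⟨(1 / 2 : ℂ) • (Ψ + Polaron.conjSpace Ψ),
    (-Complex.I / 2) • (Ψ + (-1 : ℂ) • Polaron.conjSpace Ψ),
    ⟨(hΨ.add hΨ.conjSpace).smul _, ?_⟩, ⟨(hΨ.add (hΨ.conjSpace.smul _)).smul _, ?_⟩, ?_⟩
  · rw [conjSpace_smul, conjSpace_add, conjSpace_conjSpace, add_comm Ψ, map_div₀, map_one,
      map_ofNat]
  · rw [conjSpace_smul, conjSpace_add, conjSpace_smul, conjSpace_conjSpace]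
    simp only [map_div₀, map_neg, Complex.conj_I, neg_neg, map_one, map_ofNat]
    module
  · rw [smul_smul]
    have : Complex.I * (-Complex.I / 2) = 1 / 2 := by
      rw [mul_div_assoc', mul_neg, Complex.I_mul_I, neg_neg]
    rw [this]
    module

/-- The ground states form a complex line, if there are any besides `0`. -/
theorem exists_span_eq_of_isGround (hg : 0 < g)
    (hlow : ∀ Φ ∈ formSubmodule ℓ, E * ‖Φ‖ ^ 2 ≤ (energyForm ℓ (-g) Φ Φ).re)
    {Ψ : Space ℓ} (hΨ : IsGround g E Ψ) (hne : Ψ ≠ 0) :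
    ∃ Ψ₀ : Space ℓ, Ψ₀ ≠ 0 ∧ ∀ Φ, IsGround g E Φ ↔ Φ ∈ Submodule.span ℂ {Ψ₀} := by
  obtain ⟨R, hR, hRreal, hR0⟩ : ∃ R, IsGround g E R ∧ Polaron.conjSpace R = R ∧ R ≠ 0 := by
    obtain ⟨A, B, ⟨hA, hA'⟩, ⟨hB, hB'⟩, h⟩ := hΨ.exists_real_imag
    by_cases hA0 : A = 0
    · refine ⟨B, hB, hB', fun hB0 => hne ?_⟩
      rw [h, hA0, hB0, smul_zero, add_zero]
    · exact ⟨A, hA, hA', hA0⟩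
  obtain ⟨Ψ₀, c, h, hΨ₀, hnonneg⟩ := hR.nonneg_or_nonpos hg hlow hRreal
  have hΨ₀ne : Ψ₀ ≠ 0 := fun h0 => hR0 (by rw [h, h0, smul_zero])
  refine ⟨Ψ₀, hΨ₀ne, fun Φ => ⟨fun hΦ => ?_, fun hΦ => ?_⟩⟩
  · obtain ⟨A, B, ⟨hA, hA'⟩, ⟨hB, hB'⟩, hAB⟩ := hΦ.exists_real_imag
    rw [hAB]
    exact Submodule.add_mem _ (hΨ₀.mem_span_of_real hg hlow hnonneg hΨ₀ne hA hA')
      (Submodule.smul_mem _ _ (hΨ₀.mem_span_of_real hg hlow hnonneg hΨ₀ne hB hB'))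
  · obtain ⟨a, rfl⟩ := Submodule.mem_span_singleton.mp hΦ
    exact hΨ₀.smul a

theorem flipSpace_ne_zero {Ψ : Space ℓ} (h : Ψ ≠ 0) : flipSpace Ψ ≠ 0 := by
  intro h0
  have h1 := flipSpace_smul 0 (flipSpace Ψ)
  rw [zero_smul, zero_smul, ← h0, flipSpace_flipSpace, h0] at h1
  exact h h1

/-- Testing with `Θ` and with its flip is equivalent, since `flipSpace` is an involution preserving
both the form domain and the inner product. -/
theorem mem_opEigenspace_iff_isGround (α : ℝ) (Ψ : Space ℓ) :
    Ψ ∈ opEigenspace (hamiltonian ℓ α) (E : ℂ) ↔ IsGround (√α) E (flipSpace Ψ) := by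
  have hflip : ∀ Θ ∈ formSubmodule ℓ, ∀ Φ ∈ formSubmodule ℓ,
      energyForm ℓ (-√α) Θ (flipSpace Φ) = energyForm ℓ (√α) (flipSpace Θ) Φ := by
    intro Θ hΘ Φ hΦ
    rw [← energyForm_flipSpace (√α) hΘ (flipSpace_mem_formSubmodule hΦ), flipSpace_flipSpace]
  have hinner : ∀ Θ Φ : Space ℓ, inner ℂ Θ (flipSpace Φ) = inner ℂ (flipSpace Θ) Φ := by
    intro Θ Φ
    rw [← inner_flipSpace, flipSpace_flipSpace]
  constructor
  · rintro ⟨h1, h2⟩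
    have h1' : Ψ ∈ formSubmodule ℓ := h1
    refine ⟨flipSpace_mem_formSubmodule h1', fun Θ hΘ => ?_⟩
    rw [hflip Θ hΘ Ψ h1', hinner, ← inner_smul_right]
    exact h2 (flipSpace Θ) (flipSpace_mem_formSubmodule hΘ)
  · rintro ⟨h1, h2⟩
    have h1' : Ψ ∈ formSubmodule ℓ := by
      simpa only [flipSpace_flipSpace] using flipSpace_mem_formSubmodule h1
    refine ⟨h1', fun Θ hΘ => ?_⟩
    have hΘ' : flipSpace Θ ∈ formSubmodule ℓ := flipSpace_mem_formSubmodule hΘ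
    have h3 := h2 (flipSpace Θ) hΘ'
    rw [hflip _ hΘ' Ψ h1', hinner, flipSpace_flipSpace, ← inner_smul_right] at h3
    exact h3

end Uniqueness

end Polaron

end

/-! ### Multiplicity of the lowest eigenvalue -/

theorem proposition2p1 (α : ℝ) (hα : 0 < α) (ℓ : ℝ) [Fact (0 < ℓ)] (E : ℝ)
    (hE : IsGLB {t : ℝ | (t : ℂ) ∈ Polaron.opSpectrum (Polaron.hamiltonian ℓ α)} E)
    (hev : Polaron.IsOpEigenvalue (Polaron.hamiltonian ℓ α) (E : ℂ)) :
    Polaron.HasOpMultiplicityOne (Polaron.hamiltonian ℓ α) (E : ℂ) := by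
  open Polaron in
  have hg : 0 < √α := Real.sqrt_pos.mpr hα
  obtain ⟨C, hC⟩ := exists_energyForm_lower_bound (ℓ := ℓ) (√α)
  -- The spectral lower bound for the original form, evaluated at the flipped state, is the lower
  -- bound for the form with reversed coupling.
  have hlow : ∀ Φ ∈ formSubmodule ℓ, E * ‖Φ‖ ^ 2 ≤ (energyForm ℓ (-√α) Φ Φ).re := by
    intro Φ hΦ
    have h := (isHermitianFormOn_energyForm (√α)).mul_norm_sq_le_of_isGLB hC hE.1
      (flipSpace_mem_formSubmodule hΦ)
    rwa [← re_inner_self_eq, inner_flipSpace, re_inner_self_eq, energyForm_flipSpace _ hΦ hΦ] at h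
  obtain ⟨Ψ, hΨ, hne⟩ := hev
  rw [mem_opEigenspace_iff_isGround] at hΨ
  obtain ⟨Ψ₀, hΨ₀, hspan⟩ := exists_span_eq_of_isGround hg hlow hΨ (flipSpace_ne_zero hne)
  refine ⟨flipSpace Ψ₀, flipSpace_ne_zero hΨ₀, ?_⟩
  ext Φ
  rw [mem_opEigenspace_iff_isGround, hspan, SetLike.mem_coe, Submodule.mem_span_singleton,
    Submodule.mem_span_singleton]
  refine exists_congr fun a => ?_
  rw [← flipSpace_smul]
  constructor
  · intro h
    rw [h, flipSpace_flipSpace]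
  · rintro rfl
    rw [flipSpace_flipSpace]
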